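/- **Setting.** Let $P$ be the law of a unit $(X,S(0),S(1),Y(0),Y(1))$, with covariates $X\in\mathbb R^d$, surrogates $S=(S(0),S(1))$ and potential outcomes $Y(0),Y(1)$. Assume the joint linear model: for $z\in\{0,1\}$, $$Y(z)=\alpha_{Y,z}^{\mathsf T}X+\varepsilon_Y(z),\qquad S(z)=\alpha_{S,z}^{\mathsf T}X+\varepsilon_S(z),\qquad \varepsilon_Y(z)=\gamma_z\varepsilon_S(z)+\varepsilon(z),$$ where $\mathbb E[\varepsilon_Y(z)\mid X]=\mathbb E[\varepsilon_S(z)\mid X]=\mathbb E[\varepsilon_S(0)\varepsilon_S(1)\mid X]=0$, $\operatorname{var}(\varepsilon_Y(z)\mid X)=\sigma_{Y,z}^2>0$, $\operatorname{var}(\varepsilon_S(z)\mid X)=\sigma_{S,z}^2>0$, $\mathbb E[\varepsilon(z)\mid X,S(0),S(1)]=0$ and $\operatorname{var}(\varepsilon(z)\mid X,S(z))=\sigma_z^2>0$. Hence $\mu_z(X,S):=(\alpha_{Y,z}-\gamma_z\alpha_{S,z})^{\mathsf T}X+\gamma_zS(z)$ is the conditional mean of $Y(z)$ given $(X,S)$.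 Assume that the errors are sub-Gaussian: for some constants $v>0$ and $K>0$ and each $\varepsilon\in\{\varepsilon_Y(z),\varepsilon_S(z)\}$, $\mathbb E[e^{\lambda\varepsilon}\mid X]\le e^{v^2\lambda^2/2}$ for all $\lambda\in\mathbb R$, and $\|\varepsilon\|_{\psi_2}\le K$. Assume that $X$ takes values in a compact set and that $\lambda_{\min}(\mathbb E XX^{\mathsf T})>0$. **Design.** Fix a clipping rate $\eta>0$, a horizon $T$ and an initialization length $T_0$. At stage $t=1,\dots,T$ a unit $(X_t,S_t,Y_t(0),Y_t(1))$ is drawn from $P$, the units being i.i.d. and the unit of stage $t$ being independent of the history $\mathcal F_{t-1}=\sigma(X_j,Z_j,S_j,Y_j:j<t)$. A treatment $Z_t\in\{0,1\}$ is assigned, and $X_t,Z_t,S_t$ and $Y_t=Y_t(Z_t)$ are observed. Let $G_{z,t}=\{j\le t:Z_j=z\}$. Let $\hat\alpha_{S,z,t}$ be the least squares coefficient of $S_j(z)$ on $X_j$ over $j\le t$, let $\hat\alpha_{Y,z,t}$ be that of $Y_j$ on $X_j$ over $j\in G_{z,t}$, and put $$\hat\gamma_{z,t}=\frac{\sum_{j\in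 G_{z,t}}(Y_j-\hat\alpha_{Y,z,t}^{\mathsf T}X_j)(S_j(z)-\hat\alpha_{S,z,t}^{\mathsf T}X_j)}{\sum_{j\in G_{z,t}}(S_j(z)-\hat\alpha_{S,z,t}^{\mathsf T}X_j)^2},\qquad \hat\mu_{z,t}(x,s)=(\hat\alpha_{Y,z,t}-\hat\gamma_{z,t}\hat\alpha_{S,z,t})^{\mathsf T}x+\hat\gamma_{z,t}s(z),$$ $$\hat\sigma_{z,t}^2=|G_{z,t}|^{-1}\sum_{j\in G_{z,t}}\{Y_j-\hat\mu_{z,t}(X_j,S_j)\}^2,$$ where inverses of singular matrices and quotients by $0$ are read as $0$. For $t\le T_0$, $Z_t=0$ if $t$ is odd and $Z_t=1$ if $t$ is even, and the action is $a_t=(1/2,0,0)$. For $T_0<t\le T$ the action is $a_t=(\pi_t,\hat\mu_{0,t-1},\hat\mu_{1,t-1})$ with $$\pi_t=\zeta_t\vee\Big\{\frac{\hat\sigma_{1,t-1}}{\hat\sigma_{1,t-1}+\hat\sigma_{0,t-1}}\wedge(1-\zeta_t)\Big\},\qquad \zeta_t=\tfrac12t^{-\eta},$$ and $Z_t=1$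 with conditional probability $\pi_t$ given $\mathcal F_{t-1}$ and the unit of stage $t$. **Regret.** For an action $a=(\pi,g_0,g_1)$ the loss $\ell(a)$ is the variance of $$g_1(X,S)-g_0(X,S)+\pi^{-1}I(Z=1)\{Y(1)-g_1(X,S)\}-(1-\pi)^{-1}I(Z=0)\{Y(0)-g_0(X,S)\},$$ where the unit has law $P$ and, independently, $Z=1$ with probability $\pi$ and $Z=0$ otherwise. Let $\pi^*=\sigma_1/(\sigma_0+\sigma_1)$, $\underline\pi=\pi^*\wedge(1-\pi^*)$ and $a^*=(\pi^*,\mu_0,\mu_1)$. The regret is $\mathcal R_T=\sum_{t=1}^T\ell(a_t)-T\,\ell(a^*)$. **Length of the initialization phase.** Let $\delta=T^{-1}$ and $$T_0=\left\lceil\frac{8C_4^2}{\sigma_0^4\wedge\sigma_1^4\wedge(2^{-5}\sigma_0^2\sigma_1^2\underline\pi)}\vee\frac{16C_0^2}{\underline\pi^2}\vee\frac1{(2\underline\pi)^{1/\eta}}\right\rceil,\qquad C_0=0.85\sqrt{\log\log T+0.72\log(5.2/\delta)},$$ where $c_0\sqrt{\log T+\log(T/\delta)}\le C_4\le c_1\sqrt{\log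 T+\log(T/\delta)}$, so that $T_0\asymp\log(T/\delta)$. **Theorem.** There is a constant $c_0>0$, depending only on $P$ and the model parameters, such that for all $\eta>0$ and $c_1$ there are constants $C$ and $k\in\mathbb N$, depending only on $P$, the model parameters, $\eta$ and $c_1$, with the following property. For every $T\ge3$, every $C_4$ and $T_0$ as above, every realization of the design with horizon $T$, and every number $\ell_{\max}\ge\ell(a^*)$ such that almost surely $\max_{1\le t\le T}\ell(a_t)\le\ell_{\max}$, the regret $\mathcal R_T$ is integrable and $$\mathbb E\,\mathcal R_T\le C(\log T)^2\{\log((\log T)^2)\}^k+2\{\ell_{\max}-\ell(a^*)\}.$$ In particular $\mathbb E\,\mathcal R_T=\widetilde O((\log T)^2)$ whenever $\ell_{\max}$ does not depend on $T$; here $a_T=\widetilde O(b_T)$ means $a_T=O(b_T\log^k b_T)$ for some $k\ge0$. -/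

import Mathlib

open MeasureTheory ProbabilityTheory
open scoped Matrix

noncomputable section

namespace SLOACI

/-! ### The superpopulation and the joint linear model -/

/-- A unit `(x, s, y)`: covariates `x`, the pair of surrogates `s = (s(0), s(1))` and the pair of
potential outcomes `y = (y(0), y(1))`.  The arms are `0, 1 : Fin 2`. -/
abbrev Subject (d : ℕ) := (Fin d → ℝ) × (Fin 2 → ℝ) × (Fin 2 → ℝ)

/-- Covariates of a unit. -/
def Subject.x {d : ℕ} (w : Subject d) : Fin d → ℝ := w.1

/-- Surrogates of a unit (both are observable). -/
def Subject.s {d : ℕ} (w : Subject d) : Fin 2 → ℝ := w.2.1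

/-- Potential primary outcomes of a unit. -/
def Subject.y {d : ℕ} (w : Subject d) : Fin 2 → ℝ := w.2.2

/-- Parameters of the joint linear model. -/
structure Params (d : ℕ) where
  /-- regression coefficients of the primary outcomes -/
  αY : Fin 2 → Fin d → ℝ
  /-- regression coefficients of the surrogates -/
  αS : Fin 2 → Fin d → ℝ
  /-- linear coefficients of the surrogate errors in the outcome errors -/
  γ : Fin 2 → ℝ
  /-- standard deviations of `ε_Y(z)` given the covariates -/
  σY : Fin 2 → ℝ
  /-- standard deviations of `ε_S(z)` given the covariates -/
  σS : Fin 2 → ℝ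
  /-- standard deviations of the remaining noises `ε(z)` -/
  σ : Fin 2 → ℝ

namespace Params

variable {d : ℕ} (θ : Params d)

/-- `ε_Y(z) = Y(z) - α_{Y,z}ᵀ X`. -/
def εY (z : Fin 2) (w : Subject d) : ℝ := w.y z - θ.αY z ⬝ᵥ w.x

/-- `ε_S(z) = S(z) - α_{S,z}ᵀ X`. -/
def εS (z : Fin 2) (w : Subject d) : ℝ := w.s z - θ.αS z ⬝ᵥ w.x

/-- `ε(z) = ε_Y(z) - γ_z ε_S(z)`. -/
def ε (z : Fin 2) (w : Subject d) : ℝ := θ.εY z w - θ.γ z * θ.εS z w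

/-- `μ_z(x, s) = (α_{Y,z} - γ_z α_{S,z})ᵀ x + γ_z s(z)`. -/
def condMean (z : Fin 2) (x : Fin d → ℝ) (s : Fin 2 → ℝ) : ℝ :=
  (θ.αY z - θ.γ z • θ.αS z) ⬝ᵥ x + θ.γ z * s z

/-- The oracle allocation `π* = σ₁ / (σ₀ + σ₁)`. -/
def πStar : ℝ := θ.σ 1 / (θ.σ 0 + θ.σ 1)

/-- `π* ∧ (1 - π*)`. -/
def πLow : ℝ := min θ.πStar (1 - θ.πStar)

end Params

/-- The σ-algebra on units generated by the covariates. -/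
abbrev sigmaX (d : ℕ) : MeasurableSpace (Subject d) :=
  MeasurableSpace.comap (fun w : Subject d => w.x) inferInstance

/-- The σ-algebra generated by the covariates and the surrogate of arm `z`. -/
abbrev sigmaXSz (d : ℕ) (z : Fin 2) : MeasurableSpace (Subject d) :=
  MeasurableSpace.comap (fun w : Subject d => (w.x, w.s z)) inferInstance

/-- The σ-algebra generated by the covariates and both surrogates. -/
abbrev sigmaXS (d : ℕ) : MeasurableSpace (Subject d) :=
  MeasurableSpace.comap (fun w : Subject d => (w.x, w.s)) inferInstance

/-- The joint linear model for the law `P` of a unit, with parameters `θ`. -/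
structure LinearModel {d : ℕ} (P : Measure (Subject d)) (θ : Params d) : Prop where
  σY_pos : ∀ z, 0 < θ.σY z
  σS_pos : ∀ z, 0 < θ.σS z
  σ_pos : ∀ z, 0 < θ.σ z
  /-- `E{ε_Y(z) | X} = 0` -/
  mean_εY : ∀ z, P[θ.εY z | sigmaX d] =ᵐ[P] fun _ => 0
  /-- `E{ε_S(z) | X} = 0` -/
  mean_εS : ∀ z, P[θ.εS z | sigmaX d] =ᵐ[P] fun _ => 0
  /-- `var{ε_Y(z) | X} = σ_{Y,z}²` -/
  var_εY : ∀ z, Var[θ.εY z; P | sigmaX d] =ᵐ[P] fun _ => θ.σY z ^ 2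
  /-- `var{ε_S(z) | X} = σ_{S,z}²` -/
  var_εS : ∀ z, Var[θ.εS z; P | sigmaX d] =ᵐ[P] fun _ => θ.σS z ^ 2
  /-- `E{ε_S(0) ε_S(1) | X} = 0` -/
  uncorr_εS : P[fun w => θ.εS 0 w * θ.εS 1 w | sigmaX d] =ᵐ[P] fun _ => 0
  /-- `E{ε(z) | X, S(0), S(1)} = 0`, that is, `μ_z(X, S)` is the conditional mean of `Y(z)`
  given `(X, S)` -/
  mean_ε : ∀ z, P[θ.ε z | sigmaXS d] =ᵐ[P] fun _ => 0
  /-- `var{ε(z) | X, S(z)} = σ_z²` -/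
  var_ε : ∀ z, Var[θ.ε z; P | sigmaXSz d z] =ᵐ[P] fun _ => θ.σ z ^ 2

/-- `E[exp(lam * e) | X] ≤ exp(v² lam² / 2)` for all real `lam`, for some `v > 0`. -/
def CondSubGaussian {d : ℕ} (P : Measure (Subject d)) (e : Subject d → ℝ) : Prop :=
  ∃ v : ℝ, 0 < v ∧ ∀ lam : ℝ, Integrable (fun w => Real.exp (lam * e w)) P ∧
    P[fun w => Real.exp (lam * e w) | sigmaX d] ≤ᵐ[P] fun _ => Real.exp (v ^ 2 * lam ^ 2 / 2)

/-- Finite sub-Gaussian (`ψ₂`) norm: `E exp(e² / K²) ≤ 2` for some `K > 0`. -/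
def FinitePsiTwo {d : ℕ} (P : Measure (Subject d)) (e : Subject d → ℝ) : Prop :=
  ∃ K : ℝ, 0 < K ∧ ∫⁻ w, ENNReal.ofReal (Real.exp (e w ^ 2 / K ^ 2)) ∂P ≤ 2

/-- Sub-Gaussian model errors. -/
structure SubGaussianErrors {d : ℕ} (P : Measure (Subject d)) (θ : Params d) : Prop where
  cond_εY : ∀ z, CondSubGaussian P (θ.εY z)
  cond_εS : ∀ z, CondSubGaussian P (θ.εS z)
  psi_εY : ∀ z, FinitePsiTwo P (θ.εY z)
  psi_εS : ∀ z, FinitePsiTwo P (θ.εS z)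

/-- The second moment matrix `E X Xᵀ`. -/
def secondMoment {d : ℕ} (P : Measure (Subject d)) : Matrix (Fin d) (Fin d) ℝ :=
  Matrix.of fun i j => ∫ w, w.x i * w.x j ∂P

theorem secondMoment_isHermitian {d : ℕ} (P : Measure (Subject d)) :
    (secondMoment P).IsHermitian := by
  ext i j
  simp [secondMoment, mul_comm]

/-- The smallest eigenvalue of `E X Xᵀ` (it is `0` in the excluded case `d = 0`). -/
def lambdaMin {d : ℕ} (P : Measure (Subject d)) : ℝ :=
  ⨅ i, (secondMoment_isHermitian P).eigenvalues i

/-- Compact covariate domain and `λ_min(E X Xᵀ) > 0`. -/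
structure CovariateCondition {d : ℕ} (P : Measure (Subject d)) : Prop where
  compact : ∃ K : Set (Fin d → ℝ), IsCompact K ∧ ∀ᵐ w ∂P, w.x ∈ K
  lambdaMin_pos : 0 < lambdaMin P

/-! ### Actions, loss -/

/-- An action `(π, g₀, g₁)`: an allocation and a pair of (estimated) conditional mean functions. -/
structure Action (d : ℕ) where
  prob : ℝ
  mean : Fin 2 → (Fin d → ℝ) → (Fin 2 → ℝ) → ℝ

/-- The single-stage AIPW estimate of the average treatment effect under the action `a`, for a unit
`w` with assigned treatment `z`. -/
def phi {d : ℕ} (a : Action d) (w : Subject d) (z : Fin 2) : ℝ :=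
  a.mean 1 w.x w.s - a.mean 0 w.x w.s
    + (if z = 1 then (w.y 1 - a.mean 1 w.x w.s) / a.prob else 0)
    - (if z = 0 then (w.y 0 - a.mean 0 w.x w.s) / (1 - a.prob) else 0)

/-- The law of a treatment that is `1` with probability `p` and `0` with probability `1 - p`. -/
def assignLaw (p : ℝ) : Measure (Fin 2) :=
  ENNReal.ofReal p • Measure.dirac 1 + ENNReal.ofReal (1 - p) • Measure.dirac 0

/-- The loss `ℓ(a)`: the variance of `phi` under the action `a`, where a unit is drawn from `P`
and, independently, its treatment is `1` with probability `a.prob`. -/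
def loss {d : ℕ} (P : Measure (Subject d)) (a : Action d) : ℝ :=
  Var[fun q : Subject d × Fin 2 => phi a q.1 q.2; P.prod (assignLaw a.prob)]

/-- The optimal action `a* = (π*, μ₀, μ₁)`. -/
def optAction {d : ℕ} (θ : Params d) : Action d where
  prob := θ.πStar
  mean := θ.condMean

/-! ### Estimators computed from the observed data

`D j = (x_j, z_j, s_j, y_j)` is the observation of stage `j`; stages are numbered from `1`.
An inverse of a singular matrix and a quotient by zero are read as zero. -/

/-- An observation `(x, z, s, y)`. -/
abbrev Obs (d : ℕ) := (Fin d → ℝ) × Fin 2 × (Fin 2 → ℝ) × ℝ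

/-- What is observed of a unit `w` under treatment `z`: the outcome is `w.y z`. -/
def observe {d : ℕ} (w : Subject d) (z : Fin 2) : Obs d := (w.x, z, w.s, w.y z)

section Estimators

variable {d : ℕ} (D : ℕ → Obs d)

/-- Covariates of stage `j`. -/
def xAt (j : ℕ) : Fin d → ℝ := (D j).1

/-- Treatment of stage `j`. -/
def zAt (j : ℕ) : Fin 2 := (D j).2.1

/-- Surrogates of stage `j`. -/
def sAt (j : ℕ) : Fin 2 → ℝ := (D j).2.2.1

/-- Observed outcome of stage `j`. -/
def yAt (j : ℕ) : ℝ := (D j).2.2.2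

/-- `G_{z,t}`: the stages up to `t` with treatment `z`. -/
def arm (z : Fin 2) (t : ℕ) : Finset ℕ := (Finset.Icc 1 t).filter fun j => zAt D j = z

/-- Least squares coefficients of the responses `r j` on the covariates, over the stages in `I`. -/
def ols (I : Finset ℕ) (r : ℕ → ℝ) : Fin d → ℝ :=
  (∑ j ∈ I, Matrix.vecMulVec (xAt D j) (xAt D j))⁻¹ *ᵥ ∑ j ∈ I, r j • xAt D j

/-- `α̂_{S,z,t}`, from all stages up to `t`. -/
def αSHat (z : Fin 2) (t : ℕ) : Fin d → ℝ := ols D (Finset.Icc 1 t) fun j => sAt D j z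

/-- `α̂_{Y,z,t}`, from the stages up to `t` with treatment `z`. -/
def αYHat (z : Fin 2) (t : ℕ) : Fin d → ℝ := ols D (arm D z t) (yAt D)

/-- `γ̂_{z,t}`. -/
def γHat (z : Fin 2) (t : ℕ) : ℝ :=
  (∑ j ∈ arm D z t, (yAt D j - αYHat D z t ⬝ᵥ xAt D j) * (sAt D j z - αSHat D z t ⬝ᵥ xAt D j)) /
    ∑ j ∈ arm D z t, (sAt D j z - αSHat D z t ⬝ᵥ xAt D j) ^ 2

/-- `μ̂_{z,t}(x, s)`. -/
def μHat (z : Fin 2) (t : ℕ) (x : Fin d → ℝ) (s : Fin 2 → ℝ) : ℝ :=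
  (αYHat D z t - γHat D z t • αSHat D z t) ⬝ᵥ x + γHat D z t * s z

/-- `σ̂_{z,t}`, the square root of the mean squared residual. -/
def σHat (z : Fin 2) (t : ℕ) : ℝ :=
  Real.sqrt ((∑ j ∈ arm D z t, (yAt D j - μHat D z t (xAt D j) (sAt D j)) ^ 2) / (arm D z t).card)

/-- `π̃_t = σ̂_{1,t-1} / (σ̂_{1,t-1} + σ̂_{0,t-1})`. -/
def πTilde (t : ℕ) : ℝ := σHat D 1 (t - 1) / (σHat D 1 (t - 1) + σHat D 0 (t - 1))

/-- The clipping threshold `ζ_t = t^{-η} / 2`. -/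
def ζ (η : ℝ) (t : ℕ) : ℝ := 1 / 2 * (t : ℝ) ^ (-η)

/-- `CLIP(π̃_t, ζ_t, 1 - ζ_t)`. -/
def πClip (η : ℝ) (t : ℕ) : ℝ := max (ζ η t) (min (πTilde D t) (1 - ζ η t))

/-- The action `a_t = (π_t, μ̂_{0,t-1}, μ̂_{1,t-1})` of the design: `(1/2, 0, 0)` in the
initialization phase `t ≤ T₀`, and the clipped estimated Neyman allocation with the current
estimators in the concentration phase `t > T₀`.  It depends on `D 1, …, D (t - 1)` only. -/
def action (η : ℝ) (T₀ t : ℕ) : Action d :=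
  if t ≤ T₀ then ⟨1 / 2, fun _ _ _ => 0⟩ else ⟨πClip D η t, fun z => μHat D z (t - 1)⟩

end Estimators

/-! ### The design as a stochastic process -/

section Design

variable {d : ℕ} {Ω : Type*}

/-- The observed data sequence. -/
def data (W : ℕ → Ω → Subject d) (Z : ℕ → Ω → Fin 2) (ω : Ω) (j : ℕ) : Obs d :=
  observe (W j ω) (Z j ω)

/-- `F_t`, the σ-algebra generated by the observations of stages `1, …, t`. -/
abbrev history (W : ℕ → Ω → Subject d) (Z : ℕ → Ω → Fin 2) (t : ℕ) : MeasurableSpace Ω :=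
  ⨆ j ∈ Finset.Icc 1 t, MeasurableSpace.comap (fun ω => data W Z ω j) inferInstance

/-- The design with horizon `T`, initialization length `T₀` and clipping rate `η`, run on units
`W 1, …, W T` drawn from `P` with assigned treatments `Z 1, …, Z T`. -/
structure IsDesign [MeasurableSpace Ω] (μ : Measure Ω) (P : Measure (Subject d)) (η : ℝ)
    (T T₀ : ℕ) (W : ℕ → Ω → Subject d) (Z : ℕ → Ω → Fin 2) : Prop where
  meas_W : ∀ t ∈ Finset.Icc 1 T, Measurable (W t)
  meas_Z : ∀ t ∈ Finset.Icc 1 T, Measurable (Z t)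
  /-- the units are identically distributed -/
  law : ∀ t ∈ Finset.Icc 1 T, μ.map (W t) = P
  /-- the units are independent -/
  iIndep : iIndepFun (fun t : Fin T => W (t + 1)) μ
  /-- the unit of stage `t` is drawn independently of the history -/
  indep_history : ∀ t ∈ Finset.Icc 1 T,
    Indep (MeasurableSpace.comap (W t) inferInstance) (history W Z (t - 1)) μ
  /-- initialization: control at odd stages, treatment at even stages -/
  init : ∀ t ∈ Finset.Icc 1 T, t ≤ T₀ → ∀ ω, Z t ω = if Odd t then 0 else 1
  /-- concentration: given the history and the unit, the treatment is `1` with probability `π_t` -/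
  assign : ∀ t ∈ Finset.Icc 1 T, T₀ < t →
    μ[(Z t ⁻¹' {1}).indicator (fun _ => (1 : ℝ)) |
      history W Z (t - 1) ⊔ MeasurableSpace.comap (W t) inferInstance]
      =ᵐ[μ] fun ω => (action (data W Z ω) η T₀ t).prob

/-- The regret `R_T = ∑_{t ≤ T} ℓ(a_t) - T ℓ(a*)`. -/
def regret (P : Measure (Subject d)) (θ : Params d) (η : ℝ) (T T₀ : ℕ)
    (W : ℕ → Ω → Subject d) (Z : ℕ → Ω → Fin 2) (ω : Ω) : ℝ :=
  ∑ t ∈ Finset.Icc 1 T, loss P (action (data W Z ω) η T₀ t) - T * loss P (optAction θ)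

end Design

/-! ### The length of the initialization phase -/

/-- `C_{δ,T,0} = 0.85 √(log log T + 0.72 log(5.2/δ))`. -/
def C0 (δ : ℝ) (T : ℕ) : ℝ :=
  0.85 * Real.sqrt (Real.log (Real.log T) + 0.72 * Real.log (5.2 / δ))

/-- The order `√(log T + log(T/δ))` of the constant `C_{δ,T,4}`. -/
def C4Order (δ : ℝ) (T : ℕ) : ℝ := Real.sqrt (Real.log T + Real.log (T / δ))

/-- The length of the initialization phase (rounded up), as a function of `C_{δ,T,0}` and
`C_{δ,T,4}`. -/
def initLength {d : ℕ} (θ : Params d) (η c0 c4 : ℝ) : ℕ :=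
  ⌈max (8 * c4 ^ 2 /
        min (min (θ.σ 0 ^ 4) (θ.σ 1 ^ 4)) (θ.σ 0 ^ 2 * θ.σ 1 ^ 2 * θ.πLow / 2 ^ 5))
      (max (16 * c0 ^ 2 / θ.πLow ^ 2) (1 / (2 * θ.πLow) ^ (1 / η)))⌉₊

end SLOACI

end

/-!
The estimators of an arm are a fixed function, differentiable at the population value, of the
empirical second moments of `(X, ε_S(0), ε_S(1), ε_Y(z))` over the arm and over all stages.  Their
errors, and that of the plug-in Neyman allocation, are therefore at most a constant times the error
of the moments.  The centred sums of products of features over an arm are martingales with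
conditionally sub-exponential increments, so with probability at least `1 - 2 / T` all of them stay
within `κ √(n log T)` up to the horizon.

On this event, strong induction along the trajectory keeps the allocation bounded away from `0` and
`1`: accurate estimators at the previous stages make both arms grow linearly, and the deviation
`√(log T / n)` of the moments then makes the next estimators accurate.  The loss is the variance of
the effect plus the mean square of a residual divided by `π (1 - π)`, which is quadratic around the
optimum, so stage `n + 1` costs at most a multiple of `log T / n`, and the stages add up to order
`(log T)²`.  Off this event the regret is at most `T (ℓmax - ℓ(a*))`, and the probability `2 / T`
cancels the factor `T`.
-/

namespace SLOACI

/-! ### Exponential moments -/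

theorem exp_le_one_add_add_sq {x : ℝ} (hx : |x| ≤ 1) : Real.exp x ≤ 1 + x + x ^ 2 := by
  linarith [(abs_le.mp (Real.abs_exp_sub_one_sub_id_le hx)).2]

theorem exp_le_one_add_add_sq_mul_exp_abs (x : ℝ) :
    Real.exp x ≤ 1 + x + x ^ 2 * Real.exp |x| := by
  have h_one : 1 ≤ Real.exp |x| := Real.one_le_exp (abs_nonneg x)
  rcases le_or_gt |x| 1 with hx | hx
  · nlinarith [exp_le_one_add_add_sq hx, sq_nonneg x]
  · have h_sq : |x| ≤ x ^ 2 := by rw [← sq_abs]; nlinarith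
    rcases le_total 0 x with h0 | h0
    · rw [abs_of_nonneg h0] at *
      nlinarith
    · rw [abs_of_nonpos h0] at *
      nlinarith [Real.exp_le_one_iff.mpr h0]

theorem exp_mul_le_of_abs_le {b lam : ℝ} (hb : 0 < b) (hlam : |lam| ≤ b / 2) (y : ℝ) :
    Real.exp (lam * y) ≤ 1 + lam * y + 8 / b ^ 2 * Real.exp (b * |y|) * lam ^ 2 := by
  have h_half : Real.exp |lam * y| ≤ Real.exp (b / 2 * |y|) := by
    rw [abs_mul]
    gcongr
  have h_sq : y ^ 2 ≤ 8 / b ^ 2 * Real.exp (b / 2 * |y|) := by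
    have := Real.quadratic_le_exp_of_nonneg (x := b / 2 * |y|) (by positivity)
    rw [div_mul_eq_mul_div, le_div_iff₀ (by positivity), ← sq_abs y]
    nlinarith [mul_nonneg hb.le (abs_nonneg y)]
  calc Real.exp (lam * y)
      ≤ 1 + lam * y + lam ^ 2 * y ^ 2 * Real.exp |lam * y| := by
        simpa only [mul_pow] using exp_le_one_add_add_sq_mul_exp_abs (lam * y)
    _ ≤ 1 + lam * y
          + lam ^ 2 * (8 / b ^ 2 * Real.exp (b / 2 * |y|)) * Real.exp (b / 2 * |y|) := by gcongr
    _ = 1 + lam * y + 8 / b ^ 2 * Real.exp (b / 2 * |y| + b / 2 * |y|) * lam ^ 2 := by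
        rw [Real.exp_add]
        ring
    _ = 1 + lam * y + 8 / b ^ 2 * Real.exp (b * |y|) * lam ^ 2 := by
        rw [← add_mul, add_halves]

theorem integrable_of_integrable_exp_mul_abs {α : Type*} [MeasurableSpace α] {P : Measure α}
    {g : α → ℝ} (hg : AEMeasurable g P) {b : ℝ} (hb : 0 < b)
    (hint : Integrable (fun w => Real.exp (b * |g w|)) P) : Integrable g P := by
  refine Integrable.mono' (hint.const_mul b⁻¹) hg.aestronglyMeasurable (ae_of_all _ fun w => ?_)
  rw [Real.norm_eq_abs, ← div_eq_inv_mul, le_div_iff₀ hb]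
  linarith [Real.add_one_le_exp (b * |g w|)]

theorem exists_lintegral_exp_mul_le {α : Type*} [MeasurableSpace α] {P : Measure α}
    [IsProbabilityMeasure P] {g : α → ℝ} (hg : AEMeasurable g P) {b : ℝ} (hb : 0 < b)
    (hint : Integrable (fun w => Real.exp (b * |g w|)) P) (hmean : ∫ w, g w ∂P = 0) :
    ∃ V : ℝ, 0 ≤ V ∧ ∀ lam : ℝ, |lam| ≤ b / 2 →
      ∫⁻ w, ENNReal.ofReal (Real.exp (lam * g w)) ∂P ≤ ENNReal.ofReal (Real.exp (V * lam ^ 2)) := by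
  set V : ℝ := 8 / b ^ 2 * ∫ w, Real.exp (b * |g w|) ∂P
  refine ⟨V, by positivity, fun lam hlam => ?_⟩
  have h_exp := fun w => exp_mul_le_of_abs_le hb hlam (g w)
  have h_lin : Integrable (fun w => 1 + lam * g w) P :=
    (integrable_const 1).add ((integrable_of_integrable_exp_mul_abs hg hb hint).const_mul lam)
  have h_quad : Integrable (fun w => 8 / b ^ 2 * Real.exp (b * |g w|) * lam ^ 2) P :=
    (hint.const_mul _).mul_const _
  have h_mean_lin : ∫ w, (1 + lam * g w) ∂P = 1 := by
    rw [integral_add (integrable_const 1)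
      ((integrable_of_integrable_exp_mul_abs hg hb hint).const_mul lam), integral_const_mul, hmean]
    simp
  calc ∫⁻ w, ENNReal.ofReal (Real.exp (lam * g w)) ∂P
      ≤ ∫⁻ w, ENNReal.ofReal (1 + lam * g w + 8 / b ^ 2 * Real.exp (b * |g w|) * lam ^ 2) ∂P :=
        lintegral_mono fun w => ENNReal.ofReal_le_ofReal (h_exp w)
    _ = ENNReal.ofReal (∫ w, (1 + lam * g w + 8 / b ^ 2 * Real.exp (b * |g w|) * lam ^ 2) ∂P) :=
        (ofReal_integral_eq_lintegral_ofReal (h_lin.add h_quad)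
          (ae_of_all _ fun w => (Real.exp_pos _).le.trans (h_exp w))).symm
    _ = ENNReal.ofReal (V * lam ^ 2 + 1) := by
        rw [integral_add h_lin h_quad, h_mean_lin, integral_mul_const, integral_const_mul, add_comm]
    _ ≤ ENNReal.ofReal (Real.exp (V * lam ^ 2)) :=
        ENNReal.ofReal_le_ofReal (Real.add_one_le_exp _)

theorem bernoulli_mgf_le {q lam : ℝ} (hq : q ∈ Set.Icc (0 : ℝ) 1) (hlam : |lam| ≤ 1) :
    Real.exp (lam * (1 - q)) * q + Real.exp (lam * (0 - q)) * (1 - q) ≤ Real.exp (lam ^ 2) := by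
  obtain ⟨h0, h1⟩ := hq
  have h_treated : |lam * (1 - q)| ≤ 1 := by
    rw [abs_mul]
    exact mul_le_one₀ hlam (abs_nonneg _) (by rw [abs_le]; constructor <;> linarith)
  have h_control : |lam * (0 - q)| ≤ 1 := by
    rw [abs_mul]
    exact mul_le_one₀ hlam (abs_nonneg _) (by rw [abs_le]; constructor <;> linarith)
  calc Real.exp (lam * (1 - q)) * q + Real.exp (lam * (0 - q)) * (1 - q)
      ≤ (1 + lam * (1 - q) + (lam * (1 - q)) ^ 2) * q
          + (1 + lam * (0 - q) + (lam * (0 - q)) ^ 2) * (1 - q) :=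
        add_le_add (mul_le_mul_of_nonneg_right (exp_le_one_add_add_sq h_treated) h0)
          (mul_le_mul_of_nonneg_right (exp_le_one_add_add_sq h_control) (sub_nonneg.mpr h1))
    _ = lam ^ 2 * (q * (1 - q)) + 1 := by ring
    _ ≤ lam ^ 2 + 1 := by nlinarith [mul_nonneg (sq_nonneg lam) (sq_nonneg q), sq_nonneg lam]
    _ ≤ Real.exp (lam ^ 2) := Real.add_one_le_exp _

theorem nat_mul_exp_neg_log_le {N T : ℕ} (hT : 2 ≤ T) :
    T * (N * (2 * ENNReal.ofReal (Real.exp (-((N + 2) * Real.log T)))))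
      ≤ ENNReal.ofReal (2 / T) := by
  have : (0 : ℝ) < T := by exact_mod_cast (by omega : 0 < T)
  have h_exp : Real.exp (-((N + 2) * Real.log T)) = ((T : ℝ) ^ (N + 2))⁻¹ := by
    rw [Real.exp_neg, ← Real.rpow_natCast, Real.rpow_def_of_pos this, mul_comm]
    push_cast
    rfl
  have h_pow : (N : ℝ) ≤ (T : ℝ) ^ N := by exact_mod_cast (Nat.lt_pow_self (by omega : 1 < T)).le
  calc (T : ENNReal) * (N * (2 * ENNReal.ofReal (Real.exp (-((N + 2) * Real.log T)))))
      = ENNReal.ofReal (T * (N * (2 * ((T : ℝ) ^ (N + 2))⁻¹))) := by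
        rw [h_exp, ENNReal.ofReal_mul (by positivity), ENNReal.ofReal_mul (by positivity),
          ENNReal.ofReal_mul (by positivity)]
        simp
    _ ≤ ENNReal.ofReal (T * (T ^ N * (2 * ((T : ℝ) ^ (N + 2))⁻¹))) :=
        ENNReal.ofReal_le_ofReal (by gcongr)
    _ = ENNReal.ofReal (2 / T) := by
        congr 1
        rw [pow_add]
        field_simp

/-! ### Conditionally sub-exponential variables -/

theorem setLIntegral_eq_of_condExp {Ω : Type*} {m m0 : MeasurableSpace Ω} (hm : m ≤ m0)
    {μ : Measure Ω} [IsFiniteMeasure μ] {A : Set Ω} (hA : MeasurableSet A) {q : Ω → ℝ}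
    (hq : Measurable[m] q) (hq0 : ∀ ω, 0 ≤ q ω)
    (hc : μ[A.indicator (fun _ => (1 : ℝ)) | m] =ᵐ[μ] q)
    {K : Ω → ENNReal} (hK : Measurable[m] K) :
    ∫⁻ ω in A, K ω ∂μ = ∫⁻ ω, K ω * ENNReal.ofReal (q ω) ∂μ := by
  have hqm : Measurable fun ω => ENNReal.ofReal (q ω) := (hq.mono hm le_rfl).ennreal_ofReal
  have hqi : Integrable q μ := (integrable_congr hc).mp integrable_condExp
  have h_trim :
      (μ.restrict A).trim hm = (μ.withDensity fun ω => ENNReal.ofReal (q ω)).trim hm := by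
    refine @Measure.ext _ m _ _ fun B hB => ?_
    have h_set : ∫ ω in B, A.indicator (fun _ => (1 : ℝ)) ω ∂μ = ∫ ω in B, q ω ∂μ := by
      rw [← setIntegral_condExp hm ((integrable_const (1 : ℝ)).indicator hA) hB]
      exact setIntegral_congr_ae (hm _ hB) (hc.mono fun ω h _ => h)
    rw [trim_measurableSet_eq hm hB, trim_measurableSet_eq hm hB, withDensity_apply _ (hm _ hB),
      Measure.restrict_apply (hm _ hB),
      ← ofReal_integral_eq_lintegral_ofReal hqi.integrableOn (ae_of_all _ hq0), ← h_set,
      integral_indicator_const (1 : ℝ) hA, smul_eq_mul, mul_one, measureReal_def,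
      ENNReal.ofReal_toReal (measure_ne_top _ _), Measure.restrict_apply hA, Set.inter_comm]
  rw [← lintegral_trim hm hK, h_trim, lintegral_trim hm hK,
    lintegral_withDensity_eq_lintegral_mul _ hqm (hK.mono hm le_rfl)]
  simp only [Pi.mul_apply, mul_comm]

theorem condExp_indicator_compl {Ω : Type*} {m m0 : MeasurableSpace Ω} (hm : m ≤ m0)
    {μ : Measure Ω} [IsFiniteMeasure μ] {A : Set Ω} (hA : MeasurableSet A) {q : Ω → ℝ}
    (hc : μ[A.indicator (fun _ => (1 : ℝ)) | m] =ᵐ[μ] q) :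
    μ[Aᶜ.indicator (fun _ => (1 : ℝ)) | m] =ᵐ[μ] fun ω => 1 - q ω := by
  rw [Set.indicator_compl]
  refine (condExp_sub (integrable_const 1) ((integrable_const (1 : ℝ)).indicator hA) m).trans ?_
  filter_upwards [hc] with ω h
  simp [h, condExp_const hm]

theorem lintegral_ite_eq_of_condExp {Ω : Type*} {m m0 : MeasurableSpace Ω} (hm : m ≤ m0)
    {μ : Measure Ω} [IsFiniteMeasure μ] {A : Set Ω} [DecidablePred (· ∈ A)] (hA : MeasurableSet A)
    {q : Ω → ℝ} (hq : Measurable[m] q) (hq01 : ∀ ω, q ω ∈ Set.Icc (0 : ℝ) 1)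
    (hc : μ[A.indicator (fun _ => (1 : ℝ)) | m] =ᵐ[μ] q)
    {K K' : Ω → ENNReal} (hK : Measurable[m] K) (hK' : Measurable[m] K') :
    ∫⁻ ω, (if ω ∈ A then K ω else K' ω) ∂μ
      = ∫⁻ ω, (K ω * ENNReal.ofReal (q ω) + K' ω * ENNReal.ofReal (1 - q ω)) ∂μ := by
  have h_in : ∫⁻ ω in A, (if ω ∈ A then K ω else K' ω) ∂μ = ∫⁻ ω in A, K ω ∂μ :=
    setLIntegral_congr_fun hA fun ω hω => if_pos hω
  have h_out : ∫⁻ ω in Aᶜ, (if ω ∈ A then K ω else K' ω) ∂μ = ∫⁻ ω in Aᶜ, K' ω ∂μ :=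
    setLIntegral_congr_fun hA.compl fun ω hω => if_neg hω
  have hq' : Measurable[m] fun ω => 1 - q ω := measurable_const.sub hq
  have hKq : Measurable fun ω => K ω * ENNReal.ofReal (q ω) :=
    (hK.mul hq.ennreal_ofReal).mono hm le_rfl
  rw [← lintegral_add_compl _ hA, h_in, h_out,
    setLIntegral_eq_of_condExp hm hA hq (fun ω => (hq01 ω).1) hc hK,
    setLIntegral_eq_of_condExp hm hA.compl hq' (fun ω => sub_nonneg.mpr (hq01 ω).2)
      (condExp_indicator_compl hm hA hc) hK',
    lintegral_add_left hKq]

theorem lintegral_mul_ofReal_add_one_sub {Ω : Type*} {m0 : MeasurableSpace Ω} {μ : Measure Ω}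
    {H : Ω → ENNReal} {q : Ω → ℝ} (hHq : Measurable fun ω => H ω * ENNReal.ofReal (q ω))
    (hq01 : ∀ ω, q ω ∈ Set.Icc (0 : ℝ) 1) :
    ∫⁻ ω, H ω * ENNReal.ofReal (q ω) ∂μ + ∫⁻ ω, H ω * ENNReal.ofReal (1 - q ω) ∂μ
      = ∫⁻ ω, H ω ∂μ := by
  rw [← lintegral_add_left hHq]
  refine lintegral_congr fun ω => ?_
  rw [← mul_add, ← ENNReal.ofReal_add (hq01 ω).1 (sub_nonneg.mpr (hq01 ω).2), add_sub_cancel,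
    ENNReal.ofReal_one, mul_one]

/-- `X` is conditionally sub-exponential given `m`: `E[exp (lam X) | m] ≤ exp (V lam²)` for
`|lam| ≤ r`. The conditional bound is tested against nonnegative `m`-measurable weights, so that no
integrability has to be carried along. -/
def CondSubExponential {Ω : Type*} {_ : MeasurableSpace Ω} (μ : Measure Ω) (m : MeasurableSpace Ω)
    (X : Ω → ℝ) (V r : ℝ) : Prop :=
  ∀ lam : ℝ, |lam| ≤ r → ∀ H : Ω → ENNReal, Measurable[m] H →
    ∫⁻ ω, H ω * ENNReal.ofReal (Real.exp (lam * X ω)) ∂μ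
      ≤ ENNReal.ofReal (Real.exp (V * lam ^ 2)) * ∫⁻ ω, H ω ∂μ

namespace CondSubExponential

section Examples

variable {Ω S : Type*} {m₁ m m0 : MeasurableSpace Ω} [MeasurableSpace S] {μ : Measure Ω}
  {W : Ω → S} {A : Set Ω} {q : Ω → ℝ} [DecidablePred (· ∈ A)]

theorem neg {X : Ω → ℝ} {V r : ℝ} (h : CondSubExponential μ m X V r) :
    CondSubExponential μ m (fun ω => -X ω) V r := fun lam hlam H hH => by
  simpa only [neg_mul, mul_neg, neg_sq] using h (-lam) (by rwa [abs_neg]) H hH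

theorem mono {X : Ω → ℝ} {V V' r r' : ℝ} (h : CondSubExponential μ m X V r) (hV : V ≤ V')
    (hr : r' ≤ r) : CondSubExponential μ m X V' r' := fun lam hlam H hH =>
  (h lam (hlam.trans hr) H hH).trans (by gcongr)

theorem ite_comp [IsProbabilityMeasure μ] (hm : m₁ ≤ m0) (hW : Measurable W)
    (hind : Indep (MeasurableSpace.comap W inferInstance) m₁ μ) (hA : MeasurableSet A)
    (hq : Measurable[m₁] q) (hq01 : ∀ ω, q ω ∈ Set.Icc (0 : ℝ) 1)
    (hc : μ[A.indicator (fun _ => (1 : ℝ)) | m₁ ⊔ MeasurableSpace.comap W inferInstance] =ᵐ[μ] q)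
    {f : S → ℝ} (hf : Measurable f) {V r : ℝ} (hV : 0 ≤ V)
    (hmgf : ∀ lam : ℝ, |lam| ≤ r → ∫⁻ w, ENNReal.ofReal (Real.exp (lam * f w)) ∂(μ.map W)
      ≤ ENNReal.ofReal (Real.exp (V * lam ^ 2))) :
    CondSubExponential μ m₁ (fun ω => if ω ∈ A then f (W ω) else 0) V r := by
  intro lam hlam H hH
  set c := ENNReal.ofReal (Real.exp (V * lam ^ 2))
  set G : S → ENNReal := fun w => ENNReal.ofReal (Real.exp (lam * f w))
  have hc1 : 1 ≤ c := ENNReal.one_le_ofReal.mpr (Real.one_le_exp (by positivity))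
  have hG : Measurable G := by fun_prop
  have hsup : m₁ ⊔ MeasurableSpace.comap W inferInstance ≤ m0 := sup_le hm hW.comap_le
  have hGW : Measurable[MeasurableSpace.comap W inferInstance] fun ω => G (W ω) :=
    hG.comp (comap_measurable W)
  have hHq : Measurable[m₁] fun ω => H ω * ENNReal.ofReal (q ω) := hH.mul hq.ennreal_ofReal
  have hH' : Measurable[m₁ ⊔ MeasurableSpace.comap W inferInstance] H :=
    hH.mono le_sup_left le_rfl
  have hHG : Measurable[m₁ ⊔ MeasurableSpace.comap W inferInstance] fun ω => H ω * G (W ω) :=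
    hH'.mul (hGW.mono le_sup_right le_rfl)
  have h_indep : ∫⁻ ω, H ω * G (W ω) * ENNReal.ofReal (q ω) ∂μ
      ≤ c * ∫⁻ ω, H ω * ENNReal.ofReal (q ω) ∂μ := by
    calc ∫⁻ ω, H ω * G (W ω) * ENNReal.ofReal (q ω) ∂μ
        = ∫⁻ ω, G (W ω) * (H ω * ENNReal.ofReal (q ω)) ∂μ := lintegral_congr fun ω => by ring
      _ = (∫⁻ w, G w ∂(μ.map W)) * ∫⁻ ω, H ω * ENNReal.ofReal (q ω) ∂μ := by
        rw [lintegral_map hG hW]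
        exact lintegral_mul_eq_lintegral_mul_lintegral_of_independent_measurableSpace
          hW.comap_le hm hind hGW hHq
      _ ≤ c * ∫⁻ ω, H ω * ENNReal.ofReal (q ω) ∂μ := mul_le_mul_left (hmgf lam hlam) _
  calc ∫⁻ ω, H ω * ENNReal.ofReal (Real.exp (lam * if ω ∈ A then f (W ω) else 0)) ∂μ
      = ∫⁻ ω, (if ω ∈ A then H ω * G (W ω) else H ω) ∂μ :=
        lintegral_congr fun ω => by split_ifs <;> simp [G]
    _ = ∫⁻ ω, H ω * G (W ω) * ENNReal.ofReal (q ω) ∂μ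
          + ∫⁻ ω, H ω * ENNReal.ofReal (1 - q ω) ∂μ := by
        rw [lintegral_ite_eq_of_condExp hsup hA (hq.mono le_sup_left le_rfl) hq01 hc
          hHG hH', lintegral_add_right]
        exact (hH.mono hm le_rfl).mul (measurable_const.sub (hq.mono hm le_rfl)).ennreal_ofReal
    _ ≤ c * ∫⁻ ω, H ω * ENNReal.ofReal (q ω) ∂μ
          + c * ∫⁻ ω, H ω * ENNReal.ofReal (1 - q ω) ∂μ :=
        add_le_add h_indep (le_mul_of_one_le_left' hc1)
    _ = c * ∫⁻ ω, H ω ∂μ := by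
        rw [← mul_add, lintegral_mul_ofReal_add_one_sub (hHq.mono hm le_rfl) hq01]

theorem indicator_sub [IsFiniteMeasure μ] (hm₁ : m₁ ≤ m) (hm : m ≤ m0) (hA : MeasurableSet A)
    (hq : Measurable[m₁] q) (hq01 : ∀ ω, q ω ∈ Set.Icc (0 : ℝ) 1)
    (hc : μ[A.indicator (fun _ => (1 : ℝ)) | m] =ᵐ[μ] q) :
    CondSubExponential μ m₁ (fun ω => (if ω ∈ A then 1 else 0) - q ω) 1 1 := by
  intro lam hlam H hH
  have hq' : Measurable[m] q := hq.mono hm₁ le_rfl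
  have hK : ∀ a : ℝ, Measurable[m] fun ω => H ω * ENNReal.ofReal (Real.exp (lam * (a - q ω))) :=
    fun a => (hH.mono hm₁ le_rfl).mul (Real.measurable_exp.comp
      ((measurable_const.sub hq').const_mul lam)).ennreal_ofReal
  calc ∫⁻ ω, H ω * ENNReal.ofReal (Real.exp (lam * ((if ω ∈ A then 1 else 0) - q ω))) ∂μ
      = ∫⁻ ω, (if ω ∈ A then H ω * ENNReal.ofReal (Real.exp (lam * (1 - q ω)))
          else H ω * ENNReal.ofReal (Real.exp (lam * (0 - q ω)))) ∂μ :=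
        lintegral_congr fun ω => by split_ifs <;> rfl
    _ = ∫⁻ ω, (H ω * ENNReal.ofReal (Real.exp (lam * (1 - q ω))) * ENNReal.ofReal (q ω)
          + H ω * ENNReal.ofReal (Real.exp (lam * (0 - q ω))) * ENNReal.ofReal (1 - q ω)) ∂μ :=
        lintegral_ite_eq_of_condExp hm hA hq' hq01 hc (hK 1) (hK 0)
    _ ≤ ∫⁻ ω, ENNReal.ofReal (Real.exp (1 * lam ^ 2)) * H ω ∂μ := lintegral_mono fun ω => by
        obtain ⟨h0, h1⟩ := hq01 ω
        rw [mul_assoc, mul_assoc, ← mul_add, ← ENNReal.ofReal_mul (Real.exp_pos _).le,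
          ← ENNReal.ofReal_mul (Real.exp_pos _).le,
          ← ENNReal.ofReal_add (mul_nonneg (Real.exp_pos _).le h0)
            (mul_nonneg (Real.exp_pos _).le (sub_nonneg.mpr h1)), mul_comm, one_mul]
        gcongr
        exact bernoulli_mgf_le (hq01 ω) hlam
    _ = ENNReal.ofReal (Real.exp (1 * lam ^ 2)) * ∫⁻ ω, H ω ∂μ :=
        lintegral_const_mul _ (hH.mono (hm₁.trans hm) le_rfl)

end Examples

section Sums

variable {Ω : Type*} {m0 : MeasurableSpace Ω} {μ : Measure Ω} [IsProbabilityMeasure μ]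
  {m : ℕ → MeasurableSpace Ω} {X : ℕ → Ω → ℝ} {V r : ℝ} {n : ℕ}

theorem measurable_sum_Icc {m' : MeasurableSpace Ω} (hm : ∀ j ∈ Finset.Icc 1 n, m j ≤ m')
    (hX : ∀ j ∈ Finset.Icc 1 n, Measurable[m j] (X j)) :
    Measurable[m'] fun ω => ∑ j ∈ Finset.Icc 1 n, X j ω :=
  Finset.measurable_sum _ fun j hj => (hX j hj).mono (hm j hj) le_rfl

theorem lintegral_exp_sum_le (hmono : Monotone m)
    (hX : ∀ j ∈ Finset.Icc 1 n, Measurable[m j] (X j))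
    (hstep : ∀ j ∈ Finset.Icc 1 n, CondSubExponential μ (m (j - 1)) (X j) V r)
    {lam : ℝ} (hlam : |lam| ≤ r) :
    ∫⁻ ω, ENNReal.ofReal (Real.exp (lam * ∑ j ∈ Finset.Icc 1 n, X j ω)) ∂μ
      ≤ ENNReal.ofReal (Real.exp (n * (V * lam ^ 2))) := by
  induction n with
  | zero => simp
  | succ n ih =>
    have h_sub : Finset.Icc 1 n ⊆ Finset.Icc 1 (n + 1) := Finset.Icc_subset_Icc_right n.le_succ
    have h_top : n + 1 ∈ Finset.Icc 1 (n + 1) := Finset.mem_Icc.mpr ⟨n.succ_pos, le_rfl⟩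
    have h_sum : Measurable[m n] fun ω => ∑ j ∈ Finset.Icc 1 n, X j ω :=
      measurable_sum_Icc (fun j hj => hmono (Finset.mem_Icc.mp hj).2) fun j hj => hX j (h_sub hj)
    calc ∫⁻ ω, ENNReal.ofReal (Real.exp (lam * ∑ j ∈ Finset.Icc 1 (n + 1), X j ω)) ∂μ
        = ∫⁻ ω, ENNReal.ofReal (Real.exp (lam * ∑ j ∈ Finset.Icc 1 n, X j ω))
            * ENNReal.ofReal (Real.exp (lam * X (n + 1) ω)) ∂μ := by
          refine lintegral_congr fun ω => ?_
          rw [← ENNReal.ofReal_mul (Real.exp_pos _).le, ← Real.exp_add,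
            Finset.sum_Icc_succ_top n.succ_pos, mul_add]
      _ ≤ ENNReal.ofReal (Real.exp (V * lam ^ 2))
            * ∫⁻ ω, ENNReal.ofReal (Real.exp (lam * ∑ j ∈ Finset.Icc 1 n, X j ω)) ∂μ :=
          hstep (n + 1) h_top lam hlam _
            (Real.measurable_exp.comp (h_sum.const_mul lam)).ennreal_ofReal
      _ ≤ ENNReal.ofReal (Real.exp (V * lam ^ 2))
            * ENNReal.ofReal (Real.exp (n * (V * lam ^ 2))) := by
          gcongr
          exact ih (fun j hj => hX j (h_sub hj)) fun j hj => hstep j (h_sub hj)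
      _ = ENNReal.ofReal (Real.exp ((n + 1 : ℕ) * (V * lam ^ 2))) := by
          rw [← ENNReal.ofReal_mul (Real.exp_pos _).le, ← Real.exp_add]
          congr 2
          push_cast
          ring

theorem measure_sqrt_le_sum_le (hmono : Monotone m) (hm : m n ≤ m0)
    (hX : ∀ j ∈ Finset.Icc 1 n, Measurable[m j] (X j))
    (hstep : ∀ j ∈ Finset.Icc 1 n, CondSubExponential μ (m (j - 1)) (X j) V r)
    (hn : 0 < n) {L κ : ℝ} (hL : 0 ≤ L) (hnL : √(L / n) ≤ r) :
    μ {ω | κ * √(n * L) ≤ ∑ j ∈ Finset.Icc 1 n, X j ω}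
      ≤ ENNReal.ofReal (Real.exp (-((κ - V) * L))) := by
  have : (0 : ℝ) < n := by exact_mod_cast hn
  set lam := √(L / n) with hlam
  have h_sq : n * (V * lam ^ 2) = V * L := by
    rw [hlam, Real.sq_sqrt (by positivity)]
    field_simp
  have h_level : lam * √(n * L) = L := by
    rw [hlam, ← Real.sqrt_mul (by positivity), show L / n * (n * L) = L ^ 2 by field_simp,
      Real.sqrt_sq hL]
  have h_sum : Measurable fun ω => ∑ j ∈ Finset.Icc 1 n, X j ω :=
    measurable_sum_Icc (fun j hj => (hmono (Finset.mem_Icc.mp hj).2).trans hm) hX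
  have h_mgf := lintegral_exp_sum_le hmono hX hstep (lam := lam)
    (by rwa [abs_of_nonneg (Real.sqrt_nonneg _)])
  calc μ {ω | κ * √(n * L) ≤ ∑ j ∈ Finset.Icc 1 n, X j ω}
      ≤ μ {ω | ENNReal.ofReal (Real.exp (κ * L))
          ≤ ENNReal.ofReal (Real.exp (lam * ∑ j ∈ Finset.Icc 1 n, X j ω))} := by
        refine measure_mono fun ω hω => ENNReal.ofReal_le_ofReal (Real.exp_le_exp.mpr ?_)
        calc κ * L = lam * (κ * √(n * L)) := by rw [mul_left_comm, h_level]
          _ ≤ lam * ∑ j ∈ Finset.Icc 1 n, X j ω :=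
            mul_le_mul_of_nonneg_left hω (Real.sqrt_nonneg _)
    _ ≤ (∫⁻ ω, ENNReal.ofReal (Real.exp (lam * ∑ j ∈ Finset.Icc 1 n, X j ω)) ∂μ)
          / ENNReal.ofReal (Real.exp (κ * L)) :=
        meas_ge_le_lintegral_div
          (Real.measurable_exp.comp (h_sum.const_mul lam)).ennreal_ofReal.aemeasurable
          (by simp [Real.exp_pos]) ENNReal.ofReal_ne_top
    _ ≤ ENNReal.ofReal (Real.exp (V * L)) / ENNReal.ofReal (Real.exp (κ * L)) := by
        rw [← h_sq]
        gcongr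
    _ = ENNReal.ofReal (Real.exp (-((κ - V) * L))) := by
        rw [← ENNReal.ofReal_div_of_pos (Real.exp_pos _), ← Real.exp_sub]
        congr 2
        ring

theorem measure_sqrt_le_abs_sum_le (hmono : Monotone m) (hm : m n ≤ m0)
    (hX : ∀ j ∈ Finset.Icc 1 n, Measurable[m j] (X j))
    (hstep : ∀ j ∈ Finset.Icc 1 n, CondSubExponential μ (m (j - 1)) (X j) V r)
    (hn : 0 < n) {L κ : ℝ} (hL : 0 ≤ L) (hnL : √(L / n) ≤ r) :
    μ {ω | κ * √(n * L) ≤ |∑ j ∈ Finset.Icc 1 n, X j ω|}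
      ≤ 2 * ENNReal.ofReal (Real.exp (-((κ - V) * L))) := by
  simp only [le_abs, Set.ofPred_or, ← Finset.sum_neg_distrib, two_mul]
  exact (measure_union_le _ _).trans (add_le_add
    (measure_sqrt_le_sum_le hmono hm hX hstep hn hL hnL)
    (measure_sqrt_le_sum_le hmono hm (fun j hj => (hX j hj).neg)
      (fun j hj => (hstep j hj).neg) hn hL hnL))

theorem measure_exists_sqrt_le_abs_sum_le {ι : Type*} [Fintype ι] {X : ι → ℕ → Ω → ℝ} {T₀ T : ℕ}
    (hmono : Monotone m) (hm : ∀ n ≤ T, m n ≤ m0)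
    (hX : ∀ i, ∀ j ∈ Finset.Icc 1 T, Measurable[m j] (X i j))
    (hstep : ∀ i, ∀ j ∈ Finset.Icc 1 T, CondSubExponential μ (m (j - 1)) (X i j) V r)
    (hT₀ : 0 < T₀) (hT : 2 ≤ T) (hr : √(Real.log T / T₀) ≤ r) :
    μ {ω | ∃ n ∈ Finset.Icc T₀ T, ∃ i,
        (V + (Fintype.card ι + 2)) * √(n * Real.log T) ≤ |∑ j ∈ Finset.Icc 1 n, X i j ω|}
      ≤ ENNReal.ofReal (2 / T) := by
  have : (0 : ℝ) < T₀ := by exact_mod_cast hT₀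
  have hL : 0 ≤ Real.log T := Real.log_natCast_nonneg T
  set κ : ℝ := V + (Fintype.card ι + 2) with hκ
  set tail := 2 * ENNReal.ofReal (Real.exp (-((Fintype.card ι + 2) * Real.log T)))
  have h_tail : ∀ n ∈ Finset.Icc T₀ T, ∀ i,
      μ {ω | κ * √(n * Real.log T) ≤ |∑ j ∈ Finset.Icc 1 n, X i j ω|} ≤ tail := by
    intro n hn i
    obtain ⟨hT₀n, hnT⟩ := Finset.mem_Icc.mp hn
    have h_sub : Finset.Icc 1 n ⊆ Finset.Icc 1 T := Finset.Icc_subset_Icc_right hnT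
    have hnr : √(Real.log T / n) ≤ r := (Real.sqrt_le_sqrt (by gcongr)).trans hr
    have h_bound := measure_sqrt_le_abs_sum_le (κ := κ) hmono (hm n hnT)
      (fun j hj => hX i j (h_sub hj)) (fun j hj => hstep i j (h_sub hj)) (by omega) hL hnr
    rwa [hκ, add_sub_cancel_left] at h_bound
  calc μ {ω | ∃ n ∈ Finset.Icc T₀ T, ∃ i,
        κ * √(n * Real.log T) ≤ |∑ j ∈ Finset.Icc 1 n, X i j ω|}
      = μ (⋃ n ∈ Finset.Icc T₀ T, ⋃ i ∈ Finset.univ,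
          {ω | κ * √(n * Real.log T) ≤ |∑ j ∈ Finset.Icc 1 n, X i j ω|}) := by
        congr 1
        ext ω
        simp
    _ ≤ ∑ _n ∈ Finset.Icc T₀ T, ∑ _i : ι, tail :=
        (measure_biUnion_finset_le _ _).trans (Finset.sum_le_sum fun _ hn =>
          (measure_biUnion_finset_le _ _).trans (Finset.sum_le_sum fun _ _ => h_tail _ hn _))
    _ ≤ T * (Fintype.card ι * tail) := by
        simp only [Finset.sum_const, nsmul_eq_mul, Finset.card_univ, Nat.card_Icc]
        gcongr
        omega
    _ ≤ ENNReal.ofReal (2 / T) := nat_mul_exp_neg_log_le hT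

end Sums

end CondSubExponential

/-! ### Moments of a unit -/

theorem exp_half_add_le (u v : ℝ) : Real.exp ((u + v) / 2) ≤ Real.exp u + Real.exp v := by
  have h_sq : ∀ t : ℝ, Real.exp t = Real.exp (t / 2) ^ 2 := fun t => by
    rw [sq, ← Real.exp_add, add_halves]
  rw [add_div, Real.exp_add, h_sq u, h_sq v]
  nlinarith [sq_nonneg (Real.exp (u / 2) - Real.exp (v / 2)), sq_nonneg (Real.exp (u / 2)),
    sq_nonneg (Real.exp (v / 2))]

namespace FinitePsiTwo

variable {d : ℕ} {P : Measure (Subject d)} {e f : Subject d → ℝ}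

theorem exists_integrable_exp (he : AEMeasurable e P) (h : FinitePsiTwo P e) :
    ∃ b : ℝ, 0 < b ∧ Integrable (fun w => Real.exp (b * e w ^ 2)) P := by
  obtain ⟨K, hK, hint⟩ := h
  refine ⟨1 / K ^ 2, by positivity, by fun_prop, ?_⟩
  rw [hasFiniteIntegral_iff_ofReal (ae_of_all _ fun w => (Real.exp_pos _).le)]
  simp only [one_div_mul_eq_div]
  exact hint.trans_lt (by simp)

theorem of_abs_le [IsProbabilityMeasure P] {B : ℝ} (h : ∀ᵐ w ∂P, |e w| ≤ B) :
    FinitePsiTwo P e := by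
  have h_log : 0 < Real.log 2 := Real.log_pos one_lt_two
  refine ⟨(|B| + 1) / √(Real.log 2), by positivity, ?_⟩
  calc ∫⁻ w, ENNReal.ofReal (Real.exp (e w ^ 2 / ((|B| + 1) / √(Real.log 2)) ^ 2)) ∂P
      ≤ ∫⁻ _, 2 ∂P := by
        refine lintegral_mono_ae (h.mono fun w hw => ?_)
        have h_sq : e w ^ 2 ≤ (|B| + 1) ^ 2 := by
          rw [← sq_abs]
          gcongr
          linarith [le_abs_self B]
        refine ENNReal.ofReal_le_of_le_toReal ?_
        rw [div_pow, Real.sq_sqrt h_log.le, ENNReal.toReal_ofNat, ← Real.le_log_iff_exp_le two_pos,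
          div_div_eq_mul_div, div_le_iff₀ (by positivity), mul_comm]
        gcongr
    _ = 2 := by simp

theorem memLp (he : AEMeasurable e P) (h : FinitePsiTwo P e) : MemLp e 2 P := by
  obtain ⟨b, hb, hint⟩ := h.exists_integrable_exp he
  rw [memLp_two_iff_integrable_sq he.aestronglyMeasurable]
  refine Integrable.mono' (hint.const_mul b⁻¹) (he.pow_const 2).aestronglyMeasurable
    (ae_of_all _ fun w => ?_)
  rw [Real.norm_of_nonneg (sq_nonneg _), ← div_eq_inv_mul, le_div_iff₀ hb]
  linarith [Real.add_one_le_exp (b * e w ^ 2)]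

theorem exists_integrable_exp_mul_abs_sub (he : AEMeasurable e P) (hf : AEMeasurable f P)
    (h : FinitePsiTwo P e) (h' : FinitePsiTwo P f) (m : ℝ) :
    ∃ b : ℝ, 0 < b ∧ Integrable (fun w => Real.exp (b * |e w * f w - m|)) P := by
  obtain ⟨b, hb, hint⟩ := h.exists_integrable_exp he
  obtain ⟨c, hc, hint'⟩ := h'.exists_integrable_exp hf
  have h_min : 0 < min b c := lt_min hb hc
  refine ⟨min b c, h_min, ((hint.add hint').const_mul (Real.exp (min b c * |m|))).mono'
    (by fun_prop) (ae_of_all _ fun w => ?_)⟩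
  have h_abs : |e w * f w - m| ≤ |m| + (e w ^ 2 + f w ^ 2) / 2 := by
    have h_amgm : |e w * f w| ≤ (e w ^ 2 + f w ^ 2) / 2 := by
      rw [abs_mul, ← sq_abs (e w), ← sq_abs (f w)]
      linarith [two_mul_le_add_sq |e w| |f w|]
    linarith [abs_sub (e w * f w) m]
  rw [Real.norm_of_nonneg (Real.exp_pos _).le]
  calc Real.exp (min b c * |e w * f w - m|)
      ≤ Real.exp (min b c * |m| + (b * e w ^ 2 + c * f w ^ 2) / 2) := by
        refine Real.exp_le_exp.mpr ((mul_le_mul_of_nonneg_left h_abs h_min.le).trans ?_)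
        linarith [mul_le_mul_of_nonneg_right (min_le_left b c) (sq_nonneg (e w)),
          mul_le_mul_of_nonneg_right (min_le_right b c) (sq_nonneg (f w))]
    _ ≤ Real.exp (min b c * |m|) * (Real.exp (b * e w ^ 2) + Real.exp (c * f w ^ 2)) := by
        rw [Real.exp_add]
        gcongr
        exact exp_half_add_le _ _

end FinitePsiTwo

section Measurability

variable {d : ℕ}

@[fun_prop]
theorem measurable_x : Measurable fun w : Subject d => w.x := measurable_fst

@[fun_prop]
theorem measurable_s : Measurable fun w : Subject d => w.s := measurable_fst.comp measurable_snd

@[fun_prop]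
theorem measurable_y : Measurable fun w : Subject d => w.y := measurable_snd.comp measurable_snd

@[fun_prop]
theorem measurable_dotProduct {α : Type*} [MeasurableSpace α] {u v : α → Fin d → ℝ}
    (hu : Measurable u) (hv : Measurable v) : Measurable fun a => u a ⬝ᵥ v a := by
  unfold dotProduct
  fun_prop

@[fun_prop]
theorem measurable_εS (θ : Params d) (z : Fin 2) : Measurable (θ.εS z) := by
  unfold Params.εS
  fun_prop

@[fun_prop]
theorem measurable_εY (θ : Params d) (z : Fin 2) : Measurable (θ.εY z) := by
  unfold Params.εY
  fun_prop

end Measurability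

/-- `α_{S,z}`, `α_{Y,z}` and `γ_z` are the coefficients of linear projections: the errors are
uncorrelated with the covariates, and `ε(z)` also with both surrogate errors. The variables have
finite `ψ₂` norms, and the covariates may be unbounded. -/
structure LinearProjectionModel {d : ℕ} (P : Measure (Subject d)) (θ : Params d) : Prop where
  σS_pos : ∀ z, 0 < θ.σS z
  σ_pos : ∀ z, 0 < θ.σ z
  psi_x : ∀ i, FinitePsiTwo P fun w => w.x i
  psi_εS : ∀ z, FinitePsiTwo P (θ.εS z)
  psi_εY : ∀ z, FinitePsiTwo P (θ.εY z)
  integral_x_mul_εS : ∀ z i, ∫ w, w.x i * θ.εS z w ∂P = 0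
  integral_x_mul_ε : ∀ z i, ∫ w, w.x i * θ.ε z w ∂P = 0
  integral_εS_mul_ε : ∀ z z', ∫ w, θ.εS z' w * θ.ε z w ∂P = 0
  integral_εS_sq : ∀ z, ∫ w, θ.εS z w ^ 2 ∂P = θ.σS z ^ 2
  integral_ε_sq : ∀ z, ∫ w, θ.ε z w ^ 2 ∂P = θ.σ z ^ 2
  lambdaMin_pos : 0 < lambdaMin P

theorem integral_add_sq {α : Type*} [MeasurableSpace α] {P : Measure α} {f g : α → ℝ}
    (hf : MemLp f 2 P) (hg : MemLp g 2 P) :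
    ∫ w, (f w + g w) ^ 2 ∂P = ∫ w, f w ^ 2 ∂P + 2 * ∫ w, f w * g w ∂P + ∫ w, g w ^ 2 ∂P := by
  have h_cross : Integrable (fun w => 2 * (f w * g w)) P := (hf.integrable_mul hg).const_mul 2
  have h_fst : Integrable (fun w => f w ^ 2 + 2 * (f w * g w)) P := hf.integrable_sq.add h_cross
  rw [← integral_const_mul, ← integral_add hf.integrable_sq h_cross,
    ← integral_add h_fst hg.integrable_sq]
  exact integral_congr_ae (ae_of_all _ fun w => by ring)

section CondExp

variable {α : Type*} {m m0 : MeasurableSpace α} {P : Measure α} [IsProbabilityMeasure P]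

theorem integral_mul_eq_zero_of_condExp (hm : m ≤ m0) {h e : α → ℝ} (hh : Measurable[m] h)
    (h2 : MemLp h 2 P) (e2 : MemLp e 2 P) (hc : P[e | m] =ᵐ[P] fun _ => 0) :
    ∫ w, h w * e w ∂P = 0 := by
  have h_pull := condExp_mul_of_stronglyMeasurable_left (m := m) hh.stronglyMeasurable
    (h2.integrable_mul e2) (e2.integrable one_le_two)
  calc ∫ w, h w * e w ∂P = ∫ w, (P[h * e | m]) w ∂P := (integral_condExp hm).symm
    _ = ∫ _, 0 ∂P := integral_congr_ae (by filter_upwards [h_pull, hc] with w h1 h2; simp [h1, h2])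
    _ = 0 := integral_zero _ _

theorem integral_sq_eq_of_condVar (hm : m ≤ m0) {e : α → ℝ} {c : ℝ}
    (hc : P[e | m] =ᵐ[P] fun _ => 0) (hv : Var[e; P | m] =ᵐ[P] fun _ => c) :
    ∫ w, e w ^ 2 ∂P = c := by
  calc ∫ w, e w ^ 2 ∂P = ∫ w, (e w - (P[e | m]) w) ^ 2 ∂P :=
        integral_congr_ae (hc.mono fun w h => by simp [h])
    _ = ∫ w, (Var[e; P | m]) w ∂P := (integral_condExp hm).symm
    _ = c := by rw [integral_congr_ae hv]; simp

end CondExp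

theorem CovariateCondition.finitePsiTwo_x {d : ℕ} {P : Measure (Subject d)}
    [IsProbabilityMeasure P] (h : CovariateCondition P) (i : Fin d) :
    FinitePsiTwo P fun w => w.x i := by
  obtain ⟨K, hK, hxK⟩ := h.compact
  obtain ⟨B, hB⟩ := hK.isBounded.exists_norm_le
  exact .of_abs_le (hxK.mono fun w hw => (norm_le_pi_norm w.x i).trans (hB _ hw))

namespace LinearModel

variable {d : ℕ} {P : Measure (Subject d)} [IsProbabilityMeasure P] {θ : Params d}

theorem condExp_ε_sigmaXSz (hmodel : LinearModel P θ) (z : Fin 2) :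
    P[θ.ε z | sigmaXSz d z] =ᵐ[P] fun _ => 0 := by
  have h_proj : Measurable fun p : (Fin d → ℝ) × (Fin 2 → ℝ) => (p.1, p.2 z) := by fun_prop
  have h_le : sigmaXSz d z ≤ sigmaXS d :=
    (h_proj.comp (comap_measurable fun w : Subject d => (w.x, w.s))).comap_le
  have h_le' : sigmaXS d ≤ (inferInstance : MeasurableSpace (Subject d)) :=
    (measurable_x.prodMk measurable_s).comap_le
  refine (condExp_condExp_of_le h_le h_le').symm.trans
    ((condExp_congr_ae (hmodel.mean_ε z)).trans ?_)
  rw [condExp_const (h_le.trans h_le')]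

theorem linearProjectionModel (hmodel : LinearModel P θ) (herr : SubGaussianErrors P θ)
    (hcov : CovariateCondition P) : LinearProjectionModel P θ := by
  have h_x : Measurable[sigmaX d] fun w : Subject d => w.x := comap_measurable _
  have h_xs : Measurable[sigmaXS d] fun w : Subject d => (w.x, w.s) := comap_measurable _
  have h_x' : Measurable[sigmaXS d] fun w : Subject d => w.x :=
    (measurable_fst (α := Fin d → ℝ) (β := Fin 2 → ℝ)).comp h_xs
  have h_sigmaX : sigmaX d ≤ (inferInstance : MeasurableSpace (Subject d)) := measurable_x.comap_le
  have h_sigmaXS : sigmaXS d ≤ (inferInstance : MeasurableSpace (Subject d)) :=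
    (measurable_x.prodMk measurable_s).comap_le
  have memLp_x i := (hcov.finitePsiTwo_x i).memLp (by fun_prop)
  have memLp_εS z := (herr.psi_εS z).memLp (by fun_prop)
  have memLp_ε z : MemLp (θ.ε z) 2 P :=
    ((herr.psi_εY z).memLp (by fun_prop)).sub ((memLp_εS z).const_mul (θ.γ z))
  have h_εS z : Measurable[sigmaXS d] (θ.εS z) := by
    have h : Measurable fun p : (Fin d → ℝ) × (Fin 2 → ℝ) => p.2 z - θ.αS z ⬝ᵥ p.1 := by fun_prop
    exact h.comp h_xs
  exact
    { σS_pos := hmodel.σS_pos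
      σ_pos := hmodel.σ_pos
      psi_x := hcov.finitePsiTwo_x
      psi_εS := herr.psi_εS
      psi_εY := herr.psi_εY
      integral_x_mul_εS := fun z i => integral_mul_eq_zero_of_condExp h_sigmaX
        ((measurable_pi_apply i).comp h_x) (memLp_x i) (memLp_εS z) (hmodel.mean_εS z)
      integral_x_mul_ε := fun z i => integral_mul_eq_zero_of_condExp h_sigmaXS
        ((measurable_pi_apply i).comp h_x') (memLp_x i) (memLp_ε z) (hmodel.mean_ε z)
      integral_εS_mul_ε := fun z z' => integral_mul_eq_zero_of_condExp h_sigmaXS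
        (h_εS z') (memLp_εS z') (memLp_ε z) (hmodel.mean_ε z)
      integral_εS_sq := fun z =>
        integral_sq_eq_of_condVar h_sigmaX (hmodel.mean_εS z) (hmodel.var_εS z)
      integral_ε_sq := fun z => integral_sq_eq_of_condVar
        ((measurable_x.prodMk ((measurable_pi_apply z).comp measurable_s)).comap_le)
        (hmodel.condExp_ε_sigmaXSz z) (hmodel.var_ε z)
      lambdaMin_pos := hcov.lambdaMin_pos }

end LinearModel

namespace LinearProjectionModel

variable {d : ℕ} {P : Measure (Subject d)} {θ : Params d} (h : LinearProjectionModel P θ)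

include h

theorem memLp_x (i : Fin d) : MemLp (fun w : Subject d => w.x i) 2 P :=
  (h.psi_x i).memLp (by fun_prop)

theorem memLp_εS (z : Fin 2) : MemLp (θ.εS z) 2 P := (h.psi_εS z).memLp (by fun_prop)

theorem memLp_εY (z : Fin 2) : MemLp (θ.εY z) 2 P := (h.psi_εY z).memLp (by fun_prop)

theorem memLp_ε (z : Fin 2) : MemLp (θ.ε z) 2 P :=
  (h.memLp_εY z).sub ((h.memLp_εS z).const_mul (θ.γ z))

theorem memLp_dotProduct_x (v : Fin d → ℝ) : MemLp (fun w : Subject d => v ⬝ᵥ w.x) 2 P :=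
  memLp_finsetSum Finset.univ fun i _ => (h.memLp_x i).const_mul (v i)

theorem memLp_y (z : Fin 2) : MemLp (fun w : Subject d => w.y z) 2 P := by
  convert (h.memLp_εY z).add (h.memLp_dotProduct_x (θ.αY z)) using 1
  ext w
  simp [Params.εY]

theorem memLp_s (z : Fin 2) : MemLp (fun w : Subject d => w.s z) 2 P := by
  convert (h.memLp_εS z).add (h.memLp_dotProduct_x (θ.αS z)) using 1
  ext w
  simp [Params.εS]

theorem integral_x_mul_εY (z : Fin 2) (i : Fin d) : ∫ w, w.x i * θ.εY z w ∂P = 0 := by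
  have h_split : ∀ w, w.x i * θ.εY z w = w.x i * θ.ε z w + θ.γ z * (w.x i * θ.εS z w) :=
    fun w => by simp only [Params.ε]; ring
  have h_ε : Integrable (fun w => w.x i * θ.ε z w) P :=
    (h.memLp_x i).integrable_mul (h.memLp_ε z)
  have h_εS : Integrable (fun w => θ.γ z * (w.x i * θ.εS z w)) P :=
    ((h.memLp_x i).integrable_mul (h.memLp_εS z)).const_mul _
  simp_rw [h_split]
  rw [integral_add h_ε h_εS, integral_const_mul, h.integral_x_mul_ε, h.integral_x_mul_εS, mul_zero,
    add_zero]

theorem integral_εS_mul_εY (z : Fin 2) : ∫ w, θ.εS z w * θ.εY z w ∂P = θ.γ z * θ.σS z ^ 2 := by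
  have h_split : ∀ w, θ.εS z w * θ.εY z w = θ.εS z w * θ.ε z w + θ.γ z * θ.εS z w ^ 2 :=
    fun w => by simp only [Params.ε]; ring
  have h_cross : Integrable (fun w => θ.εS z w * θ.ε z w) P :=
    (h.memLp_εS z).integrable_mul (h.memLp_ε z)
  simp_rw [h_split]
  rw [integral_add h_cross ((h.memLp_εS z).integrable_sq.const_mul _), integral_const_mul,
    h.integral_εS_mul_ε, h.integral_εS_sq, zero_add]

theorem integral_εY_sq (z : Fin 2) :
    ∫ w, θ.εY z w ^ 2 ∂P = θ.γ z ^ 2 * θ.σS z ^ 2 + θ.σ z ^ 2 := by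
  have h_split : ∀ w, θ.εY z w = θ.γ z * θ.εS z w + θ.ε z w := fun w => by
    simp only [Params.ε]
    ring
  simp_rw [h_split]
  rw [integral_add_sq ((h.memLp_εS z).const_mul _) (h.memLp_ε z)]
  simp only [mul_assoc, mul_pow, integral_const_mul, h.integral_εS_mul_ε, h.integral_εS_sq,
    h.integral_ε_sq]
  ring

end LinearProjectionModel

theorem secondMoment_posDef {d : ℕ} {P : Measure (Subject d)} (h : 0 < lambdaMin P) :
    (secondMoment P).PosDef := by
  rw [(secondMoment_isHermitian P).posDef_iff_eigenvalues_pos]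
  exact fun i => h.trans_le (ciInf_le (Set.finite_range _).bddBelow i)

/-! ### The loss of an action with linear mean functions -/

section Loss

variable {d : ℕ} {P : Measure (Subject d)} {a : Action d}

theorem prod_assignLaw (P : Measure (Subject d)) [SFinite P] (p : ℝ) :
    P.prod (assignLaw p) = ENNReal.ofReal p • P.map (fun w => (w, (1 : Fin 2)))
      + ENNReal.ofReal (1 - p) • P.map (fun w => (w, (0 : Fin 2))) := by
  have : IsFiniteMeasure (ENNReal.ofReal p • Measure.dirac (1 : Fin 2)) :=
    Measure.smul_finite _ ENNReal.ofReal_ne_top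
  have : IsFiniteMeasure (ENNReal.ofReal (1 - p) • Measure.dirac (0 : Fin 2)) :=
    Measure.smul_finite _ ENNReal.ofReal_ne_top
  rw [assignLaw, Measure.prod_add, Measure.prod_smul_right, Measure.prod_smul_right,
    Measure.prod_dirac, Measure.prod_dirac]

theorem integral_prod_assignLaw [SFinite P] {p : ℝ} (h0 : 0 ≤ p) (h1 : p ≤ 1)
    {f : Subject d × Fin 2 → ℝ} (hf : Measurable f)
    (hf1 : Integrable (fun w => f (w, 1)) P) (hf0 : Integrable (fun w => f (w, 0)) P) :
    ∫ q, f q ∂(P.prod (assignLaw p)) = ∫ w, (p * f (w, 1) + (1 - p) * f (w, 0)) ∂P := by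
  have h_meas : ∀ z : Fin 2, AEMeasurable (fun w : Subject d => (w, z)) P := by fun_prop
  have h_int : ∀ z : Fin 2, Integrable (fun w => f (w, z)) P →
      Integrable f (P.map fun w => (w, z)) := fun z =>
    (integrable_map_measure hf.aestronglyMeasurable (h_meas z)).mpr
  rw [prod_assignLaw, integral_add_measure ((h_int 1 hf1).smul_measure ENNReal.ofReal_ne_top)
    ((h_int 0 hf0).smul_measure ENNReal.ofReal_ne_top), integral_smul_measure,
    integral_smul_measure, integral_map (h_meas 1) hf.aestronglyMeasurable,
    integral_map (h_meas 0) hf.aestronglyMeasurable, ENNReal.toReal_ofReal h0,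
    ENNReal.toReal_ofReal (sub_nonneg.mpr h1), smul_eq_mul, smul_eq_mul,
    integral_add (hf1.const_mul p) (hf0.const_mul (1 - p)), integral_const_mul, integral_const_mul]

theorem phi_one (a : Action d) (w : Subject d) :
    phi a w 1 = a.mean 1 w.x w.s - a.mean 0 w.x w.s + (w.y 1 - a.mean 1 w.x w.s) / a.prob := by
  simp [phi]

theorem phi_zero (a : Action d) (w : Subject d) :
    phi a w 0 = a.mean 1 w.x w.s - a.mean 0 w.x w.s
      - (w.y 0 - a.mean 0 w.x w.s) / (1 - a.prob) := by
  simp [phi]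

theorem measurable_phi (hm : ∀ z, Measurable fun w : Subject d => a.mean z w.x w.s) :
    Measurable fun q : Subject d × Fin 2 => phi a q.1 q.2 := by
  refine measurable_from_prod_countable_left fun z => ?_
  fin_cases z
  · simp only [Fin.zero_eta, phi_zero]
    fun_prop
  · simp only [Fin.mk_one, phi_one]
    fun_prop

theorem memLp_phi (hL : ∀ z, MemLp (fun w : Subject d => a.mean z w.x w.s) 2 P)
    (hy : ∀ z, MemLp (fun w : Subject d => w.y z) 2 P) (z : Fin 2) :
    MemLp (fun w => phi a w z) 2 P := by
  fin_cases z
  · simp only [Fin.zero_eta, phi_zero, div_eq_mul_inv]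
    exact ((hL 1).sub (hL 0)).sub (((hy 0).sub (hL 0)).mul_const _)
  · simp only [Fin.mk_one, phi_one, div_eq_mul_inv]
    exact ((hL 1).sub (hL 0)).add (((hy 1).sub (hL 1)).mul_const _)

theorem integral_phi [IsProbabilityMeasure P] (h0 : 0 < a.prob) (h1 : a.prob < 1)
    (hm : ∀ z, Measurable fun w : Subject d => a.mean z w.x w.s)
    (hL : ∀ z, MemLp (fun w : Subject d => a.mean z w.x w.s) 2 P)
    (hy : ∀ z, MemLp (fun w : Subject d => w.y z) 2 P) :
    ∫ q, phi a q.1 q.2 ∂(P.prod (assignLaw a.prob)) = ∫ w, (w.y 1 - w.y 0) ∂P := by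
  have h1' : 0 < 1 - a.prob := sub_pos.mpr h1
  rw [integral_prod_assignLaw h0.le h1.le (measurable_phi hm)
    ((memLp_phi hL hy 1).integrable one_le_two) ((memLp_phi hL hy 0).integrable one_le_two)]
  refine integral_congr_ae (ae_of_all _ fun w => ?_)
  simp only [phi_one, phi_zero]
  field_simp
  ring

theorem loss_eq [IsProbabilityMeasure P] (h0 : 0 < a.prob) (h1 : a.prob < 1)
    (hm : ∀ z, Measurable fun w : Subject d => a.mean z w.x w.s)
    (hL : ∀ z, MemLp (fun w : Subject d => a.mean z w.x w.s) 2 P)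
    (hy : ∀ z, MemLp (fun w : Subject d => w.y z) 2 P) :
    loss P a = Var[fun w => w.y 1 - w.y 0; P]
      + (∫ w, ((1 - a.prob) * (w.y 1 - a.mean 1 w.x w.s)
          + a.prob * (w.y 0 - a.mean 0 w.x w.s)) ^ 2 ∂P) / (a.prob * (1 - a.prob)) := by
  have h1' : 0 < 1 - a.prob := sub_pos.mpr h1
  have h_phi := measurable_phi hm
  set M := ∫ w, (w.y 1 - w.y 0) ∂P with hM
  have h_arm : ∀ z, Integrable (fun w => (phi a w z - M) ^ 2) P := fun z =>
    ((memLp_phi hL hy z).sub (memLp_const M)).integrable_sq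
  have h_effect : Integrable (fun w : Subject d => (w.y 1 - w.y 0 - M) ^ 2) P :=
    (((hy 1).sub (hy 0)).sub (memLp_const M)).integrable_sq
  have h_resid : Integrable (fun w : Subject d => ((1 - a.prob) * (w.y 1 - a.mean 1 w.x w.s)
      + a.prob * (w.y 0 - a.mean 0 w.x w.s)) ^ 2) P :=
    ((((hy 1).sub (hL 1)).const_mul (1 - a.prob)).add
      (((hy 0).sub (hL 0)).const_mul a.prob)).integrable_sq
  rw [loss, variance_eq_integral h_phi.aemeasurable, integral_phi h0 h1 hm hL hy,
    integral_prod_assignLaw h0.le h1.le ((h_phi.sub_const M).pow_const 2) (h_arm 1) (h_arm 0),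
    variance_eq_integral (by fun_prop), ← hM, ← integral_div,
    ← integral_add h_effect (h_resid.div_const _)]
  refine integral_congr_ae (ae_of_all _ fun w => ?_)
  simp only [phi_one, phi_zero]
  field_simp
  ring

end Loss

/-- Mean functions `g_z(x, s) = β_zᵀ x + g_z s(z)`, the form of both `μ_z` and `μ̂_z`. -/
def linMean {d : ℕ} (β : Fin 2 → Fin d → ℝ) (g : Fin 2 → ℝ) (z : Fin 2) (x : Fin d → ℝ)
    (s : Fin 2 → ℝ) : ℝ :=
  β z ⬝ᵥ x + g z * s z

section LinMean

variable {d : ℕ} {θ : Params d} (β : Fin 2 → Fin d → ℝ) (g : Fin 2 → ℝ)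

theorem condMean_eq_linMean (θ : Params d) :
    θ.condMean = linMean (fun z => θ.αY z - θ.γ z • θ.αS z) θ.γ := rfl

theorem measurable_linMean (z : Fin 2) :
    Measurable fun w : Subject d => linMean β g z w.x w.s := by
  unfold linMean
  fun_prop

theorem linMean_sub_condMean (θ : Params d) (z : Fin 2) (w : Subject d) :
    linMean β g z w.x w.s - θ.condMean z w.x w.s
      = (β z + g z • θ.αS z - θ.αY z) ⬝ᵥ w.x + (g z - θ.γ z) * θ.εS z w := by
  simp only [linMean, Params.condMean, Params.εS, sub_dotProduct, add_dotProduct, smul_dotProduct,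
    smul_eq_mul]
  ring

theorem y_sub_linMean (θ : Params d) (z : Fin 2) (w : Subject d) :
    w.y z - linMean β g z w.x w.s
      = θ.ε z w - (linMean β g z w.x w.s - θ.condMean z w.x w.s) := by
  simp only [Params.condMean, Params.ε, Params.εY, Params.εS, sub_dotProduct, smul_dotProduct,
    smul_eq_mul]
  ring

theorem sq_linMean_sub_condMean_le {β g} {ρ : ℝ} {z : Fin 2}
    (hβ : ∀ i, |(β z + g z • θ.αS z - θ.αY z) i| ≤ ρ) (hg : |g z - θ.γ z| ≤ ρ) (w : Subject d) :
    (linMean β g z w.x w.s - θ.condMean z w.x w.s) ^ 2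
      ≤ ρ ^ 2 * (∑ i, |w.x i| + |θ.εS z w|) ^ 2 := by
  have h_dot : |(β z + g z • θ.αS z - θ.αY z) ⬝ᵥ w.x| ≤ ρ * ∑ i, |w.x i| := by
    rw [Finset.mul_sum]
    refine (Finset.abs_sum_le_sum_abs _ _).trans (Finset.sum_le_sum fun i _ => ?_)
    rw [abs_mul]
    exact mul_le_mul_of_nonneg_right (hβ i) (abs_nonneg _)
  have h_εS : |(g z - θ.γ z) * θ.εS z w| ≤ ρ * |θ.εS z w| := by
    rw [abs_mul]
    exact mul_le_mul_of_nonneg_right hg (abs_nonneg _)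
  rw [← mul_pow, ← sq_abs, linMean_sub_condMean, mul_add]
  exact pow_le_pow_left₀ (abs_nonneg _) ((abs_add_le _ _).trans (add_le_add h_dot h_εS)) 2

end LinMean

namespace LinearProjectionModel

variable {d : ℕ} {P : Measure (Subject d)} {θ : Params d} (h : LinearProjectionModel P θ)
  (β : Fin 2 → Fin d → ℝ) (g : Fin 2 → ℝ)

include h

theorem πStar_pos : 0 < θ.πStar := div_pos (h.σ_pos 1) (add_pos (h.σ_pos 0) (h.σ_pos 1))

theorem one_sub_πStar : 1 - θ.πStar = θ.σ 0 / (θ.σ 0 + θ.σ 1) := by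
  have := add_pos (h.σ_pos 0) (h.σ_pos 1)
  rw [Params.πStar, one_sub_div this.ne', add_sub_cancel_right]

theorem πStar_lt_one : θ.πStar < 1 := by
  rw [← sub_pos, h.one_sub_πStar]
  exact div_pos (h.σ_pos 0) (add_pos (h.σ_pos 0) (h.σ_pos 1))

theorem πLow_pos : 0 < θ.πLow := lt_min h.πStar_pos (sub_pos.mpr h.πStar_lt_one)

theorem memLp_linMean (z : Fin 2) : MemLp (fun w : Subject d => linMean β g z w.x w.s) 2 P :=
  (h.memLp_dotProduct_x (β z)).add ((h.memLp_s z).const_mul (g z))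

theorem integral_dotProduct_x_mul_ε (v : Fin d → ℝ) (z : Fin 2) :
    ∫ w, v ⬝ᵥ w.x * θ.ε z w ∂P = 0 := by
  have h_int : ∀ i ∈ Finset.univ, Integrable (fun w => v i * (w.x i * θ.ε z w)) P := fun i _ =>
    ((h.memLp_x i).integrable_mul (h.memLp_ε z)).const_mul _
  simp only [dotProduct, Finset.sum_mul, mul_assoc]
  rw [integral_finsetSum _ h_int]
  simp only [integral_const_mul, h.integral_x_mul_ε, mul_zero, Finset.sum_const_zero]

theorem integral_linMean_sub_condMean_mul_ε (z z' : Fin 2) :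
    ∫ w, (linMean β g z w.x w.s - θ.condMean z w.x w.s) * θ.ε z' w ∂P = 0 := by
  have h_x : Integrable (fun w => (β z + g z • θ.αS z - θ.αY z) ⬝ᵥ w.x * θ.ε z' w) P :=
    (h.memLp_dotProduct_x _).integrable_mul (h.memLp_ε z')
  have h_εS : Integrable (fun w => (g z - θ.γ z) * (θ.εS z w * θ.ε z' w)) P :=
    ((h.memLp_εS z).integrable_mul (h.memLp_ε z')).const_mul _
  simp only [linMean_sub_condMean, add_mul, mul_assoc]
  rw [integral_add h_x h_εS, integral_const_mul, h.integral_dotProduct_x_mul_ε,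
    h.integral_εS_mul_ε, mul_zero, add_zero]

theorem integral_mixed_ε_sq (p : ℝ) :
    ∫ w, ((1 - p) * θ.ε 1 w + p * θ.ε 0 w) ^ 2 ∂P
      = (1 - p) ^ 2 * θ.σ 1 ^ 2 + 2 * (p * (1 - p)) * ∫ w, θ.ε 1 w * θ.ε 0 w ∂P
        + p ^ 2 * θ.σ 0 ^ 2 := by
  rw [integral_add_sq ((h.memLp_ε 1).const_mul _) ((h.memLp_ε 0).const_mul _)]
  simp only [mul_pow, mul_mul_mul_comm (1 - p), integral_const_mul, h.integral_ε_sq]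
  ring

theorem memLp_linMean_sub_condMean (z : Fin 2) :
    MemLp (fun w : Subject d => linMean β g z w.x w.s - θ.condMean z w.x w.s) 2 P :=
  (h.memLp_linMean β g z).sub (h.memLp_linMean (fun z => θ.αY z - θ.γ z • θ.αS z) θ.γ z)

theorem integral_mixed_ε_mul_linMean_sub_condMean (p : ℝ) :
    ∫ w, ((1 - p) * θ.ε 1 w + p * θ.ε 0 w)
      * ((1 - p) * (linMean β g 1 w.x w.s - θ.condMean 1 w.x w.s)
        + p * (linMean β g 0 w.x w.s - θ.condMean 0 w.x w.s)) ∂P = 0 := by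
  set Δ : Fin 2 → Subject d → ℝ := fun z w => linMean β g z w.x w.s - θ.condMean z w.x w.s
  have hΔ := h.memLp_linMean_sub_condMean β g
  have h_int : ∀ c z z', Integrable (fun w => c * (Δ z w * θ.ε z' w)) P := fun c z z' =>
    ((hΔ z).integrable_mul (h.memLp_ε z')).const_mul c
  have h_arm : ∀ z', ∫ w, ((1 - p) * Δ 1 w + p * Δ 0 w) * θ.ε z' w ∂P = 0 := fun z' => by
    simp only [add_mul, mul_assoc]
    rw [integral_add (h_int _ 1 z') (h_int _ 0 z'), integral_const_mul, integral_const_mul,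
      h.integral_linMean_sub_condMean_mul_ε, h.integral_linMean_sub_condMean_mul_ε]
    ring
  have h_int' : ∀ c z', Integrable (fun w => c * (((1 - p) * Δ 1 w + p * Δ 0 w) * θ.ε z' w)) P :=
    fun c z' => ((((hΔ 1).const_mul _).add ((hΔ 0).const_mul _)).integrable_mul
      (h.memLp_ε z')).const_mul c
  have h_expand : ∀ w, ((1 - p) * θ.ε 1 w + p * θ.ε 0 w) * ((1 - p) * Δ 1 w + p * Δ 0 w)
      = (1 - p) * (((1 - p) * Δ 1 w + p * Δ 0 w) * θ.ε 1 w)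
        + p * (((1 - p) * Δ 1 w + p * Δ 0 w) * θ.ε 0 w) := fun w => by ring
  refine (integral_congr_ae (ae_of_all _ h_expand)).trans ?_
  rw [integral_add (h_int' _ 1) (h_int' _ 0), integral_const_mul, integral_const_mul, h_arm, h_arm]
  ring

theorem loss_linMean [IsProbabilityMeasure P] {p : ℝ} (h0 : 0 < p) (h1 : p < 1) :
    loss P ⟨p, linMean β g⟩ = Var[fun w => w.y 1 - w.y 0; P] + 2 * ∫ w, θ.ε 1 w * θ.ε 0 w ∂P
      + (1 - p) / p * θ.σ 1 ^ 2 + p / (1 - p) * θ.σ 0 ^ 2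
      + (∫ w, ((1 - p) * (linMean β g 1 w.x w.s - θ.condMean 1 w.x w.s)
          + p * (linMean β g 0 w.x w.s - θ.condMean 0 w.x w.s)) ^ 2 ∂P) / (p * (1 - p)) := by
  have h1' : 0 < 1 - p := sub_pos.mpr h1
  set Δ : Fin 2 → Subject d → ℝ := fun z w => linMean β g z w.x w.s - θ.condMean z w.x w.s
  set N : Subject d → ℝ := fun w => (1 - p) * θ.ε 1 w + p * θ.ε 0 w
  have hΔ := h.memLp_linMean_sub_condMean β g
  have hN : MemLp N 2 P := ((h.memLp_ε 1).const_mul _).add ((h.memLp_ε 0).const_mul _)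
  have h_dev : MemLp (fun w => -((1 - p) * Δ 1 w + p * Δ 0 w)) 2 P :=
    (((hΔ 1).const_mul _).add ((hΔ 0).const_mul _)).neg
  have h_orth : ∫ w, N w * -((1 - p) * Δ 1 w + p * Δ 0 w) ∂P = 0 := by
    simp only [mul_neg, integral_neg, neg_eq_zero]
    exact h.integral_mixed_ε_mul_linMean_sub_condMean β g p
  have h_split : ∀ w : Subject d, (1 - p) * (w.y 1 - linMean β g 1 w.x w.s)
      + p * (w.y 0 - linMean β g 0 w.x w.s) = N w + -((1 - p) * Δ 1 w + p * Δ 0 w) := fun w => by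
    simp only [y_sub_linMean β g θ, N, Δ]
    ring
  rw [loss_eq h0 h1 (measurable_linMean β g) (h.memLp_linMean β g) h.memLp_y]
  simp_rw [h_split]
  rw [integral_add_sq hN h_dev, h_orth, h.integral_mixed_ε_sq]
  simp only [neg_sq]
  field_simp
  ring

theorem loss_optAction [IsProbabilityMeasure P] :
    loss P (optAction θ) = Var[fun w => w.y 1 - w.y 0; P] + 2 * ∫ w, θ.ε 1 w * θ.ε 0 w ∂P
      + 2 * (θ.σ 0 * θ.σ 1) := by
  have h_σ0 := h.σ_pos 0
  have h_σ1 := h.σ_pos 1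
  rw [optAction, condMean_eq_linMean, h.loss_linMean _ _ h.πStar_pos h.πStar_lt_one,
    condMean_eq_linMean]
  simp only [sub_self, mul_zero, add_zero, ne_eq, OfNat.ofNat_ne_zero, not_false_eq_true, zero_pow,
    integral_zero, zero_div, h.one_sub_πStar]
  unfold Params.πStar
  field_simp
  ring

theorem loss_linMean_sub_loss_optAction [IsProbabilityMeasure P] {p : ℝ} (h0 : 0 < p)
    (h1 : p < 1) :
    loss P ⟨p, linMean β g⟩ - loss P (optAction θ)
      = ((θ.σ 0 + θ.σ 1) ^ 2 * (p - θ.πStar) ^ 2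
          + ∫ w, ((1 - p) * (linMean β g 1 w.x w.s - θ.condMean 1 w.x w.s)
              + p * (linMean β g 0 w.x w.s - θ.condMean 0 w.x w.s)) ^ 2 ∂P) / (p * (1 - p)) := by
  have h1' : 0 < 1 - p := sub_pos.mpr h1
  have h_σ0 := h.σ_pos 0
  have h_σ1 := h.σ_pos 1
  rw [h.loss_linMean β g h0 h1, h.loss_optAction]
  unfold Params.πStar
  field_simp
  ring

theorem exists_loss_linMean_sub_le [IsProbabilityMeasure P] :
    ∃ C : ℝ, 0 ≤ C ∧ ∀ (p : ℝ) (β : Fin 2 → Fin d → ℝ) (g : Fin 2 → ℝ) (ρ : ℝ),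
      θ.πLow / 2 ≤ p → θ.πLow / 2 ≤ 1 - p → |p - θ.πStar| ≤ ρ →
      (∀ z i, |(β z + g z • θ.αS z - θ.αY z) i| ≤ ρ) → (∀ z, |g z - θ.γ z| ≤ ρ) →
      loss P ⟨p, linMean β g⟩ - loss P (optAction θ) ≤ C * ρ ^ 2 := by
  have h_low := h.πLow_pos
  set F : Fin 2 → Subject d → ℝ := fun z w => ∑ i, |w.x i| + |θ.εS z w|
  have hF : ∀ z, MemLp (F z) 2 P := fun z =>
    (memLp_finsetSum _ fun i _ => (h.memLp_x i).abs).add (h.memLp_εS z).abs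
  set E : ℝ := ∫ w, (F 1 w ^ 2 + F 0 w ^ 2) ∂P with hE
  refine ⟨((θ.σ 0 + θ.σ 1) ^ 2 + E) / (θ.πLow / 2) ^ 2, by positivity, ?_⟩
  intro p β g ρ hp hp' hpi hβ hg
  have h0 : 0 < p := by linarith
  have h1 : 0 < 1 - p := by linarith
  have h_mean : ∫ w, ((1 - p) * (linMean β g 1 w.x w.s - θ.condMean 1 w.x w.s)
      + p * (linMean β g 0 w.x w.s - θ.condMean 0 w.x w.s)) ^ 2 ∂P ≤ E * ρ ^ 2 := by
    rw [hE, ← integral_mul_const]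
    refine integral_mono_of_nonneg (ae_of_all _ fun w => sq_nonneg _)
      (((hF 1).integrable_sq.add (hF 0).integrable_sq).mul_const _) (ae_of_all _ fun w => ?_)
    have h_dev1 := sq_linMean_sub_condMean_le (hβ 1) (hg 1) w
    have h_dev0 := sq_linMean_sub_condMean_le (hβ 0) (hg 0) w
    set u := linMean β g 1 w.x w.s - θ.condMean 1 w.x w.s
    set v := linMean β g 0 w.x w.s - θ.condMean 0 w.x w.s
    have h_convex : ((1 - p) * u + p * v) ^ 2 ≤ (1 - p) * u ^ 2 + p * v ^ 2 := by
      nlinarith [mul_nonneg (mul_pos h0 h1).le (sq_nonneg (u - v))]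
    have h_weights : (1 - p) * u ^ 2 + p * v ^ 2 ≤ u ^ 2 + v ^ 2 := by
      nlinarith [mul_nonneg h0.le (sq_nonneg u), mul_nonneg h1.le (sq_nonneg v)]
    simp only [F]
    linarith
  have h_prob : (p - θ.πStar) ^ 2 ≤ ρ ^ 2 := sq_le_sq' (abs_le.mp hpi).1 (abs_le.mp hpi).2
  rw [h.loss_linMean_sub_loss_optAction β g h0 (by linarith), div_mul_eq_mul_div, add_mul]
  gcongr
  rw [sq]
  gcongr

end LinearProjectionModel

theorem Params.πLow_le_half {d : ℕ} (θ : Params d) : θ.πLow ≤ 1 / 2 := by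
  have := min_le_left θ.πStar (1 - θ.πStar)
  have := min_le_right θ.πStar (1 - θ.πStar)
  unfold Params.πLow
  linarith

/-! ### The estimators as smooth functions of empirical moments -/

section MatrixCalculus

variable {E n : Type*} [NormedAddCommGroup E] [NormedSpace ℝ E] [Fintype n]
  {A : E → Matrix n n ℝ} {u v : E → n → ℝ} {e : E}

theorem differentiableAt_dotProduct (hu : ∀ i, DifferentiableAt ℝ (fun e => u e i) e)
    (hv : ∀ i, DifferentiableAt ℝ (fun e => v e i) e) :
    DifferentiableAt ℝ (fun e => u e ⬝ᵥ v e) e := by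
  unfold dotProduct
  fun_prop

theorem differentiableAt_mulVec_apply (hA : ∀ i j, DifferentiableAt ℝ (fun e => A e i j) e)
    (hv : ∀ i, DifferentiableAt ℝ (fun e => v e i) e) (i : n) :
    DifferentiableAt ℝ (fun e => (A e *ᵥ v e) i) e :=
  differentiableAt_dotProduct (hA i) hv

variable [DecidableEq n]

theorem differentiableAt_matrix_det (hA : ∀ i j, DifferentiableAt ℝ (fun e => A e i j) e) :
    DifferentiableAt ℝ (fun e => (A e).det) e := by
  simp only [Matrix.det_apply]
  fun_prop

theorem differentiableAt_matrix_inv_apply (hA : ∀ i j, DifferentiableAt ℝ (fun e => A e i j) e)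
    (hdet : (A e).det ≠ 0) (i j : n) : DifferentiableAt ℝ (fun e => (A e)⁻¹ i j) e := by
  have h_adj : DifferentiableAt ℝ (fun e => (A e).adjugate i j) e := by
    simp only [Matrix.adjugate_apply]
    refine differentiableAt_matrix_det fun k l => ?_
    by_cases hk : k = j
    · subst hk
      simp
    · simpa only [Matrix.updateRow_ne hk] using hA k l
  simp only [Matrix.inv_def, Ring.inverse_eq_inv, Matrix.smul_apply, smul_eq_mul]
  exact ((differentiableAt_matrix_det hA).inv hdet).mul h_adj

end MatrixCalculus

theorem exists_forall_norm_sub_le_of_differentiableAt {E F : Type*} [NormedAddCommGroup E]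
    [NormedSpace ℝ E] [NormedAddCommGroup F] [NormedSpace ℝ F] {f : E → F} {e₀ : E}
    (hf : DifferentiableAt ℝ f e₀) {p : E → Prop} (hp : ∀ᶠ e in nhds e₀, p e) :
    ∃ C r : ℝ, 0 < C ∧ 0 < r ∧ ∀ (e : E) (ρ : ℝ), ‖e - e₀‖ ≤ ρ → ρ ≤ r →
      p e ∧ ‖f e - f e₀‖ ≤ C * ρ := by
  obtain ⟨C, hC, hfC⟩ := hf.isBigO_sub.exists_pos
  obtain ⟨r, hr, h⟩ := Metric.eventually_nhds_iff.mp (hp.and hfC.bound)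
  refine ⟨C, r / 2, hC, half_pos hr, fun e ρ he hρ => ?_⟩
  obtain ⟨hpe, hfe⟩ := h (show dist e e₀ < r by rw [dist_eq_norm]; linarith)
  exact ⟨hpe, hfe.trans (by gcongr)⟩

/-- The coordinates of a unit that enter the estimators of one arm: the covariates, the two
surrogate errors and the outcome error of that arm. -/
abbrev FeatureIndex (d : ℕ) := Fin d ⊕ Fin 2 ⊕ Unit

/-- The feature vector `(x, ε_S(0), ε_S(1), ε_Y(z))` of an observation with treatment `z`. -/
def obsFeature {d : ℕ} (θ : Params d) (z : Fin 2) (o : Obs d) : FeatureIndex d → ℝ :=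
  Sum.elim o.1 (Sum.elim (fun z' => o.2.2.1 z' - θ.αS z' ⬝ᵥ o.1)
    fun _ => o.2.2.2 - θ.αY z ⬝ᵥ o.1)

/-- The feature vector of a unit observed under treatment `z`. -/
def feature {d : ℕ} (θ : Params d) (z : Fin 2) (w : Subject d) : FeatureIndex d → ℝ :=
  obsFeature θ z (observe w z)

/-- The population second moments of the features. -/
noncomputable def featureMoment {d : ℕ} (P : Measure (Subject d)) (θ : Params d) (z : Fin 2)
    (a b : FeatureIndex d) : ℝ :=
  ∫ w, feature θ z w a * feature θ z w b ∂P

/-- The moments from which the estimators of one arm are computed: those of `(X, X)` and of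
`(X, ε_S(z))` over all stages, which determine `α̂_S`, and those of the features over the arm. -/
abbrev ArmMoments (d : ℕ) :=
  (Fin d → Fin d → ℝ) × (Fin d → ℝ) × (FeatureIndex d → FeatureIndex d → ℝ)

namespace ArmMoments

variable {d : ℕ} (z : Fin 2) (m : ArmMoments d)

/-- The matrix of `(X, X)`-moments over all stages. -/
def gram : Matrix (Fin d) (Fin d) ℝ := Matrix.of m.1

/-- The matrix of `(X, X)`-moments over the arm. -/
def armGram : Matrix (Fin d) (Fin d) ℝ :=
  Matrix.of fun i k => m.2.2 (Sum.inl i) (Sum.inl k)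

/-- The error `α̂_S - α_S`. -/
noncomputable def αSErr : Fin d → ℝ := m.gram⁻¹ *ᵥ m.2.1

/-- The error `α̂_Y - α_Y`. -/
noncomputable def αYErr : Fin d → ℝ :=
  m.armGram⁻¹ *ᵥ fun i => m.2.2 (Sum.inl i) (Sum.inr (Sum.inr ()))

/-- The moment over the arm of the product of the residuals `f_p - aᵀ x` and `f_q - bᵀ x` of two
features. -/
def residualMoment (p q : FeatureIndex d) (a b : Fin d → ℝ) : ℝ :=
  m.2.2 p q - (a ⬝ᵥ fun i => m.2.2 (Sum.inl i) q) - (b ⬝ᵥ fun i => m.2.2 (Sum.inl i) p)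
    + a ⬝ᵥ (m.armGram *ᵥ b)

/-- The moment of the squared outcome residual. -/
noncomputable def residualYY : ℝ :=
  m.residualMoment (Sum.inr (Sum.inr ())) (Sum.inr (Sum.inr ())) m.αYErr m.αYErr

/-- The moment of the product of the outcome and surrogate residuals. -/
noncomputable def residualYS : ℝ :=
  m.residualMoment (Sum.inr (Sum.inr ())) (Sum.inr (Sum.inl z)) m.αYErr m.αSErr

/-- The moment of the squared surrogate residual. -/
noncomputable def residualSS : ℝ :=
  m.residualMoment (Sum.inr (Sum.inl z)) (Sum.inr (Sum.inl z)) m.αSErr m.αSErr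

/-- The estimate `γ̂`. -/
noncomputable def γHat : ℝ := m.residualYS z / m.residualSS z

/-- The estimate `σ̂²`. -/
noncomputable def σSqHat : ℝ :=
  m.residualYY - 2 * m.γHat z * m.residualYS z + m.γHat z ^ 2 * m.residualSS z

/-- The estimates `(α̂_Y - γ̂ α̂_S + γ̂ α_S - α_Y, γ̂, σ̂)`; the first component is the error in the
coefficient of `x` when `μ̂` is written in terms of `x` and `ε_S`. -/
noncomputable def estimates : (Fin d → ℝ) × ℝ × ℝ :=
  (m.αYErr - m.γHat z • m.αSErr, m.γHat z, √(m.σSqHat z))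

variable {z m}

theorem differentiableAt_αSErr (hdet : m.gram.det ≠ 0) (i : Fin d) :
    DifferentiableAt ℝ (fun m : ArmMoments d => m.αSErr i) m :=
  differentiableAt_mulVec_apply (differentiableAt_matrix_inv_apply
    (fun i j => by simp only [gram, Matrix.of_apply]; fun_prop) hdet) (by fun_prop) i

theorem differentiableAt_αYErr (hdet : m.armGram.det ≠ 0) (i : Fin d) :
    DifferentiableAt ℝ (fun m : ArmMoments d => m.αYErr i) m :=
  differentiableAt_mulVec_apply (differentiableAt_matrix_inv_apply
    (fun i j => by simp only [armGram, Matrix.of_apply]; fun_prop) hdet) (by fun_prop) i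

theorem differentiableAt_residualMoment {p q : FeatureIndex d} {a b : ArmMoments d → Fin d → ℝ}
    (ha : ∀ i, DifferentiableAt ℝ (fun m => a m i) m)
    (hb : ∀ i, DifferentiableAt ℝ (fun m => b m i) m) :
    DifferentiableAt ℝ (fun m : ArmMoments d => m.residualMoment p q (a m) (b m)) m := by
  have h_gram : ∀ i j, DifferentiableAt ℝ (fun m : ArmMoments d => m.armGram i j) m :=
    fun i j => by simp only [armGram, Matrix.of_apply]; fun_prop
  exact ((DifferentiableAt.sub (by fun_prop) (differentiableAt_dotProduct ha (by fun_prop))).sub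
    (differentiableAt_dotProduct hb (by fun_prop))).add
    (differentiableAt_dotProduct ha (differentiableAt_mulVec_apply h_gram hb))

theorem differentiableAt_estimates (hdet : m.gram.det ≠ 0) (hdet' : m.armGram.det ≠ 0)
    (hSS : m.residualSS z ≠ 0) (hσ : m.σSqHat z ≠ 0) :
    DifferentiableAt ℝ (fun m : ArmMoments d => m.estimates z) m := by
  have hS := differentiableAt_αSErr hdet
  have hY := differentiableAt_αYErr hdet'
  have h_YY : DifferentiableAt ℝ (fun m : ArmMoments d => m.residualYY) m :=
    differentiableAt_residualMoment hY hY
  have h_YS : DifferentiableAt ℝ (fun m : ArmMoments d => m.residualYS z) m :=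
    differentiableAt_residualMoment hY hS
  have h_SS : DifferentiableAt ℝ (fun m : ArmMoments d => m.residualSS z) m :=
    differentiableAt_residualMoment hS hS
  have hγ : DifferentiableAt ℝ (fun m : ArmMoments d => m.γHat z) m := by
    simp only [γHat, div_eq_mul_inv]
    exact h_YS.mul (h_SS.inv hSS)
  have h_coef : DifferentiableAt ℝ (fun m : ArmMoments d => m.αYErr - m.γHat z • m.αSErr) m :=
    (differentiableAt_pi.mpr hY).sub (hγ.smul (differentiableAt_pi.mpr hS))
  have h_sq : DifferentiableAt ℝ (fun m : ArmMoments d => m.σSqHat z) m :=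
    (h_YY.sub ((hγ.const_mul 2).mul h_YS)).add ((hγ.pow 2).mul h_SS)
  exact h_coef.prodMk (hγ.prodMk (h_sq.sqrt hσ))

/-- The population value of the moments. -/
noncomputable def population {d : ℕ} (P : Measure (Subject d)) (θ : Params d) (z : Fin 2) :
    ArmMoments d :=
  (secondMoment P, fun i => ∫ w, w.x i * θ.εS z w ∂P, featureMoment P θ z)

end ArmMoments

section Features

variable {d : ℕ} (θ : Params d) (z : Fin 2) (w : Subject d)

theorem feature_inr_inl (z' : Fin 2) : feature θ z w (Sum.inr (Sum.inl z')) = θ.εS z' w := rfl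

theorem feature_inr_inr (u : Unit) : feature θ z w (Sum.inr (Sum.inr u)) = θ.εY z w := rfl

end Features

namespace LinearProjectionModel

open ArmMoments

variable {d : ℕ} {P : Measure (Subject d)} {θ : Params d} (h : LinearProjectionModel P θ)
  (z : Fin 2)

include h

theorem αSErr_population : (population P θ z).αSErr = 0 := by
  have h_zero : (population P θ z).2.1 = 0 := funext fun i => h.integral_x_mul_εS z i
  rw [αSErr, h_zero, Matrix.mulVec_zero]

theorem αYErr_population : (population P θ z).αYErr = 0 := by
  have h_zero : (fun i => (population P θ z).2.2 (Sum.inl i) (Sum.inr (Sum.inr ()))) = 0 :=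
    funext fun i => h.integral_x_mul_εY z i
  rw [αYErr, h_zero, Matrix.mulVec_zero]

theorem residualSS_population : (population P θ z).residualSS z = θ.σS z ^ 2 := by
  rw [residualSS, residualMoment, h.αSErr_population, ← h.integral_εS_sq z]
  simp only [population, featureMoment, feature_inr_inl, zero_dotProduct, sub_zero, add_zero, sq]

theorem residualYS_population : (population P θ z).residualYS z = θ.γ z * θ.σS z ^ 2 := by
  rw [residualYS, residualMoment, h.αSErr_population, h.αYErr_population, ← h.integral_εS_mul_εY z]
  simp only [population, featureMoment, feature_inr_inl, feature_inr_inr, zero_dotProduct, sub_zero,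
    add_zero, mul_comm]

theorem residualYY_population :
    (population P θ z).residualYY = θ.γ z ^ 2 * θ.σS z ^ 2 + θ.σ z ^ 2 := by
  rw [residualYY, residualMoment, h.αYErr_population, ← h.integral_εY_sq z]
  simp only [population, featureMoment, feature_inr_inr, zero_dotProduct, sub_zero, add_zero, sq]

theorem γHat_population : (population P θ z).γHat z = θ.γ z := by
  have := h.σS_pos z
  rw [ArmMoments.γHat, h.residualYS_population, h.residualSS_population]
  field_simp

theorem σSqHat_population : (population P θ z).σSqHat z = θ.σ z ^ 2 := by
  rw [σSqHat, h.γHat_population, h.residualYY_population, h.residualYS_population,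
    h.residualSS_population]
  ring

theorem estimates_population : (population P θ z).estimates z = (0, θ.γ z, θ.σ z) := by
  rw [estimates, h.αSErr_population, h.αYErr_population, h.γHat_population, h.σSqHat_population,
    Real.sqrt_sq (h.σ_pos z).le, smul_zero, sub_zero]

theorem differentiableAt_estimates_population :
    DifferentiableAt ℝ (fun m : ArmMoments d => m.estimates z) (population P θ z) := by
  have h_det : (secondMoment P).det ≠ 0 := (secondMoment_posDef h.lambdaMin_pos).det_pos.ne'
  refine differentiableAt_estimates h_det h_det ?_ ?_
  · rw [h.residualSS_population]
    exact (pow_pos (h.σS_pos z) 2).ne'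
  · rw [h.σSqHat_population]
    exact (pow_pos (h.σ_pos z) 2).ne'

theorem eventually_gram_det_ne_zero :
    ∀ᶠ m in nhds (population P θ z), m.gram.det ≠ 0 ∧ m.armGram.det ≠ 0 := by
  have h_det : (secondMoment P).det ≠ 0 := (secondMoment_posDef h.lambdaMin_pos).det_pos.ne'
  have h_gram : Continuous fun m : ArmMoments d => m.gram.det := by
    unfold gram
    fun_prop
  have h_armGram : Continuous fun m : ArmMoments d => m.armGram.det := by
    unfold armGram
    fun_prop
  exact ((h_gram.tendsto (population P θ z)).eventually_ne h_det).and
    ((h_armGram.tendsto (population P θ z)).eventually_ne h_det)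

end LinearProjectionModel

/-! ### Accuracy of the estimators -/

section EmpiricalMoments

open scoped BigOperators

variable {d : ℕ}

theorem dotProduct_expect {ι : Type*} (I : Finset ι) (a : Fin d → ℝ) (x : ι → Fin d → ℝ)
    (f : ι → ℝ) :
    (a ⬝ᵥ fun i => 𝔼 j ∈ I, x j i * f j) = 𝔼 j ∈ I, (a ⬝ᵥ x j) * f j := by
  simp only [dotProduct, Finset.mul_expect, Finset.sum_mul, Finset.expect_sum_comm, mul_assoc]

theorem expect_residual_mul_residual {ι : Type*} (I : Finset ι) (a b : Fin d → ℝ)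
    (x : ι → Fin d → ℝ) (p q : ι → ℝ) :
    𝔼 j ∈ I, (p j - a ⬝ᵥ x j) * (q j - b ⬝ᵥ x j) =
      𝔼 j ∈ I, p j * q j - (a ⬝ᵥ fun i => 𝔼 j ∈ I, x j i * q j)
        - (b ⬝ᵥ fun i => 𝔼 j ∈ I, x j i * p j)
        + a ⬝ᵥ (Matrix.of (fun i k => 𝔼 j ∈ I, x j i * x j k) *ᵥ b) := by
  have h_quad : (Matrix.of (fun i k => 𝔼 j ∈ I, x j i * x j k) *ᵥ b) =
      fun i => 𝔼 j ∈ I, x j i * (b ⬝ᵥ x j) := by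
    funext i
    rw [Matrix.mulVec, dotProduct_comm]
    simp only [Matrix.of_apply, mul_comm (x _ i), dotProduct_expect]
  rw [h_quad, dotProduct_expect, dotProduct_expect, dotProduct_expect, ← Finset.expect_sub_distrib,
    ← Finset.expect_sub_distrib, ← Finset.expect_add_distrib]
  exact Finset.expect_congr rfl fun j _ => by ring

theorem ols_sub_eq (D : ℕ → Obs d) {I : Finset ℕ} (hI : I.Nonempty) (r : ℕ → ℝ) (α : Fin d → ℝ)
    (hdet : (Matrix.of fun i k => 𝔼 j ∈ I, xAt D j i * xAt D j k).det ≠ 0) :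
    ols D I r - α = (Matrix.of fun i k => 𝔼 j ∈ I, xAt D j i * xAt D j k)⁻¹ *ᵥ
      fun i => 𝔼 j ∈ I, xAt D j i * (r j - α ⬝ᵥ xAt D j) := by
  set G : Matrix (Fin d) (Fin d) ℝ := Matrix.of fun i k => 𝔼 j ∈ I, xAt D j i * xAt D j k with hG
  set w : Fin d → ℝ := fun i => 𝔼 j ∈ I, xAt D j i * (r j - α ⬝ᵥ xAt D j) with hw
  have h_card : (I.card : ℝ) ≠ 0 := Nat.cast_ne_zero.mpr hI.card_ne_zero
  have h_sum : ∑ j ∈ I, Matrix.vecMulVec (xAt D j) (xAt D j) = (I.card : ℝ) • G := by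
    ext i k
    simp only [Matrix.sum_apply, Matrix.vecMulVec_apply, hG, Matrix.smul_apply, Matrix.of_apply,
      smul_eq_mul, Finset.card_mul_expect]
  have h_normal : ((I.card : ℝ) • G) *ᵥ (α + G⁻¹ *ᵥ w) = ∑ j ∈ I, r j • xAt D j := by
    rw [Matrix.smul_mulVec, Matrix.mulVec_add, Matrix.mulVec_mulVec,
      Matrix.mul_nonsing_inv _ hdet.isUnit, Matrix.one_mulVec]
    funext i
    have h_left : (G *ᵥ α) i = 𝔼 j ∈ I, (α ⬝ᵥ xAt D j) * xAt D j i := by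
      rw [← dotProduct_expect, Matrix.mulVec, dotProduct_comm]
      simp only [hG, Matrix.of_apply, mul_comm (xAt D _ i)]
    rw [Pi.smul_apply, Pi.add_apply, h_left, hw, ← Finset.expect_add_distrib, smul_eq_mul,
      Finset.card_mul_expect, Finset.sum_apply]
    exact Finset.sum_congr rfl fun j _ => by rw [Pi.smul_apply, smul_eq_mul]; ring
  have h_unit : IsUnit ((I.card : ℝ) • G).det := by
    rw [Matrix.det_smul]
    exact (mul_ne_zero (pow_ne_zero _ h_card) hdet).isUnit
  rw [ols, h_sum, ← h_normal, Matrix.mulVec_mulVec, Matrix.nonsing_inv_mul _ h_unit,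
    Matrix.one_mulVec, add_sub_cancel_left]

/-- The empirical value of the moments of arm `z` at time `t`. -/
noncomputable def ArmMoments.empirical (θ : Params d) (D : ℕ → Obs d) (z : Fin 2) (t : ℕ) :
    ArmMoments d :=
  (fun i k => 𝔼 j ∈ Finset.Icc 1 t, xAt D j i * xAt D j k,
    fun i => 𝔼 j ∈ Finset.Icc 1 t, xAt D j i * (sAt D j z - θ.αS z ⬝ᵥ xAt D j),
    fun a b => 𝔼 j ∈ arm D z t, obsFeature θ z (D j) a * obsFeature θ z (D j) b)

open ArmMoments

variable {θ : Params d} {D : ℕ → Obs d} {z : Fin 2} {t : ℕ}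

theorem αSHat_sub_eq (ht : (Finset.Icc 1 t).Nonempty) (hdet : (empirical θ D z t).gram.det ≠ 0) :
    αSHat D z t - θ.αS z = (empirical θ D z t).αSErr :=
  ols_sub_eq D ht _ _ hdet

theorem αYHat_sub_eq (harm : (arm D z t).Nonempty)
    (hdet : (empirical θ D z t).armGram.det ≠ 0) :
    αYHat D z t - θ.αY z = (empirical θ D z t).αYErr :=
  ols_sub_eq D harm _ _ hdet

theorem expect_residual_eq_residualMoment (p q : FeatureIndex d) (a b : Fin d → ℝ) :
    𝔼 j ∈ arm D z t, (obsFeature θ z (D j) p - a ⬝ᵥ xAt D j)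
        * (obsFeature θ z (D j) q - b ⬝ᵥ xAt D j) =
      (empirical θ D z t).residualMoment p q a b :=
  expect_residual_mul_residual (arm D z t) a b (xAt D) _ _

theorem γHat_eq_expect_div_expect (harm : (arm D z t).Nonempty) :
    γHat D z t =
      (𝔼 j ∈ arm D z t, (yAt D j - αYHat D z t ⬝ᵥ xAt D j)
        * (sAt D j z - αSHat D z t ⬝ᵥ xAt D j)) /
      𝔼 j ∈ arm D z t, (sAt D j z - αSHat D z t ⬝ᵥ xAt D j)
        * (sAt D j z - αSHat D z t ⬝ᵥ xAt D j) := by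
  have h_card : ((arm D z t).card : ℝ) ≠ 0 := Nat.cast_ne_zero.mpr harm.card_ne_zero
  rw [Finset.expect_eq_sum_div_card, Finset.expect_eq_sum_div_card,
    div_div_div_cancel_right₀ h_card, γHat]
  simp only [sq]

theorem σHat_eq_sqrt_expect :
    σHat D z t = √(𝔼 j ∈ arm D z t, (yAt D j - αYHat D z t ⬝ᵥ xAt D j)
          * (yAt D j - αYHat D z t ⬝ᵥ xAt D j)
        - 2 * γHat D z t * 𝔼 j ∈ arm D z t, (yAt D j - αYHat D z t ⬝ᵥ xAt D j)
          * (sAt D j z - αSHat D z t ⬝ᵥ xAt D j)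
        + γHat D z t ^ 2 * 𝔼 j ∈ arm D z t, (sAt D j z - αSHat D z t ⬝ᵥ xAt D j)
          * (sAt D j z - αSHat D z t ⬝ᵥ xAt D j)) := by
  rw [σHat, ← Finset.expect_eq_sum_div_card, Finset.mul_expect, Finset.mul_expect,
    ← Finset.expect_sub_distrib, ← Finset.expect_add_distrib]
  refine congrArg Real.sqrt (Finset.expect_congr rfl fun j _ => ?_)
  simp only [μHat, sub_dotProduct, smul_dotProduct, smul_eq_mul]
  ring

theorem estimates_empirical (ht : (Finset.Icc 1 t).Nonempty) (harm : (arm D z t).Nonempty)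
    (hdet : (empirical θ D z t).gram.det ≠ 0) (hdet' : (empirical θ D z t).armGram.det ≠ 0) :
    (empirical θ D z t).estimates z =
      (αYHat D z t - γHat D z t • αSHat D z t + γHat D z t • θ.αS z - θ.αY z,
        γHat D z t, σHat D z t) := by
  have h_y : ∀ j, yAt D j - αYHat D z t ⬝ᵥ xAt D j =
      obsFeature θ z (D j) (Sum.inr (Sum.inr ())) - (empirical θ D z t).αYErr ⬝ᵥ xAt D j :=
    fun j => by
      rw [← αYHat_sub_eq harm hdet', sub_dotProduct]
      change _ = yAt D j - θ.αY z ⬝ᵥ xAt D j - _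
      ring
  have h_s : ∀ j, sAt D j z - αSHat D z t ⬝ᵥ xAt D j =
      obsFeature θ z (D j) (Sum.inr (Sum.inl z)) - (empirical θ D z t).αSErr ⬝ᵥ xAt D j :=
    fun j => by
      rw [← αSHat_sub_eq ht hdet, sub_dotProduct]
      change _ = sAt D j z - θ.αS z ⬝ᵥ xAt D j - _
      ring
  have hγ : (empirical θ D z t).γHat z = γHat D z t := by
    rw [γHat_eq_expect_div_expect harm]
    simp only [h_y, h_s, expect_residual_eq_residualMoment]
    rfl
  have hσ : √((empirical θ D z t).σSqHat z) = σHat D z t := by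
    rw [σHat_eq_sqrt_expect, ← hγ]
    simp only [h_y, h_s, expect_residual_eq_residualMoment]
    rfl
  rw [estimates, hσ, hγ, ← αSHat_sub_eq ht hdet, ← αYHat_sub_eq harm hdet', smul_sub]
  congr 1
  abel

end EmpiricalMoments

section Accuracy

open ArmMoments

open scoped BigOperators

variable {d : ℕ} {P : Measure (Subject d)} {θ : Params d} {D : ℕ → Obs d} {t : ℕ} {ρ : ℝ}

/-- The empirical moments of the features of both arms at time `t` are within `ρ` of the
population moments; the arm sizes are multiplied out, so that nothing is asserted about an empty
arm. -/
def MomentsClose (P : Measure (Subject d)) (θ : Params d) (D : ℕ → Obs d) (t : ℕ) (ρ : ℝ) : Prop :=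
  ∀ z a b, |∑ j ∈ arm D z t, obsFeature θ z (D j) a * obsFeature θ z (D j) b
    - (arm D z t).card * featureMoment P θ z a b| ≤ (arm D z t).card * ρ

theorem abs_expect_sub_le_iff {ι : Type*} {I : Finset ι} (hI : I.Nonempty) {f : ι → ℝ} {m ρ : ℝ} :
    |𝔼 j ∈ I, f j - m| ≤ ρ ↔ |∑ j ∈ I, f j - I.card * m| ≤ I.card * ρ := by
  have h_card : (0 : ℝ) < I.card := Nat.cast_pos.mpr hI.card_pos
  rw [← Finset.card_mul_expect, ← mul_sub, abs_mul, abs_of_pos h_card,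
    mul_le_mul_iff_right₀ h_card]

theorem sum_arm_zero_add_sum_arm_one (D : ℕ → Obs d) (t : ℕ) (f : ℕ → ℝ) :
    ∑ j ∈ arm D 0 t, f j + ∑ j ∈ arm D 1 t, f j = ∑ j ∈ Finset.Icc 1 t, f j := by
  have h_arm : arm D 1 t = {j ∈ Finset.Icc 1 t | ¬ zAt D j = 0} :=
    Finset.filter_congr fun j _ => by omega
  rw [← Finset.sum_filter_add_sum_filter_not (Finset.Icc 1 t) fun j => zAt D j = 0, h_arm]
  rfl

theorem card_arm_zero_add_card_arm_one (D : ℕ → Obs d) (t : ℕ) :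
    ((arm D 0 t).card : ℝ) + (arm D 1 t).card = (Finset.Icc 1 t).card := by
  simpa using sum_arm_zero_add_sum_arm_one D t fun _ => 1

namespace MomentsClose

variable (hclose : MomentsClose P θ D t ρ)

include hclose

theorem abs_expect_arm_sub_le {z : Fin 2} (harm : (arm D z t).Nonempty) (a b : FeatureIndex d) :
    |𝔼 j ∈ arm D z t, obsFeature θ z (D j) a * obsFeature θ z (D j) b
      - featureMoment P θ z a b| ≤ ρ :=
  (abs_expect_sub_le_iff harm).mpr (hclose z a b)

theorem abs_expect_Icc_sub_le (ht : (Finset.Icc 1 t).Nonempty) {a b : FeatureIndex d} {f : ℕ → ℝ}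
    {m : ℝ} (hf : ∀ z j, obsFeature θ z (D j) a * obsFeature θ z (D j) b = f j)
    (hm : ∀ z, featureMoment P θ z a b = m) :
    |𝔼 j ∈ Finset.Icc 1 t, f j - m| ≤ ρ := by
  have h0 := hclose 0 a b
  have h1 := hclose 1 a b
  simp only [hf, hm] at h0 h1
  rw [abs_expect_sub_le_iff ht, ← sum_arm_zero_add_sum_arm_one D t f,
    ← card_arm_zero_add_card_arm_one D t]
  rw [abs_le] at *
  constructor <;> linarith [h0.1, h0.2, h1.1, h1.2]

theorem norm_empirical_sub_population_le (harm : ∀ z, (arm D z t).Nonempty) (z : Fin 2) :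
    ‖empirical θ D z t - population P θ z‖ ≤ ρ := by
  have ht : (Finset.Icc 1 t).Nonempty := (harm z).mono (Finset.filter_subset _ _)
  have hρ : 0 ≤ ρ := le_trans (abs_nonneg _)
    (hclose.abs_expect_arm_sub_le (harm z) (Sum.inr (Sum.inr ())) (Sum.inr (Sum.inr ())))
  refine norm_prod_le_iff.mpr ⟨?_, norm_prod_le_iff.mpr ⟨?_, ?_⟩⟩
  · refine (pi_norm_le_iff_of_nonneg hρ).mpr fun i => (pi_norm_le_iff_of_nonneg hρ).mpr fun k => ?_
    exact hclose.abs_expect_Icc_sub_le ht (a := Sum.inl i) (b := Sum.inl k) (fun _ _ => rfl)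
      fun _ => rfl
  · refine (pi_norm_le_iff_of_nonneg hρ).mpr fun i => ?_
    exact hclose.abs_expect_Icc_sub_le ht (a := Sum.inl i) (b := Sum.inr (Sum.inl z))
      (fun _ _ => rfl) fun _ => rfl
  · refine (pi_norm_le_iff_of_nonneg hρ).mpr fun a => (pi_norm_le_iff_of_nonneg hρ).mpr fun b => ?_
    exact hclose.abs_expect_arm_sub_le (harm z) a b

end MomentsClose

/-- The estimates of both arms and the plug-in Neyman allocation `σ̂₁ / (σ̂₁ + σ̂₀)`, as a function
of the moments of the two arms. -/
noncomputable def pluginEstimates (m : Fin 2 → ArmMoments d) :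
    (Fin 2 → (Fin d → ℝ) × ℝ) × ℝ :=
  (fun z => (((m z).estimates z).1, ((m z).estimates z).2.1),
    ((m 1).estimates 1).2.2 / (((m 1).estimates 1).2.2 + ((m 0).estimates 0).2.2))

theorem LinearProjectionModel.differentiableAt_pluginEstimates (h : LinearProjectionModel P θ) :
    DifferentiableAt ℝ pluginEstimates (population P θ) := by
  have h_est : ∀ z, DifferentiableAt ℝ (fun m : Fin 2 → ArmMoments d => (m z).estimates z)
      (population P θ) := fun z =>
    (h.differentiableAt_estimates_population z).comp (f := fun m => m z) (population P θ)
      (differentiableAt_apply z _)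
  have h_sum : ((population P θ 1).estimates 1).2.2 + ((population P θ 0).estimates 0).2.2 ≠ 0 := by
    rw [h.estimates_population, h.estimates_population]
    exact (add_pos (h.σ_pos 1) (h.σ_pos 0)).ne'
  unfold pluginEstimates
  simp only [div_eq_mul_inv]
  exact (differentiableAt_pi.mpr fun z => (h_est z).fst.prodMk (h_est z).snd.fst).prodMk
    ((h_est 1).snd.snd.mul (((h_est 1).snd.snd.add (h_est 0).snd.snd).inv h_sum))

theorem LinearProjectionModel.exists_accuracy (h : LinearProjectionModel P θ) :
    ∃ C r : ℝ, 0 < C ∧ 0 < r ∧ ∀ (D : ℕ → Obs d) (t : ℕ) (ρ : ℝ), ρ ≤ r →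
      (∀ z, (arm D z t).Nonempty) → MomentsClose P θ D t ρ →
      (∀ z i, |(αYHat D z t - γHat D z t • αSHat D z t + γHat D z t • θ.αS z - θ.αY z) i|
        ≤ C * ρ) ∧
      (∀ z, |γHat D z t - θ.γ z| ≤ C * ρ) ∧ |πTilde D (t + 1) - θ.πStar| ≤ C * ρ := by
  have h_det : ∀ᶠ m in nhds (population P θ), ∀ z, (m z).gram.det ≠ 0 ∧ (m z).armGram.det ≠ 0 :=
    Filter.eventually_all.mpr fun z =>
      ((continuous_apply z).tendsto (population P θ)).eventually (h.eventually_gram_det_ne_zero z)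
  obtain ⟨C, r, hC, hr, hbound⟩ :=
    exists_forall_norm_sub_le_of_differentiableAt h.differentiableAt_pluginEstimates h_det
  refine ⟨C, r, hC, hr, fun D t ρ hρ harm hclose => ?_⟩
  have h_close := hclose.norm_empirical_sub_population_le harm
  have hρ0 : 0 ≤ ρ := (norm_nonneg _).trans (h_close 0)
  obtain ⟨h_emp, h_norm⟩ := hbound (fun z => empirical θ D z t) ρ
    ((pi_norm_le_iff_of_nonneg hρ0).mpr h_close) hρ
  have h_est : ∀ z, (empirical θ D z t).estimates z = _ := fun z =>
    estimates_empirical ((harm z).mono (Finset.filter_subset _ _)) (harm z) (h_emp z).1 (h_emp z).2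
  have hCρ : 0 ≤ C * ρ := by positivity
  simp only [pluginEstimates, h_est, h.estimates_population] at h_norm
  obtain ⟨h_arms, h_ratio⟩ := norm_prod_le_iff.mp h_norm
  have h_arm := fun z => norm_prod_le_iff.mp ((pi_norm_le_iff_of_nonneg hCρ).mp h_arms z)
  refine ⟨fun z i => ?_, fun z => (h_arm z).2, ?_⟩
  · simpa using (pi_norm_le_iff_of_nonneg hCρ).mp (h_arm z).1 i
  · rwa [add_comm (θ.σ 1)] at h_ratio

end Accuracy

/-! ### Measurability of the estimators -/

section FeatureMeasurability

variable {d : ℕ} (θ : Params d) (z : Fin 2) (a : FeatureIndex d)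

theorem measurable_obsFeature : Measurable fun o : Obs d => obsFeature θ z o a := by
  have h_lin : ∀ v : Fin d → ℝ, Measurable fun o : Obs d => v ⬝ᵥ o.1 :=
    fun v => measurable_dotProduct measurable_const measurable_fst
  rcases a with i | z' | u <;> simp only [obsFeature, Sum.elim_inl, Sum.elim_inr]
  · fun_prop
  · exact Measurable.sub (by fun_prop) (h_lin _)
  · exact Measurable.sub (by fun_prop) (h_lin _)

theorem measurable_observe : Measurable fun w : Subject d => observe w z := by
  unfold observe
  fun_prop

theorem measurable_feature : Measurable fun w => feature θ z w a :=
  (measurable_obsFeature θ z a).comp (measurable_observe z)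

end FeatureMeasurability

section EstimatorMeasurability

variable {d n : ℕ} {Ω : Type*} [MeasurableSpace Ω]

theorem measurable_sum_of_measurableSet_mem {ι : Type*} {J : Finset ι}
    {I : Ω → Finset ι} (hsub : ∀ ω, I ω ⊆ J) (hI : ∀ j ∈ J, MeasurableSet {ω | j ∈ I ω})
    {f : Ω → ι → ℝ} (hf : ∀ j ∈ J, Measurable fun ω => f ω j) :
    Measurable fun ω => ∑ j ∈ I ω, f ω j := by
  classical
  have h_eq : ∀ ω, ∑ j ∈ I ω, f ω j = ∑ j ∈ J, if j ∈ I ω then f ω j else 0 := fun ω => by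
    rw [Finset.sum_ite_mem, Finset.inter_eq_right.mpr (hsub ω)]
  simp only [h_eq]
  exact Finset.measurable_sum _ fun j hj => Measurable.ite (hI j hj) (hf j hj) measurable_const

theorem measurable_matrix_inv_apply {A : Ω → Matrix (Fin d) (Fin d) ℝ}
    (hA : ∀ i k, Measurable fun ω => A ω i k) (i k : Fin d) :
    Measurable fun ω => (A ω)⁻¹ i k := by
  have hA' : Measurable fun ω => (fun i k => A ω i k : Fin d → Fin d → ℝ) :=
    measurable_pi_iff.mpr fun i => measurable_pi_iff.mpr (hA i)
  have h_det : Continuous fun M : Fin d → Fin d → ℝ => (Matrix.of M).det :=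
    Continuous.matrix_det continuous_id
  have h_adj : Continuous fun M : Fin d → Fin d → ℝ => (Matrix.of M).adjugate i k :=
    (Continuous.matrix_adjugate continuous_id).matrix_elem i k
  simp only [Matrix.inv_def, Ring.inverse_eq_inv', Matrix.smul_apply, smul_eq_mul]
  exact (h_det.measurable.comp hA').inv.mul (h_adj.measurable.comp hA')

variable {D : Ω → ℕ → Obs d} (hD : ∀ j ∈ Finset.Icc 1 n, Measurable fun ω => D ω j) (z : Fin 2)

include hD

theorem measurable_xAt {j : ℕ} (hj : j ∈ Finset.Icc 1 n) : Measurable fun ω => xAt (D ω) j :=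
  (hD j hj).fst

theorem measurable_sAt {j : ℕ} (hj : j ∈ Finset.Icc 1 n) : Measurable fun ω => sAt (D ω) j z :=
  (measurable_pi_apply z).comp (hD j hj).snd.snd.fst

theorem measurable_yAt {j : ℕ} (hj : j ∈ Finset.Icc 1 n) : Measurable fun ω => yAt (D ω) j :=
  (hD j hj).snd.snd.snd

theorem measurableSet_mem_arm {j : ℕ} (hj : j ∈ Finset.Icc 1 n) :
    MeasurableSet {ω | j ∈ arm (D ω) z n} := by
  simp only [arm, Finset.mem_filter, hj, true_and]
  exact (hD j hj).snd.fst (measurableSet_singleton z)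

theorem measurable_sum_arm {f : Ω → ℕ → ℝ}
    (hf : ∀ j ∈ Finset.Icc 1 n, Measurable fun ω => f ω j) :
    Measurable fun ω => ∑ j ∈ arm (D ω) z n, f ω j :=
  measurable_sum_of_measurableSet_mem (fun _ => Finset.filter_subset _ _)
    (fun _ hj => measurableSet_mem_arm hD z hj) hf

theorem measurable_card_arm : Measurable fun ω => ((arm (D ω) z n).card : ℝ) := by
  simpa using measurable_sum_arm hD z (f := fun _ _ => 1) fun _ _ => measurable_const

theorem measurable_ols {I : Ω → Finset ℕ} (hsub : ∀ ω, I ω ⊆ Finset.Icc 1 n)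
    (hI : ∀ j ∈ Finset.Icc 1 n, MeasurableSet {ω | j ∈ I ω}) {r : Ω → ℕ → ℝ}
    (hr : ∀ j ∈ Finset.Icc 1 n, Measurable fun ω => r ω j) :
    Measurable fun ω => ols (D ω) (I ω) (r ω) := by
  have hx : ∀ j ∈ Finset.Icc 1 n, ∀ i, Measurable fun ω => xAt (D ω) j i := fun j hj i =>
    (measurable_pi_apply i).comp (measurable_xAt hD hj)
  refine measurable_pi_iff.mpr fun i => ?_
  simp only [ols, Matrix.mulVec, dotProduct, Finset.sum_apply, Pi.smul_apply, smul_eq_mul]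
  refine Finset.measurable_sum _ fun k _ =>
    (measurable_matrix_inv_apply (fun i k => ?_) i k).mul ?_
  · simp only [Matrix.sum_apply, Matrix.vecMulVec_apply]
    exact measurable_sum_of_measurableSet_mem hsub hI fun j hj => (hx j hj i).mul (hx j hj k)
  · exact measurable_sum_of_measurableSet_mem hsub hI fun j hj => (hr j hj).mul (hx j hj k)

theorem measurable_αSHat : Measurable fun ω => αSHat (D ω) z n :=
  measurable_ols hD (fun _ => subset_rfl)
    (fun _ _ => MeasurableSet.const _) fun _ hj => measurable_sAt hD z hj

theorem measurable_αYHat : Measurable fun ω => αYHat (D ω) z n :=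
  measurable_ols hD (fun _ => Finset.filter_subset _ _)
    (fun _ hj => measurableSet_mem_arm hD z hj) fun _ hj => measurable_yAt hD hj

theorem measurable_γHat : Measurable fun ω => γHat (D ω) z n := by
  have h_y : ∀ j ∈ Finset.Icc 1 n,
      Measurable fun ω => yAt (D ω) j - αYHat (D ω) z n ⬝ᵥ xAt (D ω) j := fun j hj =>
    (measurable_yAt hD hj).sub
      (measurable_dotProduct (measurable_αYHat hD z) (measurable_xAt hD hj))
  have h_s : ∀ j ∈ Finset.Icc 1 n,
      Measurable fun ω => sAt (D ω) j z - αSHat (D ω) z n ⬝ᵥ xAt (D ω) j := fun j hj =>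
    (measurable_sAt hD z hj).sub
      (measurable_dotProduct (measurable_αSHat hD z) (measurable_xAt hD hj))
  exact (measurable_sum_arm hD z fun j hj => (h_y j hj).mul (h_s j hj)).div
    (measurable_sum_arm hD z fun j hj => (h_s j hj).pow_const 2)

theorem measurable_αYHat_sub_γHat_smul_αSHat :
    Measurable fun ω => αYHat (D ω) z n - γHat (D ω) z n • αSHat (D ω) z n :=
  (measurable_αYHat hD z).sub ((measurable_γHat hD z).smul (measurable_αSHat hD z))

theorem measurable_σHat : Measurable fun ω => σHat (D ω) z n := by
  refine Measurable.sqrt ((measurable_sum_arm hD z fun j hj => ?_).div (measurable_card_arm hD z))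
  have h_coef := measurable_αYHat_sub_γHat_smul_αSHat hD z
  exact ((measurable_yAt hD hj).sub ((measurable_dotProduct h_coef (measurable_xAt hD hj)).add
    ((measurable_γHat hD z).mul (measurable_sAt hD z hj)))).pow_const 2

theorem measurable_πClip (η : ℝ) : Measurable fun ω => πClip (D ω) η (n + 1) := by
  have h0 := measurable_σHat hD 0
  have h1 := measurable_σHat hD 1
  simp only [πClip, πTilde, Nat.add_sub_cancel]
  fun_prop

end EstimatorMeasurability

/-! ### Clipping -/

section Clip

variable {d : ℕ}

theorem ζ_pos (η : ℝ) {t : ℕ} (ht : 1 ≤ t) : 0 < ζ η t := by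
  have : (0 : ℝ) < t := by exact_mod_cast ht
  unfold ζ
  positivity

theorem ζ_le_half {η : ℝ} (hη : 0 < η) {t : ℕ} (ht : 1 ≤ t) : ζ η t ≤ 1 / 2 := by
  have h_pow : (t : ℝ) ^ (-η) ≤ 1 :=
    Real.rpow_le_one_of_one_le_of_nonpos (by exact_mod_cast ht) (neg_nonpos.mpr hη.le)
  unfold ζ
  linarith

theorem πClip_pos (D : ℕ → Obs d) (η : ℝ) {t : ℕ} (ht : 1 ≤ t) : 0 < πClip D η t :=
  (ζ_pos η ht).trans_le (le_max_left _ _)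

theorem πClip_lt_one (D : ℕ → Obs d) {η : ℝ} (hη : 0 < η) {t : ℕ} (ht : 1 ≤ t) :
    πClip D η t < 1 :=
  max_lt (by linarith [ζ_le_half hη ht])
    ((min_le_right _ _).trans_lt (by linarith [ζ_pos η ht]))

theorem abs_max_min_sub_le {x y l u : ℝ} (hl : l ≤ y) (hu : y ≤ u) :
    |max l (min x u) - y| ≤ |x - y| := by
  have h_clip : max l (min y u) = y := by rw [min_eq_left hu, max_eq_right hl]
  calc |max l (min x u) - y| = |max l (min x u) - max l (min y u)| := by rw [h_clip]
    _ ≤ |min x u - min y u| := by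
      simpa only [max_comm l] using abs_max_sub_max_le_abs (min x u) (min y u) l
    _ ≤ |x - y| := by simpa using abs_min_sub_min_le_max x u y u

theorem abs_πClip_sub_le (D : ℕ → Obs d) (θ : Params d) {η : ℝ} {t : ℕ} (h : ζ η t ≤ θ.πLow) :
    |πClip D η t - θ.πStar| ≤ |πTilde D t - θ.πStar| := by
  have h_lower : θ.πLow ≤ θ.πStar := min_le_left _ _
  have h_upper : θ.πLow ≤ 1 - θ.πStar := min_le_right _ _
  exact abs_max_min_sub_le (h.trans h_lower) (by linarith)

theorem ζ_le_of_one_div_rpow_le {η p : ℝ} (hη : 0 < η) (hp : 0 < p) {t : ℕ}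
    (h : 1 / (2 * p) ^ (1 / η) ≤ t) : ζ η t ≤ p := by
  have hq : 0 < (2 * p) ^ (1 / η) := Real.rpow_pos_of_pos (by linarith) _
  have ht : (0 : ℝ) < t := (one_div_pos.mpr hq).trans_le h
  have h_pow : 1 / (2 * p) ≤ (t : ℝ) ^ η := by
    have := Real.rpow_le_rpow (one_div_pos.mpr hq).le h hη.le
    rwa [Real.div_rpow zero_le_one hq.le, Real.one_rpow, ← Real.rpow_mul (by linarith),
      one_div_mul_cancel hη.ne', Real.rpow_one] at this
  have h_inv : ((t : ℝ) ^ η)⁻¹ ≤ 2 * p := by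
    rw [inv_le_comm₀ (Real.rpow_pos_of_pos ht _) (by linarith), ← one_div]
    exact h_pow
  rw [ζ, Real.rpow_neg ht.le]
  linarith

end Clip

/-! ### The martingales of the design -/

section Increments

variable {d : ℕ}

/-- The conditional probability of treatment at stage `t`, given the history and the unit. -/
noncomputable def treatProb (D : ℕ → Obs d) (η : ℝ) (T₀ t : ℕ) : ℝ :=
  if t ≤ T₀ then (if Odd t then 0 else 1) else πClip D η t

/-- The conditional probability of arm `z` at stage `t`, given the history and the unit. -/
noncomputable def armProb (D : ℕ → Obs d) (η : ℝ) (T₀ : ℕ) (z : Fin 2) (t : ℕ) : ℝ :=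
  if z = 1 then treatProb D η T₀ t else 1 - treatProb D η T₀ t

/-- The centred product of two features of the unit of stage `j`, if that unit is in arm `z`. -/
noncomputable def momentIncrement (P : Measure (Subject d)) (θ : Params d) (D : ℕ → Obs d)
    (z : Fin 2) (a b : FeatureIndex d) (j : ℕ) : ℝ :=
  if zAt D j = z then
    obsFeature θ z (D j) a * obsFeature θ z (D j) b - featureMoment P θ z a b
  else 0

/-- The centred indicator of arm `z` at stage `j`. -/
noncomputable def armIncrement (D : ℕ → Obs d) (η : ℝ) (T₀ : ℕ) (z : Fin 2) (j : ℕ) : ℝ :=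
  (if zAt D j = z then 1 else 0) - armProb D η T₀ z j

/-- The increments of the martingales that control the estimators: the moments of the features of
each arm, and the arm sizes. -/
noncomputable def increment (P : Measure (Subject d)) (θ : Params d) (D : ℕ → Obs d) (η : ℝ)
    (T₀ : ℕ) : (Fin 2 × FeatureIndex d × FeatureIndex d) ⊕ Fin 2 → ℕ → ℝ :=
  Sum.elim (fun i => momentIncrement P θ D i.1 i.2.1 i.2.2) (armIncrement D η T₀)

/-- At time `n`, all the martingales are within `κ √(n L)`; here `L = log T` is the order of the
deviations that a union bound over the stages allows. -/
def Concentrated (P : Measure (Subject d)) (θ : Params d) (D : ℕ → Obs d) (η : ℝ) (T₀ : ℕ)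
    (κ L : ℝ) (n : ℕ) : Prop :=
  ∀ i, |∑ j ∈ Finset.Icc 1 n, increment P θ D η T₀ i j| < κ * √(n * L)

theorem treatProb_mem_Icc (D : ℕ → Obs d) {η : ℝ} (hη : 0 < η) (T₀ : ℕ) {t : ℕ} (ht : 1 ≤ t) :
    treatProb D η T₀ t ∈ Set.Icc (0 : ℝ) 1 := by
  unfold treatProb
  split_ifs
  · simp
  · simp
  · exact ⟨(πClip_pos D η ht).le, (πClip_lt_one D hη ht).le⟩

theorem armProb_mem_Icc (D : ℕ → Obs d) {η : ℝ} (hη : 0 < η) (T₀ : ℕ) (z : Fin 2) {t : ℕ}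
    (ht : 1 ≤ t) : armProb D η T₀ z t ∈ Set.Icc (0 : ℝ) 1 := by
  unfold armProb
  split_ifs
  · exact treatProb_mem_Icc D hη T₀ ht
  · exact Set.Icc.mem_iff_one_sub_mem.mp (treatProb_mem_Icc D hη T₀ ht)

end Increments

section Design

variable {d : ℕ} {Ω : Type*} {W : ℕ → Ω → Subject d} {Z : ℕ → Ω → Fin 2}

theorem history_mono (W : ℕ → Ω → Subject d) (Z : ℕ → Ω → Fin 2) : Monotone (history W Z) :=
  fun _ _ hst => biSup_mono fun _ hj => Finset.Icc_subset_Icc_right hst hj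

theorem measurable_data_history {j t : ℕ} (hj : j ∈ Finset.Icc 1 t) :
    Measurable[history W Z t] fun ω => data W Z ω j :=
  measurable_iff_comap_le.mpr (le_iSup₂_of_le j hj le_rfl)

section Measurability

variable (η : ℝ) (T₀ : ℕ) (z : Fin 2) {j : ℕ} (hj : 1 ≤ j)

include hj

theorem measurable_treatProb :
    Measurable[history W Z (j - 1)] fun ω => treatProb (data W Z ω) η T₀ j := by
  obtain ⟨n, rfl⟩ := Nat.exists_eq_add_of_le' hj
  unfold treatProb
  split_ifs
  · exact measurable_const
  · exact measurable_const
  · exact @measurable_πClip d n Ω (history W Z n) _ (fun _ hj => measurable_data_history hj) η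

theorem measurable_armProb :
    Measurable[history W Z (j - 1)] fun ω => armProb (data W Z ω) η T₀ z j := by
  have h_treat := measurable_treatProb (W := W) (Z := Z) η T₀ hj
  unfold armProb
  split_ifs
  · exact h_treat
  · exact measurable_const.sub h_treat

theorem measurable_ite_zAt {f : Obs d → ℝ} (hf : Measurable f) :
    Measurable[history W Z j] fun ω =>
      if zAt (data W Z ω) j = z then f (data W Z ω j) else 0 := by
  have h_arm : MeasurableSet {o : Obs d | o.2.1 = z} :=
    measurable_snd.fst (measurableSet_singleton z)
  exact (Measurable.ite h_arm hf measurable_const).comp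
    (measurable_data_history (Finset.mem_Icc.mpr ⟨hj, le_rfl⟩))

theorem measurable_increment (P : Measure (Subject d)) (θ : Params d)
    (i : (Fin 2 × FeatureIndex d × FeatureIndex d) ⊕ Fin 2) :
    Measurable[history W Z j] fun ω => increment P θ (data W Z ω) η T₀ i j := by
  rcases i with ⟨z, a, b⟩ | z
  · exact measurable_ite_zAt z hj
      (((measurable_obsFeature θ z a).mul (measurable_obsFeature θ z b)).sub_const _)
  · exact (measurable_ite_zAt z hj measurable_const).sub
      ((measurable_armProb η T₀ z hj).mono (history_mono W Z (Nat.sub_le _ _)) le_rfl)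

end Measurability

namespace IsDesign

variable [m0 : MeasurableSpace Ω] {μ : Measure Ω} {P : Measure (Subject d)} {η : ℝ} {T T₀ : ℕ}

theorem measurable_data (h : IsDesign μ P η T T₀ W Z) {j : ℕ} (hj : j ∈ Finset.Icc 1 T) :
    Measurable fun ω => data W Z ω j := by
  have hW := h.meas_W j hj
  have hZ := h.meas_Z j hj
  have h_obs : Measurable fun p : Subject d × Fin 2 => observe p.1 p.2 :=
    measurable_from_prod_countable_left measurable_observe
  exact h_obs.comp (hW.prodMk hZ)

theorem history_le (h : IsDesign μ P η T T₀ W Z) {t : ℕ} (ht : t ≤ T) : history W Z t ≤ m0 :=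
  iSup₂_le fun _ hj => (h.measurable_data (Finset.Icc_subset_Icc_right ht hj)).comap_le

theorem history_sub_one_le (h : IsDesign μ P η T T₀ W Z) {t : ℕ} (ht : t ∈ Finset.Icc 1 T) :
    history W Z (t - 1) ≤ m0 :=
  h.history_le ((Nat.sub_le _ _).trans (Finset.mem_Icc.mp ht).2)

theorem history_sup_comap_le (h : IsDesign μ P η T T₀ W Z) {t : ℕ} (ht : t ∈ Finset.Icc 1 T) :
    history W Z (t - 1) ⊔ MeasurableSpace.comap (W t) inferInstance ≤ m0 :=
  sup_le (h.history_sub_one_le ht) (h.meas_W t ht).comap_le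

variable [IsProbabilityMeasure μ]

theorem condExp_treat (h : IsDesign μ P η T T₀ W Z) {t : ℕ} (ht : t ∈ Finset.Icc 1 T) :
    μ[(Z t ⁻¹' {1}).indicator (fun _ => (1 : ℝ)) |
      history W Z (t - 1) ⊔ MeasurableSpace.comap (W t) inferInstance]
      =ᵐ[μ] fun ω => treatProb (data W Z ω) η T₀ t := by
  by_cases h_init : t ≤ T₀
  · have h_ind : (Z t ⁻¹' {1}).indicator (fun _ => (1 : ℝ))
        = fun _ => if Odd t then (0 : ℝ) else 1 := by
      ext ω
      by_cases ho : Odd t <;> simp [Set.indicator, h.init t ht h_init ω, ho]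
    rw [h_ind, condExp_const (h.history_sup_comap_le ht)]
    exact ae_of_all _ fun ω => (if_pos h_init).symm
  · refine (h.assign t ht (not_le.mp h_init)).trans (ae_of_all _ fun ω => ?_)
    simp only [action, treatProb, if_neg h_init]

theorem condExp_arm (h : IsDesign μ P η T T₀ W Z) {t : ℕ} (ht : t ∈ Finset.Icc 1 T) (z : Fin 2) :
    μ[(Z t ⁻¹' {z}).indicator (fun _ => (1 : ℝ)) |
      history W Z (t - 1) ⊔ MeasurableSpace.comap (W t) inferInstance]
      =ᵐ[μ] fun ω => armProb (data W Z ω) η T₀ z t := by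
  obtain rfl | rfl : z = 1 ∨ z = 0 := by omega
  · exact h.condExp_treat ht
  · have h_compl : Z t ⁻¹' {0} = (Z t ⁻¹' {1})ᶜ := by
      ext ω
      simp only [Set.mem_preimage, Set.mem_singleton_iff, Set.mem_compl_iff]
      omega
    rw [h_compl]
    exact condExp_indicator_compl (h.history_sup_comap_le ht)
      (h.meas_Z t ht (measurableSet_singleton 1)) (h.condExp_treat ht)

theorem condSubExponential_momentIncrement (h : IsDesign μ P η T T₀ W Z) (hη : 0 < η)
    (θ : Params d) {z : Fin 2} {a b : FeatureIndex d} {V r : ℝ} (hV : 0 ≤ V)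
    (hmgf : ∀ lam : ℝ, |lam| ≤ r → ∫⁻ w, ENNReal.ofReal (Real.exp (lam *
      (feature θ z w a * feature θ z w b - featureMoment P θ z a b))) ∂P
        ≤ ENNReal.ofReal (Real.exp (V * lam ^ 2)))
    {j : ℕ} (hj : j ∈ Finset.Icc 1 T) :
    CondSubExponential μ (history W Z (j - 1))
      (fun ω => momentIncrement P θ (data W Z ω) z a b j) V r := by
  classical
  have hj1 := (Finset.mem_Icc.mp hj).1
  have h_feature : Measurable fun w : Subject d =>
      feature θ z w a * feature θ z w b - featureMoment P θ z a b :=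
    ((measurable_feature θ z a).mul (measurable_feature θ z b)).sub_const _
  have h_eq : (fun ω => momentIncrement P θ (data W Z ω) z a b j) = fun ω =>
      if ω ∈ Z j ⁻¹' {z} then feature θ z (W j ω) a * feature θ z (W j ω) b
        - featureMoment P θ z a b else 0 := by
    ext ω
    refine ite_congr rfl (fun hz => ?_) fun _ => rfl
    have hz : Z j ω = z := hz
    simp only [data, hz, feature]
  rw [h_eq]
  exact CondSubExponential.ite_comp (h.history_sub_one_le hj) (h.meas_W j hj)
    (h.indep_history j hj) (h.meas_Z j hj (measurableSet_singleton z))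
    (measurable_armProb η T₀ z hj1) (fun ω => armProb_mem_Icc _ hη T₀ z hj1) (h.condExp_arm hj z)
    h_feature hV (by rwa [h.law j hj])

theorem condSubExponential_armIncrement (h : IsDesign μ P η T T₀ W Z) (hη : 0 < η) (z : Fin 2)
    {j : ℕ} (hj : j ∈ Finset.Icc 1 T) :
    CondSubExponential μ (history W Z (j - 1))
      (fun ω => armIncrement (data W Z ω) η T₀ z j) 1 1 := by
  classical
  have hj1 := (Finset.mem_Icc.mp hj).1
  have h_eq : (fun ω => armIncrement (data W Z ω) η T₀ z j)
      = fun ω => (if ω ∈ Z j ⁻¹' {z} then 1 else 0) - armProb (data W Z ω) η T₀ z j := by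
    ext ω
    exact congrArg (· - armProb (data W Z ω) η T₀ z j) (if_congr Iff.rfl rfl rfl)
  rw [h_eq]
  exact CondSubExponential.indicator_sub le_sup_left (h.history_sup_comap_le hj)
    (h.meas_Z j hj (measurableSet_singleton z)) (measurable_armProb η T₀ z hj1)
    (fun ω => armProb_mem_Icc _ hη T₀ z hj1) (h.condExp_arm hj z)

end IsDesign

end Design

section Concentration

variable {d : ℕ} {P : Measure (Subject d)} {θ : Params d}

namespace LinearProjectionModel

theorem finitePsiTwo_feature (h : LinearProjectionModel P θ) (z : Fin 2) (a : FeatureIndex d) :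
    FinitePsiTwo P fun w => feature θ z w a := by
  rcases a with i | z' | _
  · exact h.psi_x i
  · exact h.psi_εS z'
  · exact h.psi_εY z

variable [IsProbabilityMeasure P]

theorem exists_lintegral_exp_feature_le (h : LinearProjectionModel P θ) :
    ∃ K : ℝ, 1 ≤ K ∧ ∀ z a b, ∀ lam : ℝ, |lam| ≤ K⁻¹ →
      ∫⁻ w, ENNReal.ofReal (Real.exp (lam *
        (feature θ z w a * feature θ z w b - featureMoment P θ z a b))) ∂P
        ≤ ENNReal.ofReal (Real.exp (K * lam ^ 2)) := by
  have h_each : ∀ z a b, ∀ᶠ K : ℝ in Filter.atTop, ∀ lam : ℝ, |lam| ≤ K⁻¹ →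
      ∫⁻ w, ENNReal.ofReal (Real.exp (lam *
        (feature θ z w a * feature θ z w b - featureMoment P θ z a b))) ∂P
        ≤ ENNReal.ofReal (Real.exp (K * lam ^ 2)) := by
    intro z a b
    have ha := measurable_feature θ z a
    have hb := measurable_feature θ z b
    have h_int : Integrable (fun w => feature θ z w a * feature θ z w b) P :=
      ((h.finitePsiTwo_feature z a).memLp ha.aemeasurable).integrable_mul
        ((h.finitePsiTwo_feature z b).memLp hb.aemeasurable)
    have h_mean : ∫ w, (feature θ z w a * feature θ z w b - featureMoment P θ z a b) ∂P = 0 := by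
      rw [integral_sub h_int (integrable_const _)]
      simp [featureMoment]
    obtain ⟨r, hr, h_exp⟩ := (h.finitePsiTwo_feature z a).exists_integrable_exp_mul_abs_sub
      ha.aemeasurable hb.aemeasurable (h.finitePsiTwo_feature z b) (featureMoment P θ z a b)
    obtain ⟨V, -, hV⟩ := exists_lintegral_exp_mul_le
      ((ha.mul hb).sub_const _).aemeasurable hr h_exp h_mean
    filter_upwards [Filter.eventually_ge_atTop V, Filter.eventually_ge_atTop (r / 2)⁻¹]
      with K hVK hrK lam hlam
    have hlam' : |lam| ≤ r / 2 := hlam.trans (inv_le_of_inv_le₀ (half_pos hr) hrK)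
    exact (hV lam hlam').trans (by gcongr)
  simp only [← Filter.eventually_all] at h_each
  obtain ⟨K, hK, hK1⟩ := (h_each.and (Filter.eventually_ge_atTop 1)).exists
  exact ⟨K, hK1, hK⟩

theorem exists_measure_not_concentrated_le (h : LinearProjectionModel P θ) :
    ∃ κ r : ℝ, 0 < κ ∧ 0 < r ∧ ∀ {Ω : Type*} [MeasurableSpace Ω] (μ : Measure Ω)
      [IsProbabilityMeasure μ] (W : ℕ → Ω → Subject d) (Z : ℕ → Ω → Fin 2) (η : ℝ) (T T₀ : ℕ),
      0 < η → 2 ≤ T → 0 < T₀ → √(Real.log T / T₀) ≤ r → IsDesign μ P η T T₀ W Z →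
      μ {ω | ∃ n ∈ Finset.Icc T₀ T, ¬ Concentrated P θ (data W Z ω) η T₀ κ (Real.log T) n}
        ≤ ENNReal.ofReal (2 / T) := by
  obtain ⟨K, hK, hmgf⟩ := h.exists_lintegral_exp_feature_le
  refine ⟨K + (Fintype.card ((Fin 2 × FeatureIndex d × FeatureIndex d) ⊕ Fin 2) + 2), K⁻¹,
    by positivity, by positivity, fun {Ω} _ μ _ W Z η T T₀ hη hT hT₀ hr hD => ?_⟩
  simp only [Concentrated, not_forall, not_lt]
  refine CondSubExponential.measure_exists_sqrt_le_abs_sum_le (history_mono W Z)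
    (fun n hn => hD.history_le hn)
    (fun i j hj => measurable_increment η T₀ (Finset.mem_Icc.mp hj).1 P θ i)
    (fun i j hj => ?_) hT₀ hT hr
  rcases i with ⟨z, a, b⟩ | z
  · exact hD.condSubExponential_momentIncrement hη θ (by linarith) (hmgf z a b) hj
  · exact (hD.condSubExponential_armIncrement hη z hj).mono hK (inv_le_one_of_one_le₀ hK)

end LinearProjectionModel

end Concentration

/-! ### Accuracy along a trajectory -/

section Trajectory

variable {d : ℕ} {P : Measure (Subject d)} {θ : Params d} {D : ℕ → Obs d} {η : ℝ} {T₀ n : ℕ}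

theorem sum_ite_odd_zero_one (m : ℕ) :
    ∑ j ∈ Finset.Icc 1 m, (if Odd j then (0 : ℝ) else 1) = (m - if Odd m then 1 else 0) / 2 := by
  induction m with
  | zero => simp
  | succ m ih =>
    rw [Finset.sum_Icc_succ_top (by omega), ih]
    simp only [Nat.odd_add_one, Nat.cast_succ]
    split_ifs <;> ring

theorem le_sum_armProb_init (D : ℕ → Obs d) (η : ℝ) (T₀ : ℕ) (z : Fin 2) :
    ((T₀ : ℝ) - 1) / 2 ≤ ∑ j ∈ Finset.Icc 1 T₀, armProb D η T₀ z j := by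
  have h_treat : ∑ j ∈ Finset.Icc 1 T₀, treatProb D η T₀ j
      = (T₀ - if Odd T₀ then 1 else 0) / 2 := by
    rw [← sum_ite_odd_zero_one]
    exact Finset.sum_congr rfl fun j hj => if_pos (Finset.mem_Icc.mp hj).2
  by_cases hz : z = 1
  · simp only [armProb, if_pos hz, h_treat]
    split_ifs <;> linarith
  · simp only [armProb, if_neg hz, Finset.sum_sub_distrib, h_treat, Finset.sum_const,
      Nat.card_Icc, Nat.add_sub_cancel, nsmul_eq_mul, mul_one]
    split_ifs <;> linarith

theorem mul_le_sum_armProb {z : Fin 2} {q : ℝ} (hq : q ≤ 1 / 4) (hT₀ : 2 ≤ T₀) (hn : T₀ ≤ n)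
    (hprob : ∀ j ∈ Finset.Ioc T₀ n, q ≤ armProb D η T₀ z j) :
    q * n ≤ ∑ j ∈ Finset.Icc 1 n, armProb D η T₀ z j := by
  have h_two : (2 : ℝ) ≤ T₀ := by exact_mod_cast hT₀
  have h_init : q * T₀ ≤ ∑ j ∈ Finset.Icc 1 T₀, armProb D η T₀ z j := by
    refine le_trans ?_ (le_sum_armProb_init D η T₀ z)
    nlinarith
  have h_rest : q * (n - T₀) ≤ ∑ j ∈ Finset.Ioc T₀ n, armProb D η T₀ z j := by
    have := Finset.card_nsmul_le_sum _ _ _ hprob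
    rwa [Nat.card_Ioc, nsmul_eq_mul, Nat.cast_sub hn, mul_comm] at this
  have h_split : ∑ j ∈ Finset.Icc 1 n, armProb D η T₀ z j
      = ∑ j ∈ Finset.Icc 1 T₀, armProb D η T₀ z j + ∑ j ∈ Finset.Ioc T₀ n, armProb D η T₀ z j :=
    (Finset.sum_Ioc_consecutive _ (Nat.zero_le T₀) hn).symm
  rw [h_split]
  linarith

theorem sum_momentIncrement (P : Measure (Subject d)) (θ : Params d) (D : ℕ → Obs d) (z : Fin 2)
    (a b : FeatureIndex d) (n : ℕ) :
    ∑ j ∈ Finset.Icc 1 n, momentIncrement P θ D z a b j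
      = ∑ j ∈ arm D z n, obsFeature θ z (D j) a * obsFeature θ z (D j) b
        - (arm D z n).card * featureMoment P θ z a b := by
  simp only [momentIncrement]
  rw [← Finset.sum_filter]
  simp [arm, Finset.sum_sub_distrib]

theorem card_arm_eq_sum (D : ℕ → Obs d) (η : ℝ) (T₀ : ℕ) (z : Fin 2) (n : ℕ) :
    ((arm D z n).card : ℝ) = ∑ j ∈ Finset.Icc 1 n, armIncrement D η T₀ z j
      + ∑ j ∈ Finset.Icc 1 n, armProb D η T₀ z j := by
  rw [← Finset.sum_add_distrib]
  simp [armIncrement, arm, Finset.sum_boole]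

theorem sqrt_mul_eq_mul_sqrt_div {x : ℝ} (hx : 0 < x) (L : ℝ) : √(x * L) = x * √(L / x) := by
  rw [← Real.sqrt_sq hx.le, ← Real.sqrt_mul (sq_nonneg x), Real.sqrt_sq hx.le]
  congr 1
  field_simp

namespace Concentrated

variable {κ L c : ℝ}

theorem mul_le_card_arm (h : Concentrated P θ D η T₀ κ L n) (hn : 0 < n) {z : Fin 2}
    (hdev : κ * √(L / n) ≤ c)
    (hprob : 2 * c * n ≤ ∑ j ∈ Finset.Icc 1 n, armProb D η T₀ z j) :
    c * n ≤ (arm D z n).card := by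
  have h_pos : (0 : ℝ) < n := Nat.cast_pos.mpr hn
  have h_sum : |∑ j ∈ Finset.Icc 1 n, armIncrement D η T₀ z j| ≤ c * n := by
    calc _ ≤ κ * √(n * L) := (h (.inr z)).le
      _ = κ * √(L / n) * n := by rw [sqrt_mul_eq_mul_sqrt_div h_pos]; ring
      _ ≤ c * n := by gcongr
  rw [card_arm_eq_sum D η T₀ z n]
  linarith [(abs_le.mp h_sum).1]

theorem momentsClose (h : Concentrated P θ D η T₀ κ L n) (hn : 0 < n) (hκ : 0 ≤ κ) (hc : 0 < c)
    (hcard : ∀ z, c * n ≤ (arm D z n).card) : MomentsClose P θ D n (κ / c * √(L / n)) := by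
  intro z a b
  have h_pos : (0 : ℝ) < n := Nat.cast_pos.mpr hn
  rw [← sum_momentIncrement]
  calc _ ≤ κ * √(n * L) := (h (.inl (z, a, b))).le
    _ = c * n * (κ / c * √(L / n)) := by rw [sqrt_mul_eq_mul_sqrt_div h_pos]; field_simp
    _ ≤ (arm D z n).card * (κ / c * √(L / n)) := by gcongr; exact hcard z

end Concentrated

/-- The estimators computed after stage `n`, and the allocation that they induce at stage `n + 1`,
are within `ρ` of their targets. The regression coefficients are measured through the resulting
coefficients of `X` in `μ̂`, once `S` is replaced by its linear model. -/
def EstimatesWithin (θ : Params d) (D : ℕ → Obs d) (η : ℝ) (n : ℕ) (ρ : ℝ) : Prop :=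
  (∀ z i, |(αYHat D z n - γHat D z n • αSHat D z n + γHat D z n • θ.αS z - θ.αY z) i| ≤ ρ) ∧
    (∀ z, |γHat D z n - θ.γ z| ≤ ρ) ∧ |πClip D η (n + 1) - θ.πStar| ≤ ρ

theorem EstimatesWithin.mem_Icc_πClip {ρ : ℝ} (h : EstimatesWithin θ D η n ρ)
    (hρ : ρ ≤ θ.πLow / 2) : πClip D η (n + 1) ∈ Set.Icc (θ.πLow / 2) (1 - θ.πLow / 2) := by
  have h_lower : θ.πLow ≤ θ.πStar := min_le_left _ _
  have h_upper : θ.πLow ≤ 1 - θ.πStar := min_le_right _ _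
  have h_abs := abs_le.mp (h.2.2.trans hρ)
  constructor <;> linarith

theorem EstimatesWithin.le_armProb {ρ : ℝ} (h : EstimatesWithin θ D η n ρ)
    (hρ : ρ ≤ θ.πLow / 2) (hn : T₀ ≤ n) (z : Fin 2) :
    θ.πLow / 2 ≤ armProb D η T₀ z (n + 1) := by
  obtain ⟨h_lower, h_upper⟩ := h.mem_Icc_πClip hρ
  simp only [armProb, treatProb, if_neg (by omega : ¬ n + 1 ≤ T₀)]
  split_ifs <;> linarith

theorem action_succ_eq (D : ℕ → Obs d) (η : ℝ) (hn : T₀ ≤ n) :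
    action D η T₀ (n + 1) = ⟨πClip D η (n + 1),
      linMean (fun z => αYHat D z n - γHat D z n • αSHat D z n) fun z => γHat D z n⟩ := by
  rw [action, if_neg (by omega)]
  rfl

namespace LinearProjectionModel

theorem exists_estimatesWithin_of_le_card_arm (h : LinearProjectionModel P θ) {κ : ℝ}
    (hκ : 0 < κ) :
    ∃ C ε : ℝ, 0 < C ∧ 0 < ε ∧ ∀ (D : ℕ → Obs d) (η L : ℝ) (T₀ n : ℕ), 0 < η → 0 < n →
      √(L / n) ≤ ε → 1 / (2 * θ.πLow) ^ (1 / η) ≤ n → Concentrated P θ D η T₀ κ L n →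
      (∀ z, θ.πLow / 4 * n ≤ (arm D z n).card) → EstimatesWithin θ D η n (C * √(L / n)) := by
  obtain ⟨A, r, hA, hr, haccuracy⟩ := h.exists_accuracy
  have h_low := h.πLow_pos
  have h_scale : 0 < κ / (θ.πLow / 4) := by positivity
  refine ⟨A * (κ / (θ.πLow / 4)), r / (κ / (θ.πLow / 4)), by positivity, by positivity,
    fun D η L T₀ n hη hn hε hclip hconc hcard => ?_⟩
  have h_arm : ∀ z, (arm D z n).Nonempty := fun z => by
    have : (0 : ℝ) < (arm D z n).card := (by positivity : 0 < θ.πLow / 4 * n).trans_le (hcard z)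
    exact Finset.card_pos.mp (by exact_mod_cast this)
  rw [mul_assoc]
  obtain ⟨hβ, hγ, hπ⟩ := haccuracy D n _ ((le_div_iff₀' h_scale).mp hε) h_arm
    (hconc.momentsClose hn hκ.le (by positivity) hcard)
  have h_ζ : ζ η (n + 1) ≤ θ.πLow :=
    ζ_le_of_one_div_rpow_le hη h_low (hclip.trans (by exact_mod_cast n.le_succ))
  exact ⟨hβ, hγ, (abs_πClip_sub_le D θ h_ζ).trans hπ⟩

/- Strong induction: accurate estimators keep the allocation away from `0` and `1`, hence both arms
growing linearly, and this is what makes the next estimators accurate. -/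
theorem exists_estimatesWithin (h : LinearProjectionModel P θ) {κ : ℝ} (hκ : 0 < κ) :
    ∃ C ε : ℝ, 0 < C ∧ 0 < ε ∧ ∀ (D : ℕ → Obs d) (η L : ℝ) (T T₀ : ℕ), 0 < η → 0 ≤ L → 2 ≤ T₀ →
      √(L / T₀) ≤ ε → 1 / (2 * θ.πLow) ^ (1 / η) ≤ T₀ →
      (∀ n ∈ Finset.Icc T₀ T, Concentrated P θ D η T₀ κ L n) →
      ∀ n ∈ Finset.Icc T₀ T,
        EstimatesWithin θ D η n (C * √(L / n)) ∧ C * √(L / n) ≤ θ.πLow / 2 := by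
  obtain ⟨C, ε, hC, hε, hwithin⟩ := h.exists_estimatesWithin_of_le_card_arm hκ
  have h_low := h.πLow_pos
  refine ⟨C, min ε (min (θ.πLow / 4 / κ) (θ.πLow / 2 / C)), hC, by positivity,
    fun D η L T T₀ hη hL hT₀ hsmall hclip hconc n => ?_⟩
  induction n using Nat.strong_induction_on with
  | _ n ih =>
  intro hn
  have hT₀n := (Finset.mem_Icc.mp hn).1
  have h_cast : (T₀ : ℝ) ≤ n := Nat.cast_le.mpr hT₀n
  have h_small : √(L / n) ≤ min ε (min (θ.πLow / 4 / κ) (θ.πLow / 2 / C)) := by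
    have : (0 : ℝ) < T₀ := Nat.cast_pos.mpr (by omega)
    exact le_trans (by gcongr) hsmall
  simp only [le_min_iff] at h_small
  obtain ⟨h_ε, h_dev, h_half⟩ := h_small
  rw [le_div_iff₀' hκ] at h_dev
  rw [le_div_iff₀' hC] at h_half
  have h_card : ∀ z, θ.πLow / 4 * n ≤ (arm D z n).card := fun z => by
    refine (hconc n hn).mul_le_card_arm (by omega) h_dev ?_
    rw [show 2 * (θ.πLow / 4) = θ.πLow / 2 by ring]
    refine mul_le_sum_armProb (by linarith [θ.πLow_le_half]) hT₀ hT₀n fun j hj => ?_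
    obtain ⟨k, rfl⟩ := Nat.exists_eq_add_of_lt (Finset.mem_Ioc.mp hj).1
    obtain ⟨h_est, h_le⟩ := ih (T₀ + k) (by grind) (by grind)
    exact h_est.le_armProb h_le (Nat.le_add_right _ _) z
  exact ⟨hwithin D η L T₀ n hη (by omega) h_ε (hclip.trans h_cast) (hconc n hn) h_card, h_half⟩

theorem exists_excess_loss_le [IsProbabilityMeasure P] (h : LinearProjectionModel P θ) {κ : ℝ}
    (hκ : 0 < κ) :
    ∃ C ε : ℝ, 0 ≤ C ∧ 0 < ε ∧ ∀ (D : ℕ → Obs d) (η L : ℝ) (T T₀ : ℕ), 0 < η → 0 ≤ L → 2 ≤ T₀ →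
      √(L / T₀) ≤ ε → 1 / (2 * θ.πLow) ^ (1 / η) ≤ T₀ →
      (∀ n ∈ Finset.Icc T₀ T, Concentrated P θ D η T₀ κ L n) →
      ∀ n ∈ Finset.Icc T₀ T,
        loss P (action D η T₀ (n + 1)) - loss P (optAction θ) ≤ C * (L / n) := by
  obtain ⟨A, ε, -, hε, hwithin⟩ := h.exists_estimatesWithin hκ
  obtain ⟨E, hE, hloss⟩ := h.exists_loss_linMean_sub_le
  refine ⟨E * A ^ 2, ε, by positivity, hε, fun D η L T T₀ hη hL hT₀ hsmall hclip hconc n hn => ?_⟩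
  obtain ⟨h_est, h_half⟩ := hwithin D η L T T₀ hη hL hT₀ hsmall hclip hconc n hn
  obtain ⟨h_lower, h_upper⟩ := h_est.mem_Icc_πClip h_half
  rw [action_succ_eq D η (Finset.mem_Icc.mp hn).1]
  calc _ ≤ E * (A * √(L / n)) ^ 2 :=
        hloss _ _ _ _ h_lower (by linarith) h_est.2.2 h_est.1 h_est.2.1
    _ = E * A ^ 2 * (L / n) := by rw [mul_pow, Real.sq_sqrt (by positivity), mul_assoc]

end LinearProjectionModel

end Trajectory

/-! ### The regret -/

section Regret

theorem one_le_log_of_three_le {T : ℕ} (hT : 3 ≤ T) : 1 ≤ Real.log T := by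
  have h_three : (3 : ℝ) ≤ T := Nat.ofNat_le_cast.mpr hT
  rw [Real.le_log_iff_exp_le (by linarith)]
  linarith [Real.exp_one_lt_three]

theorem sum_range_inv_le_one_add_log (N : ℕ) :
    ∑ n ∈ Finset.range N, (n : ℝ)⁻¹ ≤ 1 + Real.log N := by
  obtain _ | m := N
  · simp
  have h_harmonic : ∑ n ∈ Finset.range (m + 1), (n : ℝ)⁻¹ = (harmonic m : ℝ) := by
    simp [Finset.sum_range_succ', harmonic]
  have h_mono : harmonic m ≤ harmonic (m + 1) := by
    rw [harmonic_succ]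
    exact le_add_of_nonneg_right (by positivity)
  rw [h_harmonic]
  exact (Rat.cast_le.mpr h_mono).trans (harmonic_le_one_add_log _)

theorem sum_Icc_le_of_le_div {x : ℕ → ℝ} {I A : ℝ} {T T₀ : ℕ} (hI : 0 ≤ I) (hA : 0 ≤ A)
    (h_init : ∀ t ≤ T₀, x t ≤ I) (h_rest : ∀ n ∈ Finset.Icc T₀ T, x (n + 1) ≤ A / n) :
    ∑ t ∈ Finset.Icc 1 T, x t ≤ T₀ * I + A * (1 + Real.log T) := by
  have h_term : ∀ n ∈ Finset.range T, x (n + 1) ≤ (if n < T₀ then I else 0) + A * (n : ℝ)⁻¹ := by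
    intro n hn
    split_ifs with hnT₀
    · exact (h_init _ hnT₀).trans (le_add_of_nonneg_right (by positivity))
    · rw [zero_add, ← div_eq_mul_inv]
      exact h_rest n (Finset.mem_Icc.mpr ⟨not_lt.mp hnT₀, (Finset.mem_range.mp hn).le⟩)
  have h_card : ((Finset.range T).filter (· < T₀)).card ≤ T₀ := by
    refine (Finset.card_le_card fun n hn => ?_).trans_eq (Finset.card_range T₀)
    exact Finset.mem_range.mpr (Finset.mem_filter.mp hn).2
  calc ∑ t ∈ Finset.Icc 1 T, x t = ∑ n ∈ Finset.range T, x (n + 1) := by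
        rw [Finset.range_eq_Ico, Finset.sum_Ico_add' x 0 T 1]
        rfl
    _ ≤ ∑ n ∈ Finset.range T, ((if n < T₀ then I else 0) + A * (n : ℝ)⁻¹) :=
        Finset.sum_le_sum h_term
    _ = ((Finset.range T).filter (· < T₀)).card * I + A * ∑ n ∈ Finset.range T, (n : ℝ)⁻¹ := by
        rw [Finset.sum_add_distrib, ← Finset.mul_sum, ← Finset.sum_filter, Finset.sum_const,
          nsmul_eq_mul]
    _ ≤ T₀ * I + A * (1 + Real.log T) := by
        gcongr
        exact sum_range_inv_le_one_add_log T

theorem integral_le_of_measure_lt_le {Ω : Type*} {_ : MeasurableSpace Ω} {μ : Measure Ω}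
    [IsProbabilityMeasure μ] {f : Ω → ℝ} (hf : Integrable f μ) {K R q : ℝ} (hK : 0 ≤ K)
    (hR : 0 ≤ R) (hq : 0 ≤ q) (h_tail : μ {ω | K < f ω} ≤ ENNReal.ofReal q)
    (h_max : ∀ᵐ ω ∂μ, f ω ≤ R) : ∫ ω, f ω ∂μ ≤ K + R * q := by
  set S := toMeasurable μ {ω | K < f ω}
  have h_meas : MeasurableSet S := measurableSet_toMeasurable _ _
  have h_ind : Integrable (S.indicator fun _ => R) μ := (integrable_const R).indicator h_meas
  have h_real : μ.real S ≤ q := by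
    rw [measureReal_def, measure_toMeasurable]
    exact ENNReal.toReal_le_of_le_ofReal hq h_tail
  calc ∫ ω, f ω ∂μ ≤ ∫ ω, (K + S.indicator (fun _ => R) ω) ∂μ := by
        refine integral_mono_ae hf ((integrable_const K).add h_ind) ?_
        filter_upwards [h_max] with ω hω
        by_cases h_mem : ω ∈ S
        · simp only [Set.indicator_of_mem h_mem]
          linarith
        · simp only [Set.indicator_of_notMem h_mem, add_zero]
          exact not_lt.mp fun h_lt => h_mem (subset_toMeasurable μ _ h_lt)
    _ = K + R * μ.real S := by
        rw [integral_add (integrable_const K) h_ind, integral_indicator_const R h_meas]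
        simp [mul_comm]
    _ ≤ K + R * q := by gcongr

variable {d : ℕ} {P : Measure (Subject d)} {θ : Params d}

theorem loss_nonneg (P : Measure (Subject d)) (a : Action d) : 0 ≤ loss P a :=
  variance_nonneg _ _

section Pathwise

variable {Ω : Type*} {η : ℝ} {T T₀ : ℕ} {W : ℕ → Ω → Subject d} {Z : ℕ → Ω → Fin 2} {ω : Ω}

theorem regret_eq_sum :
    regret P θ η T T₀ W Z ω = ∑ t ∈ Finset.Icc 1 T,
      (loss P (action (data W Z ω) η T₀ t) - loss P (optAction θ)) := by
  simp [regret, Finset.sum_sub_distrib]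

theorem regret_le_mul {ℓmax : ℝ}
    (h : ∀ t ∈ Finset.Icc 1 T, loss P (action (data W Z ω) η T₀ t) ≤ ℓmax) :
    regret P θ η T T₀ W Z ω ≤ T * (ℓmax - loss P (optAction θ)) := by
  rw [regret_eq_sum]
  refine (Finset.sum_le_card_nsmul _ _ _ fun t ht => sub_le_sub_right (h t ht) _).trans_eq ?_
  simp

end Pathwise

namespace LinearProjectionModel

variable [IsProbabilityMeasure P]

theorem measurable_loss_linMean (h : LinearProjectionModel P θ) {Ω : Type*}
    {_ : MeasurableSpace Ω} {p : Ω → ℝ} {β : Fin 2 → Ω → Fin d → ℝ} {g : Fin 2 → Ω → ℝ}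
    (hp : Measurable p) (hβ : ∀ z, Measurable (β z)) (hg : ∀ z, Measurable (g z))
    (h0 : ∀ ω, 0 < p ω) (h1 : ∀ ω, p ω < 1) :
    Measurable fun ω => loss P ⟨p ω, linMean (fun z => β z ω) fun z => g z ω⟩ := by
  have h_loss := fun ω => loss_eq (a := ⟨p ω, linMean (fun z => β z ω) fun z => g z ω⟩)
    (h0 ω) (h1 ω) (measurable_linMean _ _) (h.memLp_linMean _ _) h.memLp_y
  have h_mean : ∀ z, Measurable fun q : Ω × Subject d =>
      linMean (fun z => β z q.1) (fun z => g z q.1) z q.2.x q.2.s := by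
    intro z
    have := hg z
    unfold linMean
    exact (measurable_dotProduct ((hβ z).comp measurable_fst)
      (measurable_x.comp measurable_snd)).add (by fun_prop)
  have := h_mean 0
  have := h_mean 1
  have h_resid : Measurable fun q : Ω × Subject d =>
      ((1 - p q.1) * (q.2.y 1 - linMean (fun z => β z q.1) (fun z => g z q.1) 1 q.2.x q.2.s)
        + p q.1 * (q.2.y 0 - linMean (fun z => β z q.1) (fun z => g z q.1) 0 q.2.x q.2.s)) ^ 2 := by
    fun_prop
  simp_rw [h_loss]
  exact measurable_const.add (h_resid.stronglyMeasurable.integral_prod_right'.measurable.div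
    (hp.mul (measurable_const.sub hp)))

section Design

variable {Ω : Type*} {_ : MeasurableSpace Ω} {μ : Measure Ω} {η : ℝ} {T T₀ : ℕ}
  {W : ℕ → Ω → Subject d} {Z : ℕ → Ω → Fin 2}

theorem measurable_loss_action (h : LinearProjectionModel P θ) (hη : 0 < η)
    (hdesign : IsDesign μ P η T T₀ W Z) {t : ℕ} (ht : t ∈ Finset.Icc 1 T) :
    Measurable fun ω => loss P (action (data W Z ω) η T₀ t) := by
  obtain ⟨n, rfl⟩ := Nat.exists_eq_add_of_le' (Finset.mem_Icc.mp ht).1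
  by_cases h_init : n + 1 ≤ T₀
  · simp only [action, if_pos h_init, measurable_const]
  have h_data : ∀ j ∈ Finset.Icc 1 n, Measurable fun ω => data W Z ω j := fun j hj =>
    hdesign.measurable_data (by grind)
  simp_rw [action_succ_eq _ _ (by omega : T₀ ≤ n)]
  exact h.measurable_loss_linMean (measurable_πClip h_data η)
    (measurable_αYHat_sub_γHat_smul_αSHat h_data) (measurable_γHat h_data)
    (fun ω => πClip_pos _ η n.succ_pos) (fun ω => πClip_lt_one _ hη n.succ_pos)

theorem integrable_regret [IsFiniteMeasure μ] (h : LinearProjectionModel P θ) (hη : 0 < η)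
    (hdesign : IsDesign μ P η T T₀ W Z) {ℓmax : ℝ}
    (hmax : ∀ᵐ ω ∂μ, ∀ t ∈ Finset.Icc 1 T, loss P (action (data W Z ω) η T₀ t) ≤ ℓmax) :
    Integrable (regret P θ η T T₀ W Z) μ := by
  refine Integrable.sub (integrable_finsetSum _ fun t ht => ?_) (integrable_const _)
  refine Integrable.mono' (integrable_const ℓmax)
    (h.measurable_loss_action hη hdesign ht).aestronglyMeasurable ?_
  filter_upwards [hmax] with ω hω
  rw [Real.norm_of_nonneg (loss_nonneg _ _)]
  exact hω t ht

end Design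

theorem exists_regret_le (h : LinearProjectionModel P θ) {κ : ℝ} (hκ : 0 < κ) :
    ∃ C ε : ℝ, 0 ≤ C ∧ 0 < ε ∧ ∀ {Ω : Type*} (W : ℕ → Ω → Subject d) (Z : ℕ → Ω → Fin 2)
      (η L : ℝ) (T T₀ : ℕ) (ω : Ω), 0 < η → 0 ≤ L → 2 ≤ T₀ → √(L / T₀) ≤ ε →
      1 / (2 * θ.πLow) ^ (1 / η) ≤ T₀ →
      (∀ n ∈ Finset.Icc T₀ T, Concentrated P θ (data W Z ω) η T₀ κ L n) →
      regret P θ η T T₀ W Z ω ≤ C * (T₀ + L * (1 + Real.log T)) := by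
  obtain ⟨E, ε, hE, hε, hexcess⟩ := h.exists_excess_loss_le hκ
  set I := |loss P ⟨1 / 2, fun _ _ _ => 0⟩ - loss P (optAction θ)|
  have hI0 : 0 ≤ I := abs_nonneg _
  refine ⟨max I E, ε, le_max_of_le_left hI0, hε,
    fun W Z η L T T₀ ω hη hL hT₀ hsmall hclip hconc => ?_⟩
  have : 0 ≤ Real.log T := Real.log_natCast_nonneg T
  rw [regret_eq_sum]
  calc _ ≤ T₀ * I + E * L * (1 + Real.log T) := by
        refine sum_Icc_le_of_le_div hI0 (by positivity) (fun t ht => ?_) fun n hn => ?_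
        · rw [action, if_pos ht]
          exact le_abs_self _
        · rw [mul_div_assoc]
          exact hexcess _ η L T T₀ hη hL hT₀ hsmall hclip hconc n hn
    _ ≤ T₀ * max I E + max I E * L * (1 + Real.log T) := by
        gcongr
        · exact le_max_left _ _
        · exact le_max_right _ _
    _ = max I E * (T₀ + L * (1 + Real.log T)) := by ring

theorem exists_measure_lt_regret_le (h : LinearProjectionModel P θ) :
    ∃ c C : ℝ, 0 < c ∧ 0 ≤ C ∧ ∀ {Ω : Type*} [MeasurableSpace Ω] (μ : Measure Ω)
      [IsProbabilityMeasure μ] (W : ℕ → Ω → Subject d) (Z : ℕ → Ω → Fin 2) (η : ℝ) (T T₀ : ℕ),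
      0 < η → 3 ≤ T → c * Real.log T ≤ T₀ → 1 / (2 * θ.πLow) ^ (1 / η) ≤ T₀ →
      IsDesign μ P η T T₀ W Z →
      μ {ω | C * (T₀ + Real.log T * (1 + Real.log T)) < regret P θ η T T₀ W Z ω}
        ≤ ENNReal.ofReal (2 / T) := by
  obtain ⟨κ, r, hκ, hr, hconc⟩ := h.exists_measure_not_concentrated_le
  obtain ⟨C, ε, hC, hε, hregret⟩ := h.exists_regret_le hκ
  set e := min ε r
  have he0 : 0 < e := lt_min hε hr
  refine ⟨2 + (e ^ 2)⁻¹, C, by positivity, hC, fun μ _ W Z η T T₀ hη hT hT₀ hclip hdesign => ?_⟩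
  have h_log := one_le_log_of_three_le hT
  have h_inv : 0 < (e ^ 2)⁻¹ := by positivity
  have h_two : 2 ≤ T₀ := by
    have : (2 : ℝ) ≤ T₀ := by nlinarith
    exact_mod_cast this
  have h_small : √(Real.log T / T₀) ≤ e := by
    rw [Real.sqrt_le_left he0.le, div_le_iff₀ (by positivity), ← inv_mul_le_iff₀ (by positivity)]
    nlinarith
  refine le_trans (measure_mono fun ω hω => ?_) (hconc μ W Z η T T₀ hη (by omega) (by omega)
    (h_small.trans (min_le_right _ _)) hdesign)
  contrapose! hω
  simp only [Set.mem_ofPred_eq, not_exists, not_and, not_not, not_lt] at hω ⊢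
  exact hregret W Z η (Real.log T) T T₀ ω hη (by linarith) h_two (h_small.trans (min_le_left _ _))
    hclip hω

theorem exists_integral_regret_le (h : LinearProjectionModel P θ) :
    ∃ c C : ℝ, 0 < c ∧ 0 ≤ C ∧ ∀ {Ω : Type*} [MeasurableSpace Ω] (μ : Measure Ω)
      [IsProbabilityMeasure μ] (W : ℕ → Ω → Subject d) (Z : ℕ → Ω → Fin 2) (η : ℝ) (T T₀ : ℕ),
      0 < η → 3 ≤ T → c * Real.log T ≤ T₀ → 1 / (2 * θ.πLow) ^ (1 / η) ≤ T₀ →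
      IsDesign μ P η T T₀ W Z → ∀ ℓmax : ℝ, loss P (optAction θ) ≤ ℓmax →
      (∀ᵐ ω ∂μ, ∀ t ∈ Finset.Icc 1 T, loss P (action (data W Z ω) η T₀ t) ≤ ℓmax) →
      ∫ ω, regret P θ η T T₀ W Z ω ∂μ
        ≤ C * (T₀ + Real.log T * (1 + Real.log T)) + 2 * (ℓmax - loss P (optAction θ)) := by
  obtain ⟨c, C, hc, hC, htail⟩ := h.exists_measure_lt_regret_le
  refine ⟨c, C, hc, hC, fun μ _ W Z η T T₀ hη hT hT₀ hclip hdesign ℓmax hopt hmax => ?_⟩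
  have : 0 ≤ Real.log T := Real.log_natCast_nonneg T
  have h_T : (T : ℝ) ≠ 0 := Nat.cast_ne_zero.mpr (by omega)
  refine (integral_le_of_measure_lt_le (h.integrable_regret hη hdesign hmax) (by positivity)
    (mul_nonneg T.cast_nonneg (sub_nonneg.mpr hopt)) (by positivity)
    (htail μ W Z η T T₀ hη hT hT₀ hclip hdesign)
    (hmax.mono fun ω hω => regret_le_mul hω)).trans_eq ?_
  field_simp

end LinearProjectionModel

end Regret

/-! ### The length of the initialization phase -/

section InitLength

theorem C4Order_inv_sq (T : ℕ) : C4Order (T : ℝ)⁻¹ T ^ 2 = 3 * Real.log T := by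
  have h_log : Real.log ((T : ℝ) / (T : ℝ)⁻¹) = 2 * Real.log T := by
    rw [div_inv_eq_mul, ← sq, Real.log_pow, Nat.cast_ofNat]
  rw [C4Order, h_log, Real.sq_sqrt (by positivity)]
  ring

theorem C0_inv_sq_le {T : ℕ} (hT : 3 ≤ T) : C0 (T : ℝ)⁻¹ T ^ 2 ≤ 6 * Real.log T := by
  have h_one := one_le_log_of_three_le hT
  have h_log : Real.log (5.2 / (T : ℝ)⁻¹) = Real.log 5.2 + Real.log T := by
    rw [div_inv_eq_mul, Real.log_mul (by norm_num) (by positivity)]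
  have h_const : Real.log 5.2 ≤ 5.2 - 1 := Real.log_le_sub_one_of_pos (by norm_num)
  have : 0 ≤ Real.log 5.2 := Real.log_nonneg (by norm_num)
  have h_loglog : Real.log (Real.log T) ≤ Real.log T - 1 :=
    Real.log_le_sub_one_of_pos (by linarith)
  have h_loglog_nonneg : 0 ≤ Real.log (Real.log T) := Real.log_nonneg h_one
  rw [C0, h_log, mul_pow, Real.sq_sqrt (by positivity)]
  norm_num
  nlinarith

variable {d : ℕ} {θ : Params d}

theorem one_div_rpow_le_initLength (θ : Params d) (η c0 c4 : ℝ) :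
    1 / (2 * θ.πLow) ^ (1 / η) ≤ initLength θ η c0 c4 :=
  ((le_max_right _ _).trans (le_max_right _ _)).trans (Nat.le_ceil _)

namespace LinearProjectionModel

variable {P : Measure (Subject d)} (h : LinearProjectionModel P θ)

include h

theorem exists_mul_log_le_initLength {c : ℝ} (hc : 0 < c) :
    ∃ c₀ : ℝ, 0 < c₀ ∧ ∀ (η c0 c4 : ℝ) (T : ℕ), c₀ * C4Order (T : ℝ)⁻¹ T ≤ c4 →
      c * Real.log T ≤ initLength θ η c0 c4 := by
  have h_low := h.πLow_pos
  have h_zero := h.σ_pos 0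
  have h_one := h.σ_pos 1
  set A := min (min (θ.σ 0 ^ 4) (θ.σ 1 ^ 4)) (θ.σ 0 ^ 2 * θ.σ 1 ^ 2 * θ.πLow / 2 ^ 5) with hA
  have hA0 : 0 < A := by positivity
  refine ⟨√(A * c), by positivity, fun η c0 c4 T h4 => ?_⟩
  refine le_trans ?_ ((le_max_left _ _).trans (Nat.le_ceil _))
  have h_sq : A * c * (3 * Real.log T) ≤ c4 ^ 2 := by
    rw [← C4Order_inv_sq T, ← Real.sq_sqrt (by positivity : 0 ≤ A * c), ← mul_pow]
    exact pow_le_pow_left₀ (mul_nonneg (Real.sqrt_nonneg _) (Real.sqrt_nonneg _)) h4 2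
  have h_nonneg : 0 ≤ A * c * Real.log T := by positivity
  rw [← hA, le_div_iff₀ hA0]
  linarith

theorem exists_initLength_le (η c₁ : ℝ) :
    ∃ C : ℝ, ∀ (T : ℕ) (c4 : ℝ), 3 ≤ T → 0 ≤ c4 → c4 ≤ c₁ * C4Order (T : ℝ)⁻¹ T →
      initLength θ η (C0 (T : ℝ)⁻¹ T) c4 ≤ C * Real.log T := by
  have h_low := h.πLow_pos
  have h_zero := h.σ_pos 0
  have h_one := h.σ_pos 1
  set A := min (min (θ.σ 0 ^ 4) (θ.σ 1 ^ 4)) (θ.σ 0 ^ 2 * θ.σ 1 ^ 2 * θ.πLow / 2 ^ 5) with hA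
  have hA0 : 0 < A := by positivity
  set u := 1 / (2 * θ.πLow) ^ (1 / η) with hu
  have hu0 : 0 ≤ u := by positivity
  refine ⟨24 * c₁ ^ 2 / A + 96 / θ.πLow ^ 2 + u + 1, fun T c4 hT h0 h4 => ?_⟩
  have h_log := one_le_log_of_three_le hT
  have h_c4 : c4 ^ 2 ≤ 3 * c₁ ^ 2 * Real.log T := by
    calc c4 ^ 2 ≤ (c₁ * C4Order (T : ℝ)⁻¹ T) ^ 2 := by gcongr
      _ = 3 * c₁ ^ 2 * Real.log T := by rw [mul_pow, C4Order_inv_sq T]; ring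
  have h_first : 8 * c4 ^ 2 / A ≤ 24 * c₁ ^ 2 / A * Real.log T := by
    rw [div_mul_eq_mul_div]
    exact div_le_div_of_nonneg_right (by linarith) hA0.le
  have h_second : 16 * C0 (T : ℝ)⁻¹ T ^ 2 / θ.πLow ^ 2 ≤ 96 / θ.πLow ^ 2 * Real.log T := by
    rw [div_mul_eq_mul_div]
    exact div_le_div_of_nonneg_right (by linarith [C0_inv_sq_le hT]) (sq_nonneg _)
  have h_third : u ≤ u * Real.log T := le_mul_of_one_le_right hu0 h_log
  have h_first_nonneg : 0 ≤ 8 * c4 ^ 2 / A := by positivity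
  have h_second_nonneg : 0 ≤ 16 * C0 (T : ℝ)⁻¹ T ^ 2 / θ.πLow ^ 2 := by positivity
  rw [initLength, ← hA, ← hu]
  refine (Nat.ceil_lt_add_one (le_max_of_le_left h_first_nonneg)).le.trans ?_
  rw [← le_sub_iff_add_le]
  refine max_le ?_ (max_le ?_ ?_) <;> linarith

end LinearProjectionModel

end InitLength

end SLOACI

theorem theoremS3_general {d : ℕ} (P : Measure (SLOACI.Subject d)) [IsProbabilityMeasure P]
    (θ : SLOACI.Params d) (h : SLOACI.LinearProjectionModel P θ) :
    ∃ c₀ : ℝ, 0 < c₀ ∧ ∀ η : ℝ, 0 < η → ∀ c₁ : ℝ,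
      ∃ C : ℝ, ∀ T : ℕ, 3 ≤ T → ∀ δ : ℝ, δ = (T : ℝ)⁻¹ →
        ∀ C4 : ℝ, c₀ * SLOACI.C4Order δ T ≤ C4 → C4 ≤ c₁ * SLOACI.C4Order δ T →
        ∀ T₀ : ℕ, T₀ = SLOACI.initLength θ η (SLOACI.C0 δ T) C4 →
        ∀ (Ω : Type*) [MeasurableSpace Ω] (μ : Measure Ω) [IsProbabilityMeasure μ]
          (W : ℕ → Ω → SLOACI.Subject d) (Z : ℕ → Ω → Fin 2),
          SLOACI.IsDesign μ P η T T₀ W Z →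
          ∀ ℓmax : ℝ, SLOACI.loss P (SLOACI.optAction θ) ≤ ℓmax →
            (∀ᵐ ω ∂μ, ∀ t ∈ Finset.Icc 1 T,
              SLOACI.loss P (SLOACI.action (SLOACI.data W Z ω) η T₀ t) ≤ ℓmax) →
            Integrable (SLOACI.regret P θ η T T₀ W Z) μ ∧
              ∫ ω, SLOACI.regret P θ η T T₀ W Z ω ∂μ ≤
                C * Real.log T ^ 2 + 2 * (ℓmax - SLOACI.loss P (SLOACI.optAction θ)) := by
  obtain ⟨c, B, hc, hB, hregret⟩ := h.exists_integral_regret_le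
  obtain ⟨c₀, hc₀, hlower⟩ := h.exists_mul_log_le_initLength hc
  refine ⟨c₀, hc₀, fun η hη c₁ => ?_⟩
  obtain ⟨K, hupper⟩ := h.exists_initLength_le η c₁
  refine ⟨B * (K + 2), ?_⟩
  rintro T hT δ rfl C4 h_ge h_le T₀ rfl Ω _ μ _ W Z hdesign ℓmax hopt hmax
  refine ⟨h.integrable_regret hη hdesign hmax,
    (hregret μ W Z η T _ hη hT (hlower η _ C4 T h_ge)
      (SLOACI.one_div_rpow_le_initLength θ η _ C4) hdesign ℓmax hopt hmax).trans ?_⟩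
  have h_T₀ := hupper T C4 hT ((mul_nonneg hc₀.le (Real.sqrt_nonneg _)).trans h_ge) h_le
  have h_log := SLOACI.one_le_log_of_three_le hT
  rw [mul_assoc]
  gcongr
  nlinarith

theorem theoremS3 {d : ℕ} (P : Measure (SLOACI.Subject d)) [IsProbabilityMeasure P]
    (θ : SLOACI.Params d) (hmodel : SLOACI.LinearModel P θ)
    (herr : SLOACI.SubGaussianErrors P θ) (hcov : SLOACI.CovariateCondition P) :
    ∃ c₀ : ℝ, 0 < c₀ ∧ ∀ η : ℝ, 0 < η → ∀ c₁ : ℝ,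
      ∃ (C : ℝ) (k : ℕ), ∀ T : ℕ, 3 ≤ T → ∀ δ : ℝ, δ = (T : ℝ)⁻¹ →
        ∀ C4 : ℝ, c₀ * SLOACI.C4Order δ T ≤ C4 → C4 ≤ c₁ * SLOACI.C4Order δ T →
        ∀ T₀ : ℕ, T₀ = SLOACI.initLength θ η (SLOACI.C0 δ T) C4 →
        ∀ (Ω : Type*) [MeasurableSpace Ω] (μ : Measure Ω) [IsProbabilityMeasure μ]
          (W : ℕ → Ω → SLOACI.Subject d) (Z : ℕ → Ω → Fin 2),
          SLOACI.IsDesign μ P η T T₀ W Z →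
          ∀ ℓmax : ℝ, SLOACI.loss P (SLOACI.optAction θ) ≤ ℓmax →
            (∀ᵐ ω ∂μ, ∀ t ∈ Finset.Icc 1 T,
              SLOACI.loss P (SLOACI.action (SLOACI.data W Z ω) η T₀ t) ≤ ℓmax) →
            Integrable (SLOACI.regret P θ η T T₀ W Z) μ ∧
              ∫ ω, SLOACI.regret P θ η T T₀ W Z ω ∂μ ≤
                C * (Real.log T ^ 2 * Real.log (Real.log T ^ 2) ^ k)
                  + 2 * (ℓmax - SLOACI.loss P (SLOACI.optAction θ)) := by
  obtain ⟨c₀, hc₀, hbound⟩ :=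
    theoremS3_general P θ (hmodel.linearProjectionModel herr hcov)
  refine ⟨c₀, hc₀, fun η hη c₁ => ?_⟩
  obtain ⟨C, hC⟩ := hbound η hη c₁
  exact ⟨C, 0, by simpa only [pow_zero, mul_one] using hC⟩
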